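/- **Theorem 9.1.** Let $n\ge 2$, let $E_{k,l}$ be the matrix units, and let $\mathfrak u_{k,l}=E_{k,l}$ ($k\ne l$) and $X_k=E_{k,k}-E_{k+1,k+1}$ ($1\le k\le n-1$) be the standard basis of $\mathfrak{sl}(n,\mathbb R)$. Let $P\subset SL(n,\mathbb R)$ be the stabilizer of the line spanned by the first basis vector of $\mathbb R^n$; for $t\in\mathbb R$ and a sign $\pm$ let $\lambda_t^{\pm}$ be the unitary character of $P$ that takes a matrix with upper left entry $a$ to $\varepsilon^{\pm}(a)|a|^{t\sqrt{-1}}$, where $\varepsilon^+=1$ and $\varepsilon^-=\mathrm{sgn}$. Let $\pi_t^\pm=\mathrm{Ind}_P^{SL(n,\mathbb R)}(\lambda_t^\pm)$ be the (normalized) unitarily induced representation, realized on $L^2(\mathbb R^{n-1})$ by $$(\pi_t^\pm(g)f)(x)=\varepsilon^\pm(c)\,|c|^{-n/2-t\sqrt{-1}}f(y/c),\qquad g^{-1}(1,x)^{\mathsf T}=(c,y)^{\mathsf T}.$$ A vector $v$ is smooth if $g\mapsto\pi_t^\pm(g)v$ is $C^\infty$. Elements of the Lie algebra act on smooth vectors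 by the derived representation. For a unitary representation and an integer $k\ge0$ put $\|v\|_k^2=\sum_{0\le m\le k}\sum\|Y_{j_1}\cdots Y_{j_m}v\|^2$ (inner sum over all words of length $m$ in the above basis); for $r=k+\theta$ with $0<\theta<1$ let $\|v\|_r$ be the quadratic interpolation norm between $\|\cdot\|_k$ and $\|\cdot\|_{k+1}$, that is, $$\|v\|_r^2=\frac{2\sin\pi\theta}{\pi}\int_0^\infty\tau^{-2\theta-1}\inf_{w\ \mathrm{smooth}}\bigl(\|v-w\|_k^2+\tau^2\|w\|_{k+1}^2\bigr)\,d\tau .$$ The operator $(I-\mathfrak u_{j,i}^2)^{s/2}$ is defined by the functional calculus of the skew-adjoint generator of the one-parameter unitary group $\tau\mapsto\pi_t^\pm(\exp(\tau\mathfrak u_{j,i}))$. Let $n\ge i>j\ge1$. 1. For all $s\ge0$, $\sigma\in[0,s+\tfrac12)$, $\lambda\in\mathbb R\setminus\{0\}$ and $C>0$ there is $\delta>0$ such that for every $t$ with $|t|>\delta$ and each sign $\pm$ there are a smooth vector $g$ and a smooth solution $f$ of the twisted equation $$(\mathfrak u_{i,j}+\sqrt{-1}\,\lambda)f=g$$ in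 $\mathrm{Ind}_P^{SL(n,\mathbb R)}(\lambda_t^\pm)$ with $$\|(I-\mathfrak u_{j,i}^2)^{s/2}f\|>C\,\|g\|_{s+\sigma}.$$ 2. Consequently there are no tame estimates for the twisted equation that are uniform in $t$: for every $\lambda\in\mathbb R\setminus\{0\}$ and each sign $\pm$, there is no $r\ge0$ such that for every $s\ge0$ there is a constant $C_s$ with $\|f\|_s\le C_s\|g\|_{s+r}$ for all $t\in\mathbb R$ and all smooth vectors $f,g$ of $\mathrm{Ind}_P^{SL(n,\mathbb R)}(\lambda_t^\pm)$ with $(\mathfrak u_{i,j}+\sqrt{-1}\,\lambda)f=g$. -/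

import Mathlib

open MeasureTheory
open scoped ContDiff

noncomputable section
namespace SLRep
variable {d : ℕ}

/-! ### The degenerate principal series of `SL(d + 1, ℝ)` in the line model

`SL(d + 1, ℝ)` acts on itself from the left, and `P` is the stabilizer of the line spanned by the
first basis vector, i.e. the group of the matrices `p` in `SL(d + 1, ℝ)` with `p k 0 = 0` for
`k ≠ 0`. The matrices `lowUni x` (`x : Fin d → ℝ`) form the unipotent group opposite to `P`, and
almost every matrix is `lowUni y * p` with `p ∈ P` in exactly one way. -/

/-- The vector `(1, x₁, …, x_d)`. -/
def affVec (x : Fin d → ℝ) : Fin (d + 1) → ℝ := Fin.cons 1 x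

/-- The first coordinate of `M (1, x)ᵀ`. -/
def den (M : Matrix (Fin (d + 1)) (Fin (d + 1)) ℝ) (x : Fin d → ℝ) : ℝ :=
  M.mulVec (affVec x) 0

/-- The projective action of `M` in the chart `x ↦ [1 : x]`: if `M (1, x)ᵀ = (c, y)ᵀ`, this is
`y / c`. -/
def proj (M : Matrix (Fin (d + 1)) (Fin (d + 1)) ℝ) (x : Fin d → ℝ) : Fin d → ℝ :=
  fun k => M.mulVec (affVec x) k.succ / den M x

theorem den_eq (M : Matrix (Fin (d + 1)) (Fin (d + 1)) ℝ) (x : Fin d → ℝ) :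
    den M x = M 0 0 + ∑ l : Fin d, M 0 l.succ * x l := by
  simp [den, affVec, Matrix.mulVec, dotProduct, Fin.sum_univ_succ]

theorem mulVec_affVec (M : Matrix (Fin (d + 1)) (Fin (d + 1)) ℝ) (x : Fin d → ℝ)
    (h : den M x ≠ 0) : M.mulVec (affVec x) = den M x • affVec (proj M x) := by
  funext k
  refine Fin.cases ?_ (fun k => ?_) k
  · simp [affVec, den]
  · simp [affVec, proj]
    field_simp

theorem den_mul (N M : Matrix (Fin (d + 1)) (Fin (d + 1)) ℝ) (x : Fin d → ℝ)
    (h : den M x ≠ 0) : den (N * M) x = den M x * den N (proj M x) := by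
  rw [den, ← Matrix.mulVec_mulVec, mulVec_affVec M x h, Matrix.mulVec_smul]
  simp [den]

theorem proj_mul (N M : Matrix (Fin (d + 1)) (Fin (d + 1)) ℝ) (x : Fin d → ℝ)
    (h : den M x ≠ 0) : proj (N * M) x = proj N (proj M x) := by
  funext k
  rw [proj, den_mul N M x h, ← Matrix.mulVec_mulVec, mulVec_affVec M x h, Matrix.mulVec_smul]
  simp [proj, mul_div_mul_left _ _ h]

theorem den_one (x : Fin d → ℝ) : den 1 x = 1 := by simp [den, affVec]
theorem proj_one (x : Fin d → ℝ) : proj 1 x = x := by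
  funext k; simp [proj, den_one, affVec]

theorem measurable_den (M : Matrix (Fin (d + 1)) (Fin (d + 1)) ℝ) : Measurable (den M) := by
  have : den M = fun x => M 0 0 + ∑ l : Fin d, M 0 l.succ * x l := funext (den_eq M)
  rw [this]; fun_prop

theorem mulVec_succ (M : Matrix (Fin (d + 1)) (Fin (d + 1)) ℝ) (x : Fin d → ℝ) (k : Fin (d+1)) :
    M.mulVec (affVec x) k = M k 0 + ∑ l : Fin d, M k l.succ * x l := by
  simp [affVec, Matrix.mulVec, dotProduct, Fin.sum_univ_succ]

theorem measurable_proj (M : Matrix (Fin (d + 1)) (Fin (d + 1)) ℝ) : Measurable (proj M) := by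
  refine measurable_pi_lambda _ fun k => ?_
  simp only [proj, mulVec_succ]
  exact Measurable.div (by fun_prop) (measurable_den M)

theorem ae_den_ne_zero (M : Matrix (Fin (d + 1)) (Fin (d + 1)) ℝ) (hM : M.det ≠ 0) :
    ∀ᵐ x : Fin d → ℝ, den M x ≠ 0 := by
  let A : (Fin d → ℝ) →ᵃ[ℝ] ℝ :=
    (∑ l : Fin d, M 0 l.succ • LinearMap.proj (R := ℝ) (φ := fun _ : Fin d => ℝ) l).toAffineMap
      + AffineMap.const ℝ _ (M 0 0)
  have hA : ∀ x, A x = den M x := by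
    intro x; simp [A, den_eq, add_comm]
  have hset : {x | ¬ den M x ≠ 0} =
      ((AffineSubspace.mk' (0:ℝ) (⊥ : Submodule ℝ ℝ)).comap A : Set (Fin d → ℝ)) := by
    ext x; simp [hA, AffineSubspace.mem_mk']
  rw [ae_iff, hset]
  refine Measure.addHaar_affineSubspace _ _ fun htop => hM ?_
  have h0 : ∀ x, den M x = 0 := by
    intro x
    have : x ∈ {x | ¬ den M x ≠ 0} := by rw [hset, htop]; trivial
    simpa using this
  refine Matrix.det_eq_zero_of_row_eq_zero 0 fun k => ?_
  have h00 : M 0 0 = 0 := by simpa [den_eq] using h0 0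
  refine Fin.cases h00 (fun l => ?_) k
  simpa [den_eq, h00, Pi.single_apply] using h0 (Pi.single l 1)

/-- The Jacobian matrix of `proj M` at `x`. -/
def projDeriv (M : Matrix (Fin (d + 1)) (Fin (d + 1)) ℝ) (x : Fin d → ℝ) :
    Matrix (Fin d) (Fin d) ℝ :=
  Matrix.of fun k l => (M k.succ l.succ - proj M x k * M 0 l.succ) / den M x

theorem hasFDerivAt_proj (M : Matrix (Fin (d + 1)) (Fin (d + 1)) ℝ) (x : Fin d → ℝ)
    (h : den M x ≠ 0) :
    HasFDerivAt (proj M) (LinearMap.toContinuousLinearMap (Matrix.toLin' (projDeriv M x))) x := by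
  rw [hasFDerivAt_pi']
  intro k
  have aff : ∀ i : Fin (d+1), HasFDerivAt (fun x : Fin d → ℝ => M.mulVec (affVec x) i)
      (∑ l : Fin d, M i l.succ • ContinuousLinearMap.proj (R := ℝ) (φ := fun _ : Fin d => ℝ) l) x := by
    intro i
    simp only [mulVec_succ]
    refine HasFDerivAt.const_add _ (HasFDerivAt.fun_sum fun l _ => ?_)
    exact ((ContinuousLinearMap.proj (R := ℝ) (φ := fun _ : Fin d => ℝ) l).hasFDerivAt).const_mul _
  have := (aff k.succ).mul ((hasDerivAt_inv h).comp_hasFDerivAt x (aff 0))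
  refine this.congr_fderiv ?_
  ext v
  simp [Matrix.mulVec, dotProduct, projDeriv, proj, Finset.mul_sum, sub_div, sub_mul,
    Finset.sum_sub_distrib]
  rw [neg_add_eq_sub]
  congr 1 <;> refine Finset.sum_congr rfl fun l _ => ?_ <;> field_simp

/-- The lower unipotent matrix with first column `(1, x)` which is the identity elsewhere. -/
def lowUni (x : Fin d → ℝ) : Matrix (Fin (d + 1)) (Fin (d + 1)) ℝ :=
  Matrix.of fun i => Fin.cons (affVec x i) fun l => if i = l.succ then 1 else 0

theorem det_lowUni (x : Fin d → ℝ) : (lowUni x).det = 1 := by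
  have h0 : ∀ l : Fin d, lowUni x 0 l.succ = 0 := by
    intro l; simp [lowUni, (Fin.succ_ne_zero l).symm]
  have h1 : (lowUni x).submatrix Fin.succ Fin.succ = 1 := by
    ext k l
    simp [lowUni, Matrix.one_apply]
  rw [Matrix.det_succ_row_zero, Fin.sum_univ_succ]
  simp only [h0]
  have h2 : lowUni x 0 0 = 1 := by simp [lowUni, affVec]
  simp [h1, h2]

/-- The decomposition behind the line model: `M * lowUni x = lowUni (proj M x) * p` with `p` in the
stabilizer of the first coordinate line and with corner entry `den M x`. -/
theorem mul_lowUni (M : Matrix (Fin (d + 1)) (Fin (d + 1)) ℝ) (x : Fin d → ℝ)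
    (h : den M x ≠ 0) : ∃ p : Matrix (Fin (d + 1)) (Fin (d + 1)) ℝ,
      M * lowUni x = lowUni (proj M x) * p ∧ p 0 0 = den M x ∧ ∀ k : Fin d, p k.succ 0 = 0 := by
  have hcol : ∀ i, (M * lowUni x) i 0 = den M x * affVec (proj M x) i := by
    intro i
    have : (M * lowUni x) i 0 = M.mulVec (affVec x) i := by
      simp [Matrix.mul_apply, Matrix.mulVec, dotProduct, lowUni]
    rw [this, mulVec_affVec M x h]; simp
  have hinv : lowUni (proj M x) * lowUni (-proj M x) = 1 := by
    ext i j
    refine Fin.cases ?_ (fun k => ?_) i <;> refine Fin.cases ?_ (fun l => ?_) j <;>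
      simp [Matrix.mul_apply, lowUni, Fin.sum_univ_succ, affVec, (Fin.succ_ne_zero _).symm,
        Matrix.one_apply]
  refine ⟨lowUni (-proj M x) * (M * lowUni x), ?_, ?_, fun k => ?_⟩
  · rw [← mul_assoc (lowUni (proj M x)), hinv, one_mul]
  · rw [Matrix.mul_apply, Fin.sum_univ_succ]
    simp only [hcol]
    simp [lowUni, affVec, (Fin.succ_ne_zero _).symm]
  · rw [Matrix.mul_apply, Fin.sum_univ_succ]
    simp only [hcol]
    simp [lowUni, affVec]
    ring

theorem det_projDeriv (M : Matrix (Fin (d + 1)) (Fin (d + 1)) ℝ) (hM : M.det = 1)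
    (x : Fin d → ℝ) (h : den M x ≠ 0) : (projDeriv M x).det = (den M x ^ (d + 1))⁻¹ := by
  set P := lowUni (-proj M x) * (M * lowUni x) with hP
  have hPdet : P.det = 1 := by simp [hP, Matrix.det_mul, det_lowUni, hM]
  have hcol : ∀ i, (M * lowUni x) i 0 = den M x * affVec (proj M x) i := by
    intro i
    have : (M * lowUni x) i 0 = M.mulVec (affVec x) i := by
      simp [Matrix.mul_apply, Matrix.mulVec, dotProduct, lowUni]
    rw [this, mulVec_affVec M x h]; simp
  have hcol' : ∀ i (l : Fin d), (M * lowUni x) i l.succ = M i l.succ := by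
    intro i l
    simp [Matrix.mul_apply, lowUni]
  have hlow : ∀ (N : Matrix (Fin (d + 1)) (Fin (d + 1)) ℝ) (k : Fin d) j,
      (lowUni (-proj M x) * N) k.succ j = N k.succ j - proj M x k * N 0 j := by
    intro N k j
    simp [Matrix.mul_apply, lowUni, Fin.sum_univ_succ, affVec]; ring
  have hrow : ∀ (N : Matrix (Fin (d + 1)) (Fin (d + 1)) ℝ) j,
      (lowUni (-proj M x) * N) 0 j = N 0 j := by
    intro N j
    simp [Matrix.mul_apply, lowUni, Fin.sum_univ_succ, affVec, (Fin.succ_ne_zero _).symm]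
  have hP00 : P 0 0 = den M x := by rw [hP, hrow, hcol]; simp [affVec]
  have hPk0 : ∀ k : Fin d, P k.succ 0 = 0 := by
    intro k
    rw [hP, hlow, hcol, hcol]; simp [affVec]; ring
  have hsub : P.submatrix Fin.succ Fin.succ = den M x • projDeriv M x := by
    ext k l
    simp [hP, hlow, hcol', projDeriv]
    field_simp
  rw [Matrix.det_succ_column_zero, Fin.sum_univ_succ] at hPdet
  simp only [hPk0] at hPdet
  simp only [Fin.succAbove_zero, hP00, hsub, Matrix.det_smul] at hPdet
  simp at hPdet
  refine eq_inv_of_mul_eq_one_right ?_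
  rw [← hPdet]; ring

theorem lintegral_proj (M : Matrix (Fin (d + 1)) (Fin (d + 1)) ℝ) (hM : M.det = 1)
    (F : (Fin d → ℝ) → ENNReal) :
    ∫⁻ x, ENNReal.ofReal ((|den M x| ^ (d + 1))⁻¹) * F (proj M x) = ∫⁻ x, F x := by
  have hU : IsUnit M.det := by simp [hM]
  have hMi : M⁻¹ * M = 1 := Matrix.nonsing_inv_mul M hU
  have hMi' : M * M⁻¹ = 1 := Matrix.mul_nonsing_inv M hU
  have hdet : (M⁻¹).det = 1 := by simp [Matrix.det_nonsing_inv, hM]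
  have key : ∀ N N' : Matrix (Fin (d + 1)) (Fin (d + 1)) ℝ, N' * N = 1 → ∀ x, den N x ≠ 0 →
      den N' (proj N x) ≠ 0 ∧ proj N' (proj N x) = x := by
    intro N N' hN x hx
    have h1 := den_mul N' N x hx
    rw [hN, den_one] at h1
    refine ⟨fun h0 => by simp [h0] at h1, ?_⟩
    rw [← proj_mul N' N x hx, hN, proj_one]
  have hs : MeasurableSet {x : Fin d → ℝ | den M x ≠ 0} :=
    (measurable_den M (measurableSet_singleton 0)).compl
  have himg : proj M '' {x : Fin d → ℝ | den M x ≠ 0} = {x | den M⁻¹ x ≠ 0} := by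
    ext y
    constructor
    · rintro ⟨x, hx, rfl⟩
      exact (key M M⁻¹ hMi x hx).1
    · intro hy
      exact ⟨proj M⁻¹ y, (key M⁻¹ M hMi' y hy).1, (key M⁻¹ M hMi' y hy).2⟩
  have hinj : Set.InjOn (proj M) {x : Fin d → ℝ | den M x ≠ 0} := by
    intro x hx y hy hxy
    rw [← (key M M⁻¹ hMi x hx).2, hxy, (key M M⁻¹ hMi y hy).2]
  have := lintegral_image_eq_lintegral_abs_det_fderiv_mul volume hs
    (fun x hx => (hasFDerivAt_proj M x hx).hasFDerivWithinAt) hinj F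
  have e1 : ({x : Fin d → ℝ | den M x ≠ 0} : Set _) =ᵐ[volume] Set.univ :=
    Filter.eventuallyEq_univ.2 (ae_den_ne_zero M (by simp [hM]))
  have e2 : ({x : Fin d → ℝ | den M⁻¹ x ≠ 0} : Set _) =ᵐ[volume] Set.univ :=
    Filter.eventuallyEq_univ.2 (ae_den_ne_zero M⁻¹ (by simp [hdet]))
  rw [himg, setLIntegral_congr e2, setLIntegral_univ] at this
  rw [this, ← setLIntegral_univ, ← setLIntegral_congr e1]
  refine setLIntegral_congr_fun hs fun x hx => ?_
  congr 2
  rw [ContinuousLinearMap.det]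
  simp [det_projDeriv M hM x hx, abs_inv, abs_pow]

theorem quasi_proj (M : Matrix (Fin (d + 1)) (Fin (d + 1)) ℝ) (hM : M.det = 1) :
    Measure.QuasiMeasurePreserving (proj M) volume volume := by
  refine ⟨measurable_proj M, Measure.AbsolutelyContinuous.mk fun s hs h0 => ?_⟩
  rw [Measure.map_apply (measurable_proj M) hs]
  have h := lintegral_proj M hM (s.indicator 1)
  rw [lintegral_indicator_one hs, h0, lintegral_eq_zero_iff] at h
  · rw [measure_eq_zero_iff_ae_notMem]
    filter_upwards [h, ae_den_ne_zero M (by simp [hM])] with x hx hd hxs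
    have hxs' : proj M x ∈ s := hxs
    have hpos : 0 < (|den M x| ^ (d + 1))⁻¹ := by positivity
    simp [hxs', hd] at hx
  · exact (((measurable_den M).abs.pow_const _).inv.ennreal_ofReal).mul
      ((measurable_one.indicator hs).comp (measurable_proj M))

/-- The unitary character `λ_t^±` of `P`, as a function of the corner entry `a = p 0 0` of `p ∈ P`:
`ε^±(a) |a|^{it}` with `ε^+ = 1` (`odd = false`) and `ε^- = sgn` (`odd = true`). -/
def lineChar (odd : Bool) (t : ℝ) (a : ℝ) : ℂ :=
  (if odd then ((SignType.sign a : ℝ) : ℂ) else 1) * ((|a| : ℝ) : ℂ) ^ ((t : ℂ) * Complex.I)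

/-- The factor `δ_P(p)^{-1/2} λ_t^±(p)⁻¹` as a function of the corner entry `a = p 0 0`. The modular
function of `P` in `SL(n, ℝ)` is `δ_P(p) = |a|^n`, here with `n = d + 1`. -/
def multiplier (d : ℕ) (odd : Bool) (t : ℝ) (a : ℝ) : ℂ :=
  ((|a| ^ (-((d : ℝ) + 1) / 2) : ℝ) : ℂ) * (lineChar odd t a)⁻¹

/-- The function `x ↦ δ_P(p)^{-1/2} λ_t^±(p)⁻¹ f(x')` where `M * lowUni x = lowUni x' * p`,
`p ∈ P`. -/
def indFun (odd : Bool) (t : ℝ) (M : Matrix (Fin (d + 1)) (Fin (d + 1)) ℝ)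
    (f : (Fin d → ℝ) → ℂ) (x : Fin d → ℝ) : ℂ :=
  multiplier d odd t (den M x) * f (proj M x)

theorem lineChar_mul (odd : Bool) (t a b : ℝ) (_ha : a ≠ 0) (_hb : b ≠ 0) :
    lineChar odd t (a * b) = lineChar odd t a * lineChar odd t b := by
  unfold lineChar
  rw [abs_mul, Complex.ofReal_mul, Complex.mul_cpow_ofReal_nonneg (abs_nonneg _) (abs_nonneg _)]
  cases odd <;> simp [sign_mul]; ring

theorem norm_lineChar (odd : Bool) (t a : ℝ) (ha : a ≠ 0) : ‖lineChar odd t a‖ = 1 := by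
  unfold lineChar
  rw [norm_mul, Complex.norm_cpow_eq_rpow_re_of_pos (abs_pos.2 ha)]
  rcases lt_or_gt_of_ne ha with h | h <;> cases odd <;> simp [h]

theorem multiplier_mul (odd : Bool) (t a b : ℝ) (ha : a ≠ 0) (hb : b ≠ 0) :
    multiplier d odd t (a * b) = multiplier d odd t a * multiplier d odd t b := by
  unfold multiplier
  rw [lineChar_mul odd t a b ha hb, abs_mul, Real.mul_rpow (abs_nonneg _) (abs_nonneg _), mul_inv]
  push_cast; ring

theorem norm_multiplier_sq (odd : Bool) (t a : ℝ) (ha : a ≠ 0) :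
    ‖multiplier d odd t a‖ ^ 2 = (|a| ^ (d + 1))⁻¹ := by
  unfold multiplier
  rw [norm_mul, norm_inv, norm_lineChar odd t a ha, inv_one, mul_one, Complex.norm_real,
    Real.norm_of_nonneg (by positivity), ← Real.rpow_natCast, ← Real.rpow_mul (abs_nonneg _),
    ← Real.rpow_natCast, ← Real.rpow_neg (abs_nonneg _)]
  congr 1
  push_cast; ring

theorem measurable_multiplier (odd : Bool) (t : ℝ) : Measurable (multiplier d odd t) := by
  have h : Measurable fun a : ℝ => (SignType.sign a : ℝ) := by
    have : (fun a : ℝ => (SignType.sign a : ℝ)) = fun a => if 0 < a then 1 else if a < 0 then -1 else 0 := by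
      funext a
      rcases lt_trichotomy a 0 with h | h | h <;> simp [h, h.le, not_lt.2]
    rw [this]
    exact Measurable.ite measurableSet_Ioi measurable_const
      (Measurable.ite measurableSet_Iio measurable_const measurable_const)
  unfold multiplier lineChar
  cases odd
  · simp only [Bool.false_eq_true, if_false]; fun_prop
  · simp only [if_true]; fun_prop

/-- The Hilbert space `L²(ℝ^d)` of the line model. -/
abbrev Model (d : ℕ) : Type := Lp ℂ 2 (volume : Measure (Fin d → ℝ))

theorem indFun_congr (odd : Bool) (t : ℝ) (M : Matrix (Fin (d + 1)) (Fin (d + 1)) ℝ)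
    (hM : M.det = 1) {f f' : (Fin d → ℝ) → ℂ} (h : f =ᵐ[volume] f') :
    indFun odd t M f =ᵐ[volume] indFun odd t M f' := by
  filter_upwards [(quasi_proj M hM).ae h] with x hx
  simp [indFun, hx]

theorem aestronglyMeasurable_indFun (odd : Bool) (t : ℝ)
    (M : Matrix (Fin (d + 1)) (Fin (d + 1)) ℝ) (hM : M.det = 1) {f : (Fin d → ℝ) → ℂ}
    (hf : AEStronglyMeasurable f volume) : AEStronglyMeasurable (indFun odd t M f) volume :=
  ((measurable_multiplier odd t).comp (measurable_den M)).aestronglyMeasurable.mul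
    (hf.comp_quasiMeasurePreserving (quasi_proj M hM))

theorem eLpNorm_indFun (odd : Bool) (t : ℝ) (M : Matrix (Fin (d + 1)) (Fin (d + 1)) ℝ)
    (hM : M.det = 1) (f : (Fin d → ℝ) → ℂ) :
    eLpNorm (indFun odd t M f) 2 volume = eLpNorm f 2 volume := by
  rw [eLpNorm_eq_lintegral_rpow_enorm_toReal (by norm_num) (by norm_num),
    eLpNorm_eq_lintegral_rpow_enorm_toReal (by norm_num) (by norm_num),
    ← lintegral_proj M hM fun x => ‖f x‖ₑ ^ ENNReal.toReal 2]
  congr 1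
  refine lintegral_congr_ae ?_
  filter_upwards [ae_den_ne_zero M (by simp [hM])] with x hx
  rw [indFun, enorm_mul, ENNReal.mul_rpow_of_nonneg _ _ (by norm_num),
    ← norm_multiplier_sq (d := d) odd t _ hx]
  congr 1
  rw [← ofReal_norm, ENNReal.toReal_ofNat, ENNReal.rpow_ofNat, ENNReal.ofReal_pow (norm_nonneg _)]

theorem memLp_indFun (odd : Bool) (t : ℝ) (M : Matrix (Fin (d + 1)) (Fin (d + 1)) ℝ)
    (hM : M.det = 1) (f : Model d) : MemLp (indFun odd t M f) 2 volume :=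
  ⟨aestronglyMeasurable_indFun odd t M hM (Lp.memLp f).1, by
    rw [eLpNorm_indFun odd t M hM]; exact (Lp.memLp f).2⟩

/-- The operator `f ↦ indFun odd t M f` on `L²(ℝ^d)`, a linear isometry. -/
def indIsom (odd : Bool) (t : ℝ) (M : Matrix (Fin (d + 1)) (Fin (d + 1)) ℝ) (hM : M.det = 1) :
    Model d →ₗᵢ[ℂ] Model d where
  toFun f := (memLp_indFun odd t M hM f).toLp _
  map_add' f f' := by
    rw [← MemLp.toLp_add, MemLp.toLp_eq_toLp_iff]
    refine (indFun_congr odd t M hM (Lp.coeFn_add f f')).trans ?_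
    exact Filter.Eventually.of_forall fun x => by simp [indFun, mul_add]
  map_smul' c f := by
    rw [RingHom.id_apply, ← MemLp.toLp_const_smul, MemLp.toLp_eq_toLp_iff]
    refine (indFun_congr odd t M hM (Lp.coeFn_smul c f)).trans ?_
    exact Filter.Eventually.of_forall fun x => by simp [indFun]; ring
  norm_map' f := by
    change ‖(memLp_indFun odd t M hM f).toLp _‖ = ‖f‖
    rw [Lp.norm_toLp, eLpNorm_indFun odd t M hM, Lp.norm_def]

theorem coeFn_indIsom (odd : Bool) (t : ℝ) (M : Matrix (Fin (d + 1)) (Fin (d + 1)) ℝ)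
    (hM : M.det = 1) (f : Model d) : indIsom odd t M hM f =ᵐ[volume] indFun odd t M f :=
  (memLp_indFun odd t M hM f).coeFn_toLp

/-- The unitary representation `Ind_P^{SL(n, ℝ)}(λ_t^±)` (normalized induction), `n = d + 1`, in its
line model: a function `F` on the group with `F(g p) = δ_P(p)^{-1/2} λ_t^±(p)⁻¹ F(g)` for `p ∈ P`
is given by `f(x) = F(lowUni x)`, the Hilbert norm is that of `L²(ℝ^d)`, and the group acts by
`(π(g) F)(h) = F(g⁻¹ h)`. Explicitly, `(π(g) f)(x) = |c|^{-n/2 - it} ε^±(c) f(y / c)` where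
`g⁻¹ (1, x)ᵀ = (c, y)ᵀ`. A homomorphism from a group into the monoid of linear isometries has
unitary (invertible) values. -/
def indRep (d : ℕ) (odd : Bool) (t : ℝ) :
    Matrix.SpecialLinearGroup (Fin (d + 1)) ℝ →* (Model d →ₗᵢ[ℂ] Model d) where
  toFun g := indIsom odd t (g⁻¹).1 (g⁻¹).2
  map_one' := by
    refine LinearIsometry.ext fun f => Lp.ext ?_
    refine (coeFn_indIsom odd t _ _ f).trans (Filter.Eventually.of_forall fun x => ?_)
    simp [indFun, den_one, proj_one, multiplier, lineChar]
  map_mul' g h := by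
    refine LinearIsometry.ext fun f => Lp.ext ?_
    refine (coeFn_indIsom odd t _ _ f).trans ?_
    refine Filter.EventuallyEq.trans ?_ (coeFn_indIsom odd t (g⁻¹).1 (g⁻¹).2 _).symm
    refine Filter.EventuallyEq.trans ?_
      (indFun_congr odd t (g⁻¹).1 (g⁻¹).2 (coeFn_indIsom odd t (h⁻¹).1 (h⁻¹).2 f)).symm
    have hg : ((g⁻¹).1).det = 1 := (g⁻¹).2
    have hh : ((h⁻¹).1).det = 1 := (h⁻¹).2
    filter_upwards [ae_den_ne_zero (g⁻¹).1 (by rw [hg]; exact one_ne_zero),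
      (quasi_proj (g⁻¹).1 hg).ae (ae_den_ne_zero (h⁻¹).1 (by rw [hh]; exact one_ne_zero))] with x hx hx'
    have e : ((g * h)⁻¹).1 = (h⁻¹).1 * (g⁻¹).1 := by rw [mul_inv_rev]; rfl
    simp only [indFun]
    rw [e, den_mul _ _ _ hx, proj_mul _ _ _ hx, multiplier_mul _ _ _ _ hx hx', mul_assoc]

/-! ### One-parameter groups, smooth vectors and Sobolev norms -/

/-- The index set of the standard basis of `sl(d + 1, ℝ)`. -/
abbrev BasisIdx (d : ℕ) : Type := Fin d ⊕ {p : Fin (d + 1) × Fin (d + 1) // p.1 ≠ p.2}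

/-- The standard basis of `sl(d + 1, ℝ)`: the matrices `X_l = E_{l,l} - E_{l+1,l+1}` and the root
vectors `u_{i,j} = E_{i,j}`, `i ≠ j`. -/
def basisVec : BasisIdx d → Matrix (Fin (d + 1)) (Fin (d + 1)) ℝ
  | .inl l => Matrix.single l.castSucc l.castSucc 1 - Matrix.single l.succ l.succ 1
  | .inr p => Matrix.single p.1.1 p.1.2 1

theorem exp_root (p : {p : Fin (d + 1) × Fin (d + 1) // p.1 ≠ p.2}) (τ : ℝ) :
    NormedSpace.exp (τ • basisVec (.inr p)) = Matrix.transvection p.1.1 p.1.2 τ := by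
  have h2 : (τ • basisVec (.inr p)) ^ 2 = 0 := by
    rw [sq]
    simp [basisVec, Matrix.single_mul_single_of_ne, p.2.symm]
  rw [NormedSpace.exp_eq_tsum ℝ]
  simp only
  rw [tsum_eq_sum (s := Finset.range 2)]
  · simp [Finset.sum_range_succ, Matrix.transvection, basisVec]
  · intro k hk
    obtain ⟨m, rfl⟩ := Nat.exists_eq_add_of_le (not_lt.1 (fun h => hk (Finset.mem_range.2 h)))
    rw [pow_add, h2, zero_mul, smul_zero]

theorem exp_cartan (l : Fin d) (τ : ℝ) :
    NormedSpace.exp (τ • basisVec (.inl l)) =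
      Matrix.diagonal fun k => Real.exp (τ * ((if k = l.castSucc then 1 else 0) -
        if k = l.succ then 1 else 0)) := by
  have : τ • basisVec (.inl l) = Matrix.diagonal fun k : Fin (d + 1) =>
      τ * ((if k = l.castSucc then 1 else 0) - if k = l.succ then 1 else 0) := by
    simp only [basisVec, ← Matrix.diagonal_single, Matrix.diagonal_sub, ← Matrix.diagonal_smul]
    congr 1
    funext k
    simp [Pi.single_apply]
  rw [this, Matrix.exp_diagonal]
  congr 1
  funext k
  rw [Pi.coe_exp, Real.exp_eq_exp_ℝ]

theorem det_exp_basisVec (b : BasisIdx d) (τ : ℝ) : (NormedSpace.exp (τ • basisVec b)).det = 1 := by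
  rcases b with l | p
  · rw [exp_cartan, Matrix.det_diagonal, ← Real.exp_sum, ← Finset.mul_sum]
    simp
  · rw [exp_root, Matrix.det_transvection_of_ne _ _ p.2]

/-- The index of the root vector `u_{i,j}`. -/
def root (i j : Fin (d + 1)) (h : i ≠ j) : BasisIdx d := .inr ⟨(i, j), h⟩

/-- The one-parameter group `τ ↦ exp(τ Y)` of a basis vector `Y`. -/
def oneParam (b : BasisIdx d) (τ : ℝ) : Matrix.SpecialLinearGroup (Fin (d + 1)) ℝ :=
  ⟨NormedSpace.exp (τ • basisVec b), det_exp_basisVec b τ⟩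

theorem det_normalize (M : Matrix (Fin (d + 1)) (Fin (d + 1)) ℝ) (h : 0 < M.det) :
    (M.det ^ (-(1 / ((d : ℝ) + 1))) • M).det = 1 := by
  have : (M.det ^ (-(1 / ((d : ℝ) + 1)))) ^ (d + 1) = M.det⁻¹ := by
    rw [← Real.rpow_natCast, ← Real.rpow_mul h.le, ← Real.rpow_neg_one]
    congr 1
    push_cast
    field_simp
  rw [Matrix.det_smul, Fintype.card_fin, this, inv_mul_cancel₀ h.ne']

open Classical in
/-- The smooth retraction `M ↦ det(M)^{-1/n} M` of the open set of the matrices with positive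
determinant onto `SL(n, ℝ)`, `n = d + 1` (extended by `1`). -/
def retract (M : Matrix (Fin (d + 1)) (Fin (d + 1)) ℝ) :
    Matrix.SpecialLinearGroup (Fin (d + 1)) ℝ :=
  if h : 0 < M.det then ⟨M.det ^ (-(1 / ((d : ℝ) + 1))) • M, det_normalize M h⟩ else 1

theorem retract_coe (g : Matrix.SpecialLinearGroup (Fin (d + 1)) ℝ) : retract g.1 = g := by
  ext i j
  simp [retract, g.2]

section General
variable {H : Type*} [NormedAddCommGroup H] [InnerProductSpace ℂ H]
  (π : Matrix.SpecialLinearGroup (Fin (d + 1)) ℝ →* (H →ₗᵢ[ℂ] H))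

/-- `v ∈ H^∞`: the orbit map `g ↦ π(g) v` is smooth on `SL(n, ℝ)`. Since `retract` is a smooth
retraction of an open set of matrices onto the submanifold `SL(n, ℝ)`, smoothness on `SL(n, ℝ)` is
smoothness of the composition with `retract` on that open set. -/
def IsSmoothVec (v : H) : Prop :=
  ContDiffOn ℝ ∞ (fun M : Fin (d + 1) → Fin (d + 1) → ℝ => π (retract (Matrix.of M)) v)
    {M | 0 < (Matrix.of M).det}

/-- The derived representation `dπ(Y) v`, the derivative of `τ ↦ π(exp(τ Y)) v` at `0`
(which exists for smooth `v`). -/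
def dRep (b : BasisIdx d) (v : H) : H := deriv (fun τ : ℝ => π (oneParam b τ) v) 0

/-- The square of the Sobolev norm of integer order `k`: the sum of `‖Y_{j_1} ⋯ Y_{j_m} v‖²` over
all words of length `m ≤ k` in the basis, the empty word giving `‖v‖²`. -/
def wordNormSq (k : ℕ) (v : H) : ℝ :=
  ∑ m ∈ Finset.range (k + 1), ∑ w : Fin m → BasisIdx d,
    ‖(List.ofFn w).foldr (dRep π) v‖ ^ 2

/-- The (quadratic) K-functional between the Sobolev norms of the orders `k` and `k + 1`:
the infimum of `‖v - w‖_k² + τ² ‖w‖_{k+1}²` over the smooth vectors `w`. -/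
def kFunctional (k : ℕ) (τ : ℝ) (v : H) : ℝ :=
  ⨅ w : {w : H // IsSmoothVec π w}, (wordNormSq π k (v - w) + τ ^ 2 * wordNormSq π (k + 1) w)

/-- The Sobolev norm `‖v‖_r` of real order `r ≥ 0` of a smooth vector `v`. For an integer `r` it is
given by `wordNormSq`. For `r = k + θ`, `0 < θ < 1`, it is the quadratic interpolation norm
`‖v‖_r² = (2 sin(π θ) / π) ∫₀^∞ τ^{-2θ-1} K(τ, v)² dτ` between the norms of the orders `k` and
`k + 1`; the constant is the one for which interpolation between `‖v‖` and `‖A v‖`, `A` positive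
and self-adjoint, gives `‖A^θ v‖`. -/
def sobolevNorm (r : ℝ) (v : H) : ℝ :=
  if r - ⌊r⌋₊ = 0 then √(wordNormSq π ⌊r⌋₊ v)
  else √(2 * Real.sin (Real.pi * (r - ⌊r⌋₊)) / Real.pi *
    ∫ τ in Set.Ioi (0 : ℝ), τ ^ (-(2 * (r - ⌊r⌋₊) + 1)) * kFunctional π ⌊r⌋₊ τ v)

/-- The spectral measure at `v` of a unitary one-parameter group `U τ = exp(i τ B)`, `B` self-adjoint:
the finite measure `μ` on `ℝ` with `⟨v, U τ v⟩ = ∫ exp(i τ ξ) dμ(ξ)` for all `τ`. It exists by the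
spectral theorem and is unique, see `IsSpectralMeasure.unique`. -/
def IsSpectralMeasure (U : ℝ → H →ₗᵢ[ℂ] H) (v : H) (μ : Measure ℝ) : Prop :=
  IsFiniteMeasure μ ∧ ∀ τ : ℝ, charFun μ τ = inner ℂ v (U τ v)

theorem IsSpectralMeasure.unique {U : ℝ → H →ₗᵢ[ℂ] H} {v : H} {μ ν : Measure ℝ}
    (hμ : IsSpectralMeasure U v μ) (hν : IsSpectralMeasure U v ν) : μ = ν := by
  have := hμ.1
  have := hν.1
  exact Measure.ext_of_charFun (funext fun τ => (hμ.2 τ).trans (hν.2 τ).symm)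

open Classical in
/-- The norm `‖(I - 𝔲²)^{s/2} v‖` in the functional calculus of the skew-adjoint generator
`𝔲 = i B` of a unitary one-parameter group `U`: as `I - 𝔲² = I + B²`, it is
`(∫ (1 + ξ²)^s dμ_v(ξ))^{1/2}` with the spectral measure `μ_v` of `U` at `v`. -/
def besselNorm (U : ℝ → H →ₗᵢ[ℂ] H) (s : ℝ) (v : H) : ℝ :=
  if h : ∃ μ : Measure ℝ, IsSpectralMeasure U v μ then √(∫ ξ, (1 + ξ ^ 2) ^ s ∂h.choose) else 0

/-- `f` and `g` are smooth vectors with `(u_{i,j} + i λ) f = g`. -/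
def IsSmoothTwistedSolution (i j : Fin (d + 1)) (hij : i ≠ j) (lam : ℝ) (f g : H) : Prop :=
  IsSmoothVec π f ∧ IsSmoothVec π g ∧ dRep π (root i j hij) f + ((lam : ℂ) * Complex.I) • f = g

end General
end SLRep
end

open SLRep

open MeasureTheory
open scoped ContDiff

noncomputable section
namespace SLRep
set_option linter.unusedSectionVars false

/-! ### Smooth families of compactly supported functions as smooth maps into `L²` -/

section Param

/-! Indices start at 0. A signed permutation conjugates `u_{i,j}` into `±E_{1,0}`, which acts in the
line model as a multiple `∓1` of the derivative in the first coordinate `X`; one more Weyl element,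
`flip`, gives a second chart, with first coordinate `y = -1/X`, in which `u_{j,i}` has the same form
(`exists_adapted_element`). Test functions supported away from `X = 0` pass from one chart to the
other at the price of the multiplier `|y|^{-n/2-it}`, up to a sign (`flipFn`).

With `μ = ±λ` the solution is `e^{iμX} a(X)` times a fixed cutoff in the other coordinates, so the
right hand side sees only `a'`. The amplitude rises to 1 on a fixed interval, stays 1 up to a
distance comparable to `ℓ = |t|/|μ|`, and has to return to 0. The point is how it returns: there
`a'` is a multiple of `e^{it(z - log z)} χ(z)` with `z = ±X/ℓ`. With the right sign, the plane wave
and the multiplier cancel this phase, and in the second chart the falling part of `g` is a dilate of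
one fixed test function (`flipFn_fallFn`). Dilations come from the group. Conjugation by this one
enlarges only the first column of a Lie algebra element, by `ℓ`, whereas `t` enters the derived
representation only through the first row; hence each derivative costs `O(|t|)`
(`exists_rowWeight_conjVec_le`, `norm_foldr_dRep_le`). Making the total descent equal to 1 means
dividing by an oscillatory integral which, by its stationary point `z = 1`, is at least
`c|t|^{-1/2}` (`norm_integral_statWave_ge`); this loss is exactly compensated by the length scale
`ℓ`. So `‖g‖_r = O(|t|^r)` for integers `r`, and by interpolation for all real `r`
(`sobolevNorm_le`).

On the plateau, seen in the second chart with `q = ±ℓy` in a fixed window, `f` oscillates like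
`e^{it(1/q - log(-q))}`. The frequency is `t` in `q`, hence of order `t²` in `y`, and the `L²` norm
over the window has order `|t|^{1/2}`. Therefore the norm of `(I - u_{j,i}²)^{s/2} f` is at least
`c|t|^{2s+1/2}`. This is proved by duality with a wave packet whose norm of order `-s` is small by
repeated integration by parts (`exists_le_integral_freqWeight`).

The quotient of the two norms grows at least like `|t|^{s+1/2-σ}`, which is the first assertion. For
the second, take an integer `s ≥ r` and `σ = r`: at positive integer order the Sobolev norm of `f`
dominates the norm in the single direction `u_{j,i}` (`besselNorm_le_wordNormSq`). -/

open Classical in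
/-- The class in `L²` of a square integrable function, and `0` for other functions. -/
def toL2 {X V : Type} [MeasureSpace X] [NormedAddCommGroup V] (f : X → V) :
    Lp V 2 (volume : Measure X) :=
  if h : MemLp f 2 (volume : Measure X) then h.toLp f else 0

variable {X V W E : Type} [MeasureSpace X] [NormedAddCommGroup V] [NormedSpace ℝ V]
  [NormedAddCommGroup W] [NormedSpace ℝ W] [NormedAddCommGroup E] [NormedSpace ℝ E]

theorem toL2_eq {f : X → V} (h : MemLp f 2 (volume : Measure X)) : toL2 f = h.toLp f := dif_pos h

theorem coeFn_toL2 {f : X → V} (h : MemLp f 2 (volume : Measure X)) : toL2 f =ᵐ[volume] f := by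
  rw [toL2_eq h]; exact h.coeFn_toLp

theorem toL2_congr {f g : X → V} (h : f =ᵐ[volume] g) : toL2 f = toL2 g := by
  unfold toL2
  by_cases hf : MemLp f 2 (volume : Measure X)
  · have hg := (memLp_congr_ae h).1 hf
    rw [dif_pos hf, dif_pos hg, MemLp.toLp_eq_toLp_iff]; exact h
  · have hg := fun hg => hf ((memLp_congr_ae h).2 hg)
    rw [dif_neg hf, dif_neg hg]

/-- No integrability is assumed: for a function outside `L²` the default value 0 satisfies the bound
trivially. -/
theorem norm_toL2_le {f : X → V} {K : Set X} (hK : MeasurableSet K)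
    (hKfin : volume K ≠ ⊤) {c : ℝ} (hc : 0 ≤ c) (hf : ∀ x ∈ K, ‖f x‖ ≤ c) (hz : ∀ x ∉ K, f x = 0) :
    ‖toL2 f‖ ≤ c * (volume K).toReal ^ (1 / 2 : ℝ) := by
  by_cases h : MemLp f 2 (volume : Measure X)
  · rw [toL2_eq h, Lp.norm_toLp]
    have hf' : f = K.indicator f := by
      ext x
      by_cases hx : x ∈ K
      · rw [Set.indicator_of_mem hx]
      · rw [Set.indicator_of_notMem hx, hz x hx]
    have h1 : eLpNorm f 2 volume ≤ eLpNorm f 2 (volume.restrict K) := by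
      conv_lhs => rw [hf', eLpNorm_indicator_eq_eLpNorm_restrict hK]
    have h2 : eLpNorm f 2 (volume.restrict K) ≤
        (volume.restrict K) Set.univ ^ (ENNReal.toReal 2)⁻¹ * ENNReal.ofReal c :=
      eLpNorm_le_of_ae_bound ((ae_restrict_iff' hK).2 (Filter.Eventually.of_forall hf))
    have h3 := h1.trans h2
    rw [Measure.restrict_apply_univ] at h3
    have h4 := ENNReal.toReal_mono
      (ENNReal.mul_ne_top (ENNReal.rpow_ne_top_of_nonneg (by simp) hKfin) (by simp)) h3
    rw [ENNReal.toReal_mul, ← ENNReal.toReal_rpow, ENNReal.toReal_ofReal hc] at h4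
    simp only [ENNReal.toReal_ofNat] at h4
    rw [mul_comm, one_div]; exact h4
  · rw [toL2, dif_neg h, norm_zero]; positivity

/-- An `L²` function with values in the linear maps, as a linear map into `L²`. -/
def evalL2 (X W E : Type) [MeasureSpace X] [NormedAddCommGroup W] [NormedSpace ℝ W]
    [NormedAddCommGroup E] [NormedSpace ℝ E] :
    Lp (E →L[ℝ] W) 2 (volume : Measure X) →L[ℝ] E →L[ℝ] Lp W 2 (volume : Measure X) :=
  LinearMap.mkContinuous₂
    { toFun := fun h =>
        { toFun := fun e => (ContinuousLinearMap.apply ℝ W e).compLp h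
          map_add' := fun e e' => by
            rw [map_add, ContinuousLinearMap.add_compLp]
          map_smul' := fun c e => by
            rw [map_smul, ContinuousLinearMap.smul_compLp]; rfl }
      map_add' := fun h h' => by
        ext1 e
        exact map_add ((ContinuousLinearMap.apply ℝ W e).compLpₗ 2 volume) h h'
      map_smul' := fun c h => by
        ext1 e
        exact map_smul ((ContinuousLinearMap.apply ℝ W e).compLpₗ 2 volume) c h } 1
    (fun h e => by
      refine (ContinuousLinearMap.norm_compLp_le _ _).trans ?_
      rw [one_mul, mul_comm]
      gcongr
      refine ContinuousLinearMap.opNorm_le_bound _ (norm_nonneg _) fun T => ?_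
      rw [mul_comm]; exact T.le_opNorm e)

theorem evalL2_toL2 {f : X → E →L[ℝ] W} (hf : MemLp f 2 (volume : Measure X)) (e : E) :
    evalL2 X W E (toL2 f) e = toL2 fun x => f x e := by
  have hfe : MemLp (fun x => f x e) 2 (volume : Measure X) :=
    (ContinuousLinearMap.apply ℝ W e).comp_memLp' hf
  refine Lp.ext ?_
  filter_upwards [(ContinuousLinearMap.apply ℝ W e).coeFn_compLp (toL2 f), coeFn_toL2 hf,
    coeFn_toL2 hfe] with x h0 h1 h2
  rw [h2]
  refine h0.trans ?_
  rw [h1]; rfl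

variable {Y : Type} [NormedAddCommGroup Y] [NormedSpace ℝ Y] [MeasureSpace Y] [BorelSpace Y]
  [SecondCountableTopology Y] [IsFiniteMeasureOnCompacts (volume : Measure Y)]

/-- A smooth family of functions on `Y` vanishing outside a common compact set. -/
structure SmoothFamily (U : Set E) (K : Set Y) (F : E → Y → V) : Prop where
  isOpen : IsOpen U
  isCompact : IsCompact K
  smooth : ContDiffOn ℝ ∞ (fun p : E × Y => F p.1 p.2) (U ×ˢ Set.univ)
  zero : ∀ p ∈ U, ∀ x ∉ K, F p x = 0

namespace SmoothFamily
variable {U : Set E} {K : Set Y} {F : E → Y → V}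

theorem differentiableAt (h : SmoothFamily U K F) {p : E} (hp : p ∈ U) (x : Y) :
    DifferentiableAt ℝ (fun q : E × Y => F q.1 q.2) (p, x) :=
  ((h.smooth.contDiffAt ((h.isOpen.prod isOpen_univ).mem_nhds ⟨hp, trivial⟩))).differentiableAt
    (by simp)

theorem hasFDerivAt (h : SmoothFamily U K F) {p : E} (hp : p ∈ U) (x : Y) :
    HasFDerivAt (fun q => F q x) ((fderiv ℝ (fun q : E × Y => F q.1 q.2) (p, x)).comp
      (ContinuousLinearMap.inl ℝ E Y)) p := by
  have h1 : HasFDerivAt (fun q : E => (q, x)) (ContinuousLinearMap.inl ℝ E Y) p :=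
    hasFDerivAt_prodMk_left p x
  exact (h.differentiableAt hp x).hasFDerivAt.comp p h1

theorem memLp (h : SmoothFamily U K F) {p : E} (hp : p ∈ U) :
    MemLp (F p) 2 (volume : Measure Y) := by
  have hc : Continuous (F p) := by
    have : ContinuousOn (fun x : Y => F p x) Set.univ :=
      h.smooth.continuousOn.comp (f := fun x : Y => (p, x)) (by fun_prop) fun x _ => ⟨hp, trivial⟩
    exact continuousOn_univ.1 this
  exact hc.memLp_of_hasCompactSupport (HasCompactSupport.intro h.isCompact (h.zero p hp))

/-- The derivative of a smooth family with respect to the parameter. -/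
theorem deriv (h : SmoothFamily U K F) :
    SmoothFamily U K fun p x => fderiv ℝ (fun q => F q x) p where
  isOpen := h.isOpen
  isCompact := h.isCompact
  smooth := by
    have h1 := h.smooth.fderiv_of_isOpen (m := ∞) (h.isOpen.prod isOpen_univ) (by simp)
    have h2 : ContDiffOn ℝ ∞ (fun p : E × Y => (fderiv ℝ (fun q : E × Y => F q.1 q.2) p).comp
      (ContinuousLinearMap.inl ℝ E Y)) (U ×ˢ Set.univ) :=
      h1.clm_comp contDiffOn_const
    refine h2.congr fun p hp => ?_
    exact (h.hasFDerivAt hp.1 p.2).fderiv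
  zero p hp x hx := by
    have : (fun q => F q x) =ᶠ[nhds p] fun _ => 0 := by
      filter_upwards [h.isOpen.mem_nhds hp] with q hq using h.zero q hq x hx
    rw [this.fderiv_eq]; simp

/-- The mean value inequality in the parameter gives a remainder that is small uniformly on `K`.
Everything vanishes off `K`, which has finite measure, so the uniform bound is an `L²` bound. -/
theorem hasFDerivAt_toL2 (h : SmoothFamily U K F) {p : E} (hp : p ∈ U) :
    HasFDerivAt (fun q => toL2 (F q)) (evalL2 Y V E (toL2 fun x => fderiv ℝ (fun q => F q x) p))
      p := by
  have hK := h.isCompact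
  set c := (volume K).toReal ^ (1 / 2 : ℝ) with hc
  have hc0 : 0 ≤ c := by positivity
  rw [hasFDerivAt_iff_isLittleO, Asymptotics.isLittleO_iff]
  intro ε hε
  -- Passing from the supremum to the `L²` norm costs the factor `c`, the square root of the volume
  -- of `K`; the summand 1 covers `c = 0`.
  set ε' := ε / (c + 1) with hε'
  have hε'0 : 0 < ε' := by positivity
  set G : E × Y → (E →L[ℝ] V) := fun q => fderiv ℝ (fun q' => F q' q.2) q.1 with hG
  have hGc : ContinuousOn G (U ×ˢ Set.univ) := h.deriv.smooth.continuousOn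
  -- Joint continuity of the parameter derivative and compactness of `K` give a neighbourhood of `p`
  -- that serves all `x ∈ K`.
  have hev : ∀ᶠ q in nhds p, ∀ x ∈ K, ‖G (q, x) - G (p, x)‖ < ε' := by
    refine hK.eventually_forall_of_forall_eventually fun x hx => ?_
    have hGx : ContinuousAt G (p, x) :=
      hGc.continuousAt ((h.isOpen.prod isOpen_univ).mem_nhds ⟨hp, trivial⟩)
    have h1 : ContinuousAt (fun z : E × Y => G z - G (p, z.2)) (p, x) := by
      refine hGx.sub ?_
      exact ContinuousAt.comp (f := fun z : E × Y => (p, z.2)) (g := G) hGx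
        (by fun_prop)
    have h2 := h1.norm.eventually_lt (continuousAt_const (y := ε')) (by simpa using hε'0)
    exact h2
  obtain ⟨r, hr, hrball⟩ := Metric.eventually_nhds_iff_ball.1 (hev.and (h.isOpen.mem_nhds hp))
  filter_upwards [Metric.ball_mem_nhds p hr] with q hq
  have hqU := (hrball q hq).2
  have hd : toL2 (F q) - toL2 (F p) - evalL2 Y V E (toL2 fun x => G (p, x)) (q - p) =
      toL2 fun x => F q x - F p x - G (p, x) (q - p) := by
    have m1 := h.memLp hqU
    have m2 := h.memLp hp
    have m3 := h.deriv.memLp hp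
    have m4 : MemLp (fun x => G (p, x) (q - p)) 2 (volume : Measure Y) :=
      (ContinuousLinearMap.apply ℝ V (q - p)).comp_memLp' m3
    have m5 : MemLp (fun x => F q x - F p x - G (p, x) (q - p)) 2 (volume : Measure Y) :=
      (m1.sub m2).sub m4
    rw [evalL2_toL2 m3, toL2_eq m1, toL2_eq m2, toL2_eq m4, toL2_eq m5]
    rfl
  change ‖toL2 (F q) - toL2 (F p) - evalL2 Y V E (toL2 fun x => G (p, x)) (q - p)‖ ≤ _
  rw [hd]
  refine (norm_toL2_le hK.measurableSet hK.measure_lt_top.ne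
    (c := ε' * ‖q - p‖) (by positivity) ?_ ?_).trans ?_
  · intro x hx
    exact (convex_ball p r).norm_image_sub_le_of_norm_hasFDerivWithin_le'
      (f := fun q => F q x) (f' := fun q => G (q, x)) (φ := G (p, x))
      (fun y hy => ((h.hasFDerivAt (hrball y hy).2 x).differentiableAt.hasFDerivAt).hasFDerivWithinAt)
      (fun y hy => ((hrball y hy).1 x hx).le) (Metric.mem_ball_self hr) hq
  · intro x hx
    rw [h.zero q hqU x hx, h.zero p hp x hx]
    have : G (p, x) = 0 := h.deriv.zero p hp x hx
    simp [this]
  · rw [mul_assoc, mul_comm ‖q - p‖, ← mul_assoc]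
    gcongr
    rw [hε', div_mul_eq_mul_div, div_le_iff₀ (by positivity)]
    nlinarith

/-- The parameter derivative is again a smooth family over the same `U` and `K`, but with values in
`E →L[ℝ] V`; the induction on the order therefore runs over all target spaces at once. -/
theorem contDiffOn_toL2 (h : SmoothFamily U K F) : ContDiffOn ℝ ∞ (fun q => toL2 (F q)) U := by
  rw [contDiffOn_infty]
  intro n
  induction n generalizing V with
  | zero =>
    refine contDiffOn_zero.2 fun p hp => ?_
    exact (h.hasFDerivAt_toL2 hp).continuousAt.continuousWithinAt
  | succ n ih =>
    rw [Nat.cast_add, Nat.cast_one, contDiffOn_succ_iff_fderiv_of_isOpen h.isOpen]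
    refine ⟨fun p hp => (h.hasFDerivAt_toL2 hp).differentiableAt.differentiableWithinAt,
      by simp, ?_⟩
    have h1 := (evalL2 Y V E).contDiff.comp_contDiffOn (ih h.deriv)
    exact h1.congr fun p hp => (h.hasFDerivAt_toL2 hp).fderiv

end SmoothFamily
end Param

/-! ### Test functions: smoothness and the derived representation -/

section Test
variable {d : ℕ}

/-- The smooth compactly supported functions on `ℝ^d`. -/
def TestFn (d : ℕ) : Submodule ℂ ((Fin d → ℝ) → ℂ) where
  carrier := {f | ContDiff ℝ ∞ f ∧ HasCompactSupport f}
  add_mem' h h' := ⟨h.1.add h'.1, h.2.add h'.2⟩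
  zero_mem' := ⟨contDiff_const, HasCompactSupport.zero⟩
  smul_mem' c _ h := ⟨contDiff_const.smul h.1, h.2.smul_left (f := fun _ => c)⟩

namespace TestFn

theorem memLp (f : TestFn d) : MemLp f.1 2 volume :=
  f.2.1.continuous.memLp_of_hasCompactSupport f.2.2

/-- The class of a test function in `L²`. -/
def vec : TestFn d →ₗ[ℂ] Model d where
  toFun f := toL2 f.1
  map_add' f g := by
    rw [toL2_eq (memLp f), toL2_eq (memLp g), toL2_eq (memLp (f + g))]; rfl
  map_smul' c f := by
    rw [toL2_eq (memLp f), toL2_eq (memLp (c • f))]; rfl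

/-- A function which is smooth near the support of a test function can be multiplied by it. -/
def mulOn (φ : (Fin d → ℝ) → ℂ) (f : TestFn d) (h : ∀ x ∈ tsupport f.1, ContDiffAt ℝ ∞ φ x) :
    TestFn d :=
  ⟨fun x => φ x * f.1 x, by
    refine ⟨contDiff_iff_contDiffAt.2 fun x => ?_, f.2.2.mul_left⟩
    by_cases hx : x ∈ tsupport f.1
    · exact (h x hx).mul f.2.1.contDiffAt
    · have : (fun x => φ x * f.1 x) =ᶠ[nhds x] fun _ => 0 := by
        filter_upwards [notMem_tsupport_iff_eventuallyEq.1 hx] with y hy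
        rw [hy]; simp
      exact contDiffAt_const.congr_of_eventuallyEq this⟩

/-- Multiplication by a smooth function. -/
def mul (φ : (Fin d → ℝ) → ℂ) (hφ : ContDiff ℝ ∞ φ) : Module.End ℂ (TestFn d) where
  toFun f := mulOn φ f fun _ _ => hφ.contDiffAt
  map_add' f g := by
    ext x; exact mul_add _ _ _
  map_smul' c f := by
    ext x; exact mul_left_comm _ _ _

/-- The `k`-th partial derivative. -/
def pd (k : Fin d) : Module.End ℂ (TestFn d) where
  toFun f := ⟨fun x => fderiv ℝ f.1 x (Pi.single k 1),
    (f.2.1.fderiv_right (m := ∞) (by simp)).clm_apply contDiff_const,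
    f.2.2.fderiv_apply ℝ _⟩
  map_add' f g := by
    ext x
    change fderiv ℝ (f.1 + g.1) x _ = fderiv ℝ f.1 x _ + fderiv ℝ g.1 x _
    rw [fderiv_add (f.2.1.differentiable (by simp) x) (g.2.1.differentiable (by simp) x)]; rfl
  map_smul' c f := by
    ext x
    change fderiv ℝ (c • f.1) x _ = c * fderiv ℝ f.1 x _
    rw [fderiv_const_smul (f.2.1.differentiable (by simp) x)]; rfl

theorem contDiff_affVec (b : Fin (d + 1)) :
    ContDiff ℝ ∞ fun x : Fin d → ℝ => ((affVec x b : ℝ) : ℂ) := by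
  refine Complex.ofRealCLM.contDiff.comp ?_
  refine Fin.cases ?_ (fun k => ?_) b
  · exact contDiff_const
  · exact contDiff_apply ℝ ℝ k

/-- Multiplication by a coordinate of `(1, x)`. -/
def mulAff (b : Fin (d + 1)) : Module.End ℂ (TestFn d) :=
  mul (fun x => ((affVec x b : ℝ) : ℂ)) (contDiff_affVec b)

/-- The derivative of the representation on test functions in the direction `E_{a,b}`. -/
def unitOp (t : ℝ) (a b : Fin (d + 1)) : Module.End ℂ (TestFn d) :=
  mulAff b * Fin.cases (((((d : ℝ) + 1) / 2 : ℝ) + t * Complex.I : ℂ) • (1 : Module.End ℂ (TestFn d))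
    + ∑ k : Fin d, mulAff k.succ * pd k) (fun k => -pd k) a

/-- The derivative of the representation on test functions in the direction `Y`. -/
def liOp (t : ℝ) (Y : Matrix (Fin (d + 1)) (Fin (d + 1)) ℝ) : Module.End ℂ (TestFn d) :=
  ∑ a, ∑ b, (Y a b : ℂ) • unitOp t a b

theorem sum_apply {ι : Type*} (s : Finset ι) (g : ι → TestFn d) (x : Fin d → ℝ) :
    (∑ i ∈ s, g i).1 x = ∑ i ∈ s, (g i).1 x := by
  rw [AddSubmonoidClass.coe_finsetSum, Finset.sum_apply]

/-- The first term is the derivative of the multiplier, the second that of the projective action,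
whose vector field is quadratic in `x`. -/
theorem liOp_apply (t : ℝ) (Y : Matrix (Fin (d + 1)) (Fin (d + 1)) ℝ) (f : TestFn d)
    (x : Fin d → ℝ) : (liOp t Y f).1 x =
      ((((d : ℝ) + 1) / 2 : ℝ) + t * Complex.I : ℂ) * (Y.mulVec (affVec x) 0 : ℝ) * f.1 x
      - fderiv ℝ f.1 x (fun k => Y.mulVec (affVec x) k.succ - x k * Y.mulVec (affVec x) 0) := by
  have hf : ∀ v : Fin d → ℝ, fderiv ℝ f.1 x v = ∑ k, (v k : ℂ) * (pd k f).1 x := by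
    intro v
    conv_lhs => rw [pi_eq_sum_univ' v, map_sum]
    refine Finset.sum_congr rfl fun k _ => ?_
    rw [map_smul]
    change _ • fderiv ℝ f.1 x _ = _ * fderiv ℝ f.1 x _
    rw [Complex.real_smul]
  have hr : ∀ a b, (unitOp t a b f).1 x = affVec x b * Fin.cases
      (((((d : ℝ) + 1) / 2 : ℝ) + t * Complex.I : ℂ) * f.1 x + ∑ k : Fin d, x k * (pd k f).1 x)
      (fun k => -(pd k f).1 x) a := by
    intro a b
    refine Fin.cases ?_ (fun k => ?_) a
    · change _ * ((_ • f.1 : (Fin d → ℝ) → ℂ) x +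
        ((∑ k : Fin d, mulAff k.succ * pd k : Module.End ℂ (TestFn d)) f).1 x) = _
      rw [LinearMap.sum_apply, sum_apply]
      rfl
    · rfl
  have h1 : (liOp t Y f).1 x = ∑ a, ∑ b, (Y a b : ℂ) * (unitOp t a b f).1 x := by
    simp only [liOp, LinearMap.sum_apply, sum_apply]; rfl
  rw [h1, hf]
  simp only [hr]
  have h2 : ∀ a, ((Y.mulVec (affVec x) a : ℝ) : ℂ) = ∑ b, (Y a b : ℂ) * affVec x b := by
    intro a; simp [Matrix.mulVec, dotProduct]
  simp only [← mul_assoc, ← Finset.sum_mul, ← h2]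
  rw [Fin.sum_univ_succ]
  simp only [Fin.cases_zero, Fin.cases_succ]
  push_cast
  simp only [sub_mul, Finset.sum_sub_distrib, mul_neg, Finset.sum_neg_distrib]
  rw [mul_add, Finset.mul_sum]
  have : ∀ k, ((Y.mulVec (affVec x) 0 : ℝ) : ℂ) * (x k * (pd k f).1 x) =
    x k * ((Y.mulVec (affVec x) 0 : ℝ) : ℂ) * (pd k f).1 x := fun k => by ring
  simp only [this]
  ring

end TestFn

theorem multiplier_of_pos (odd : Bool) (t : ℝ) {a : ℝ} (ha : 0 < a) :
    multiplier d odd t a =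
      Complex.exp (-((((d : ℝ) + 1) / 2 : ℝ) + t * Complex.I) * (Real.log a : ℝ)) := by
  have ha' : (a : ℂ) ≠ 0 := by exact_mod_cast ha.ne'
  have h1 : (if odd then ((SignType.sign a : ℝ) : ℂ) else 1) = 1 := by
    cases odd <;> simp [ha]
  rw [multiplier, lineChar, h1, one_mul, abs_of_pos ha, Complex.cpow_def_of_ne_zero ha',
    ← Complex.exp_neg, Real.rpow_def_of_pos ha, Complex.ofReal_exp, ← Complex.exp_add,
    ← Complex.ofReal_log ha.le]
  congr 1
  push_cast; ring

/-- A consequence of the convention that 0 to a nonzero real power is 0. It makes transported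
functions vanish on the hyperplane where the denominator does, so that they can be treated pointwise
there. -/
theorem multiplier_zero (odd : Bool) (t : ℝ) : multiplier d odd t 0 = 0 := by
  have : -((d : ℝ) + 1) / 2 ≠ 0 := by
    have : (0 : ℝ) < (d : ℝ) + 1 := by positivity
    intro h; linarith
  rw [multiplier, abs_zero, Real.zero_rpow this]; simp

theorem indRep_vec (odd : Bool) (t : ℝ) (g : Matrix.SpecialLinearGroup (Fin (d + 1)) ℝ)
    (f : TestFn d) : indRep d odd t g (TestFn.vec f) = toL2 (indFun odd t (g⁻¹).1 f.1) := by
  have h1 : (indFun odd t (g⁻¹).1 (TestFn.vec f : Model d) : (Fin d → ℝ) → ℂ) =ᵐ[volume]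
      indFun odd t (g⁻¹).1 f.1 := indFun_congr odd t _ (g⁻¹).2 (coeFn_toL2 (TestFn.memLp f))
  rw [← toL2_congr h1, toL2_eq (memLp_indFun odd t _ (g⁻¹).2 _)]
  rfl

section Smooth
variable {P : Type} [NormedAddCommGroup P] [NormedSpace ℝ P]

theorem contDiffOn_det {m : ℕ} {U : Set P} {N : P → Matrix (Fin m) (Fin m) ℝ}
    (hN : ∀ a b, ContDiffOn ℝ ∞ (fun p => N p a b) U) : ContDiffOn ℝ ∞ (fun p => (N p).det) U := by
  simp only [Matrix.det_apply']
  refine ContDiffOn.sum fun σ _ => ?_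
  exact contDiffOn_const.mul (contDiffOn_prod fun i _ => hN _ _)

theorem contDiffOn_adjugate {m : ℕ} {U : Set P} {N : P → Matrix (Fin m) (Fin m) ℝ}
    (hN : ∀ a b, ContDiffOn ℝ ∞ (fun p => N p a b) U) (a b : Fin m) :
    ContDiffOn ℝ ∞ (fun p => (N p).adjugate a b) U := by
  simp only [Matrix.adjugate_apply]
  refine contDiffOn_det fun i j => ?_
  simp only [Matrix.updateRow_apply]
  split_ifs
  · exact contDiffOn_const
  · exact hN i j

theorem contDiffOn_mul {m : ℕ} {U : Set P} {N N' : P → Matrix (Fin m) (Fin m) ℝ}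
    (hN : ∀ a b, ContDiffOn ℝ ∞ (fun p => N p a b) U)
    (hN' : ∀ a b, ContDiffOn ℝ ∞ (fun p => N' p a b) U) (a b : Fin m) :
    ContDiffOn ℝ ∞ (fun p => (N p * N' p) a b) U := by
  simp only [Matrix.mul_apply]
  exact ContDiffOn.sum fun i _ => (hN _ _).mul (hN' _ _)

theorem contDiffOn_mulVec {U : Set P} {N : P → Matrix (Fin (d + 1)) (Fin (d + 1)) ℝ}
    (hN : ∀ a b, ContDiffOn ℝ ∞ (fun p => N p a b) U) (a : Fin (d + 1)) :
    ContDiffOn ℝ ∞ (fun p : P × (Fin d → ℝ) => (N p.1).mulVec (affVec p.2) a)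
      (U ×ˢ Set.univ) := by
  simp only [mulVec_succ]
  have h1 : ∀ b, ContDiffOn ℝ ∞ (fun p : P × (Fin d → ℝ) => N p.1 a b) (U ×ˢ Set.univ) :=
    fun b => (hN a b).comp contDiffOn_fst fun p hp => hp.1
  refine (h1 0).add (ContDiffOn.sum fun l _ => (h1 _).mul ?_)
  exact ((contDiff_apply ℝ ℝ l).comp contDiff_snd).contDiffOn

/-- For matrices near the identity the denominator stays positive on a unit thickening of the
support and the support is moved by less than 1, so one compact set serves all nearby parameters.
Away from the identity the support could meet the hyperplane at infinity of the chart. -/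
theorem exists_smoothFamily_indFun (odd : Bool) (t : ℝ) (f : TestFn d) {U₀ : Set P}
    (hU₀ : IsOpen U₀) {p₀ : P} (hp₀ : p₀ ∈ U₀) {N : P → Matrix (Fin (d + 1)) (Fin (d + 1)) ℝ}
    (hN : ∀ a b, ContDiffOn ℝ ∞ (fun p => N p a b) U₀) (hdet : ∀ p ∈ U₀, (N p).det = 1)
    (h1 : N p₀ = 1) :
    ∃ U ⊆ U₀, p₀ ∈ U ∧ ∃ K : Set (Fin d → ℝ),
      SmoothFamily U K (fun p x => indFun odd t (N p) f.1 x) := by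
  set K₀ := tsupport f.1 with hK₀
  have hK₀c : IsCompact K₀ := f.2.2
  set K := Metric.cthickening 1 K₀ with hK
  have hKc : IsCompact K := hK₀c.cthickening
  have hmv : ∀ {N : P → Matrix (Fin (d + 1)) (Fin (d + 1)) ℝ},
      (∀ a b, ContDiffOn ℝ ∞ (fun p => N p a b) U₀) → ∀ x a,
      ContinuousAt (fun p : P × (Fin d → ℝ) => (N p.1).mulVec (affVec p.2) a) (p₀, x) :=
    fun hN x a => (contDiffOn_mulVec hN a).continuousOn.continuousAt
      ((hU₀.prod isOpen_univ).mem_nhds ⟨hp₀, trivial⟩)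
  have hA := contDiffOn_adjugate hN
  have hA1 : (N p₀).adjugate = 1 := by rw [h1, Matrix.adjugate_one]
  have e1 : ∀ᶠ p in nhds p₀, ∀ x ∈ K, 0 < den (N p) x := by
    refine hKc.eventually_forall_of_forall_eventually fun x _ => ?_
    have : ∀ᶠ q in nhds (p₀, x), 0 < den (N (Prod.fst q)) (Prod.snd q) :=
      continuousAt_const.eventually_lt (hmv hN x 0) (by
        change 0 < den (N p₀) x
        rw [h1, den_one]; exact one_pos)
    exact this
  -- As `det = 1`, the adjugate is the inverse: this controls the preimage under `proj (N p)` of the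
  -- support.
  have e2 : ∀ᶠ p in nhds p₀, ∀ k ∈ K₀, den (N p).adjugate k ≠ 0 ∧
      proj (N p).adjugate k ∈ Metric.thickening 1 K₀ := by
    refine hK₀c.eventually_forall_of_forall_eventually fun k hk => ?_
    have hd0 : ContinuousAt (fun q : P × (Fin d → ℝ) => den (N q.1).adjugate q.2) (p₀, k) :=
      hmv hA k 0
    have hd1 : den (N p₀).adjugate k ≠ 0 := by rw [hA1, den_one]; exact one_ne_zero
    refine Filter.Eventually.and (hd0.eventually_ne hd1) ?_
    have hpr : ContinuousAt (fun q : P × (Fin d → ℝ) => proj (N q.1).adjugate q.2) (p₀, k) :=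
      continuousAt_pi.2 fun l => (hmv hA k l.succ).div hd0 hd1
    refine hpr.eventually_mem (Metric.isOpen_thickening.mem_nhds ?_)
    change proj (N p₀).adjugate k ∈ _
    rw [hA1, proj_one]
    exact Metric.self_subset_thickening one_pos _ hk
  obtain ⟨U, hUsub, hUo, hpU⟩ := mem_nhds_iff.1 ((e1.and e2).and (hU₀.mem_nhds hp₀))
  have zero : ∀ p ∈ U, ∀ x ∉ K, indFun odd t (N p) f.1 x = 0 := by
    intro p hp x hx
    obtain ⟨⟨-, he2⟩, hpU₀⟩ := hUsub hp
    by_cases hd : den (N p) x = 0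
    · rw [indFun, hd, multiplier_zero, zero_mul]
    · rw [indFun]
      by_cases hk : proj (N p) x ∈ K₀
      · exfalso
        refine hx (Metric.thickening_subset_cthickening _ _ ?_)
        have := (he2 _ hk).2
        rwa [← proj_mul _ _ _ hd, Matrix.adjugate_mul, hdet p hpU₀, one_smul, proj_one] at this
      · rw [image_eq_zero_of_notMem_tsupport hk, mul_zero]
  refine ⟨U, fun p hp => (hUsub hp).2, hpU, K, hUo, hKc, ?_, zero⟩
  rintro ⟨p, x⟩ ⟨hp, -⟩
  refine ContDiffAt.contDiffWithinAt ?_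
  by_cases hx : x ∈ K
  · have hpos : 0 < den (N p) x := (hUsub hp).1.1 x hx
    have hsm : ∀ a, ContDiffAt ℝ ∞
        (fun q : P × (Fin d → ℝ) => (N q.1).mulVec (affVec q.2) a) (p, x) := fun a =>
      (contDiffOn_mulVec hN a).contDiffAt
        ((hU₀.prod isOpen_univ).mem_nhds ⟨(hUsub hp).2, trivial⟩)
    have hden : ContDiffAt ℝ ∞ (fun q : P × (Fin d → ℝ) => den (N q.1) q.2) (p, x) := hsm 0
    have hproj : ContDiffAt ℝ ∞ (fun q : P × (Fin d → ℝ) => proj (N q.1) q.2) (p, x) :=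
      contDiffAt_pi.2 fun k => (hsm k.succ).div hden hpos.ne'
    have hev : ∀ᶠ q in nhds (p, x), 0 < den (N (Prod.fst q)) (Prod.snd q) :=
      continuousAt_const.eventually_lt hden.continuousAt hpos
    have hlog := Complex.ofRealCLM.contDiff.contDiffAt.comp (p, x) (hden.log hpos.ne')
    have hexp := ((contDiffAt_const (c := -((((d : ℝ) + 1) / 2 : ℝ) + t * Complex.I : ℂ))).mul
      hlog).cexp
    have hf := f.2.1.contDiffAt.comp (p, x) hproj
    refine (hexp.mul hf).congr_of_eventuallyEq ?_
    filter_upwards [hev] with q hq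
    rw [indFun, multiplier_of_pos odd t hq]; rfl
  · refine (contDiffAt_const (c := (0 : ℂ))).congr_of_eventuallyEq ?_
    filter_upwards [(hUo.prod hKc.isClosed.isOpen_compl).mem_nhds ⟨hp, hx⟩] with q hq
    exact zero q.1 hq.1 q.2 hq.2

theorem contDiffAt_orbit (odd : Bool) (t : ℝ) (f : TestFn d) {U₀ : Set P} (hU₀ : IsOpen U₀)
    {p₀ : P} (hp₀ : p₀ ∈ U₀) {γ : P → Matrix.SpecialLinearGroup (Fin (d + 1)) ℝ}
    (hγ : ∀ a b, ContDiffOn ℝ ∞ (fun p => (γ p).1 a b) U₀) (h1 : γ p₀ = 1) :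
    ContDiffAt ℝ ∞ (fun p => indRep d odd t (γ p) (TestFn.vec f)) p₀ := by
  obtain ⟨U, -, hpU, K, hK⟩ := exists_smoothFamily_indFun odd t f hU₀ hp₀
    (N := fun p => ((γ p)⁻¹).1) (contDiffOn_adjugate hγ) (fun p _ => ((γ p)⁻¹).2)
    (by simp [h1])
  simp only [indRep_vec]
  exact hK.contDiffOn_toL2.contDiffAt (hK.isOpen.mem_nhds hpU)

end Smooth

/-- Smoothness at any point follows from smoothness near the identity: write `h g = g₀ (g₀⁻¹ h g)`
with `g₀ = h₀ g`. The outer factor is a fixed bounded operator and the inner one is the identity at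
`h = h₀`. -/
theorem isSmoothVec_rep_vec (odd : Bool) (t : ℝ) (g : Matrix.SpecialLinearGroup (Fin (d + 1)) ℝ)
    (f : TestFn d) : IsSmoothVec (indRep d odd t) (indRep d odd t g (TestFn.vec f)) := by
  have hE : ∀ a b : Fin (d + 1), ContDiff ℝ ∞
      (fun M : Fin (d + 1) → Fin (d + 1) → ℝ => (Matrix.of M) a b) := fun a b => by
    simp only [Matrix.of_apply]
    exact (contDiff_apply ℝ ℝ b).comp (contDiff_apply ℝ (Fin (d + 1) → ℝ) a)
  have hdet : ContDiff ℝ ∞ (fun M : Fin (d + 1) → Fin (d + 1) → ℝ => (Matrix.of M).det) :=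
    contDiffOn_univ.1 (contDiffOn_det fun a b => (hE a b).contDiffOn)
  have hU : IsOpen {M : Fin (d + 1) → Fin (d + 1) → ℝ | 0 < (Matrix.of M).det} :=
    isOpen_lt continuous_const hdet.continuous
  intro M₀ hM₀
  set g₀ := retract (Matrix.of M₀) * g with hg₀
  have hret : ∀ a b, ContDiffOn ℝ ∞ (fun M : Fin (d + 1) → Fin (d + 1) → ℝ =>
      (retract (Matrix.of M)).1 a b) {M | 0 < (Matrix.of M).det} := by
    intro a b
    refine ContDiffOn.congr (f := fun M => (Matrix.of M).det ^ (-(1 / ((d : ℝ) + 1))) *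
      (Matrix.of M) a b) ?_ fun M hM => ?_
    · exact (hdet.contDiffOn.rpow_const_of_ne fun M hM => ne_of_gt hM).mul (hE a b).contDiffOn
    · have : 0 < (Matrix.of M).det := hM
      simp [retract, this]
  have hγ := contDiffAt_orbit odd t f hU hM₀ (γ := fun M => g₀⁻¹ * retract (Matrix.of M) * g)
    (fun a b => contDiffOn_mul (N := fun M => g₀⁻¹.1 * (retract (Matrix.of M)).1)
      (N' := fun _ => g.1) (contDiffOn_mul (N := fun _ => g₀⁻¹.1) (fun _ _ => contDiffOn_const) hret)
      (fun _ _ => contDiffOn_const) a b)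
    (by simp [hg₀])
  have h2 : ContDiffAt ℝ ∞ (fun M => (indRep d odd t g₀)
      (indRep d odd t (g₀⁻¹ * retract (Matrix.of M) * g) (TestFn.vec f))) M₀ :=
    (((indRep d odd t g₀).toContinuousLinearMap.restrictScalars ℝ).contDiff.contDiffAt).comp M₀ hγ
  refine (h2.congr_of_eventuallyEq (Filter.Eventually.of_forall fun M => ?_)).contDiffWithinAt
  have : retract (Matrix.of M) * g = g₀ * (g₀⁻¹ * retract (Matrix.of M) * g) := by group
  change (indRep d odd t (retract (Matrix.of M)) * indRep d odd t g) _ =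
    (indRep d odd t g₀ * indRep d odd t _) _
  rw [← map_mul, ← map_mul, this]

/-- The curve `N` stands for the inverses of the group elements, whence the minus sign in its
derivative. -/
theorem hasDerivAt_indFun (odd : Bool) (t : ℝ) (f : TestFn d)
    {N : ℝ → Matrix (Fin (d + 1)) (Fin (d + 1)) ℝ} {Y : Matrix (Fin (d + 1)) (Fin (d + 1)) ℝ}
    (hN : ∀ a b, HasDerivAt (fun τ => N τ a b) (-Y a b) 0) (h1 : N 0 = 1) (x : Fin d → ℝ) :
    HasDerivAt (fun τ => indFun odd t (N τ) f.1 x) ((TestFn.liOp t Y f).1 x) 0 := by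
  have hmv : ∀ a, HasDerivAt (fun τ => (N τ).mulVec (affVec x) a) (-(Y.mulVec (affVec x) a)) 0 := by
    intro a
    have : -(Y.mulVec (affVec x) a) = ∑ b, -Y a b * affVec x b := by
      simp [Matrix.mulVec, dotProduct]
    rw [this]
    exact HasDerivAt.fun_sum (u := Finset.univ) (A := fun b τ => N τ a b * affVec x b)
      fun b _ => (hN a b).mul_const _
  have hden : HasDerivAt (fun τ => den (N τ) x) (-(Y.mulVec (affVec x) 0)) 0 := hmv 0
  have hd1 : den (N 0) x = 1 := by rw [h1, den_one]
  have hp1 : proj (N 0) x = x := by rw [h1, proj_one]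
  have hk1 : ∀ k : Fin d, (N 0).mulVec (affVec x) k.succ = x k := by
    intro k; rw [h1]; simp [affVec]
  have hproj : HasDerivAt (fun τ => proj (N τ) x)
      (-(fun k : Fin d => Y.mulVec (affVec x) k.succ - x k * Y.mulVec (affVec x) 0)) 0 := by
    refine hasDerivAt_pi.2 fun k => ?_
    have := (hmv k.succ).div hden (by rw [hd1]; exact one_ne_zero)
    refine this.congr_deriv ?_
    rw [hd1, hk1]; simp; ring
  have hlog := (hden.log (by rw [hd1]; exact one_ne_zero)).ofReal_comp
  rw [hd1] at hlog
  have hexp := (hlog.const_mul (-((((d : ℝ) + 1) / 2 : ℝ) + t * Complex.I : ℂ))).cexp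
  have hf : HasDerivAt (fun τ => f.1 (proj (N τ) x)) _ 0 :=
    ((f.2.1.differentiable (by simp) (proj (N 0) x)).hasFDerivAt).comp_hasDerivAt 0 hproj
  have hev : ∀ᶠ τ in nhds (0 : ℝ), 0 < den (N τ) x :=
    continuousAt_const.eventually_lt hden.continuousAt (by rw [hd1]; exact one_pos)
  refine ((hexp.mul hf).congr_of_eventuallyEq ?_).congr_deriv ?_
  · filter_upwards [hev] with τ hτ
    rw [indFun, multiplier_of_pos odd t hτ]; rfl
  · rw [TestFn.liOp_apply, hd1, hp1, map_neg]
    simp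
    ring

theorem hasDerivAt_orbit (odd : Bool) (t : ℝ) (f : TestFn d)
    {N : ℝ → Matrix (Fin (d + 1)) (Fin (d + 1)) ℝ} {Y : Matrix (Fin (d + 1)) (Fin (d + 1)) ℝ}
    (hs : ∀ a b, ContDiff ℝ ∞ fun τ => N τ a b) (hdet : ∀ τ, (N τ).det = 1)
    (hN : ∀ a b, HasDerivAt (fun τ => N τ a b) (-Y a b) 0) (h1 : N 0 = 1) :
    HasDerivAt (fun τ => toL2 (indFun odd t (N τ) f.1)) (TestFn.vec (TestFn.liOp t Y f)) 0 := by
  obtain ⟨U, -, hpU, K, hK⟩ := exists_smoothFamily_indFun odd t f isOpen_univ (p₀ := (0 : ℝ))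
    trivial (fun a b => (hs a b).contDiffOn) (fun τ _ => hdet τ) h1
  have h2 := (hK.hasFDerivAt_toL2 hpU).hasDerivAt
  rw [evalL2_toL2 (hK.deriv.memLp hpU)] at h2
  refine h2.congr_deriv ?_
  change _ = toL2 _
  congr 1
  funext x
  exact (hasDerivAt_indFun odd t f hN h1 x).deriv

theorem oneParam_inv (b : BasisIdx d) (τ : ℝ) : (oneParam b τ)⁻¹ = oneParam b (-τ) := by
  refine inv_eq_of_mul_eq_one_right ?_
  ext1 i j
  change (NormedSpace.exp (τ • basisVec b) * NormedSpace.exp (-τ • basisVec b)) i j = _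
  rw [← Matrix.exp_add_of_commute _ _ ((Commute.refl _).smul_left _ |>.smul_right _), ← add_smul]
  simp

theorem oneParam_entry (b : BasisIdx d) (i j : Fin (d + 1)) :
    ContDiff ℝ ∞ (fun τ => (oneParam b τ).1 i j) ∧
      HasDerivAt (fun τ => (oneParam b τ).1 i j) (basisVec b i j) 0 := by
  rcases b with l | p
  · have h : ∀ τ, (oneParam (.inl l : BasisIdx d) τ).1 i j = if i = j then
        Real.exp (τ * ((if i = l.castSucc then 1 else 0) - if i = l.succ then 1 else 0)) else 0 := by
      intro τ
      change NormedSpace.exp (τ • basisVec (.inl l)) i j = _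
      rw [exp_cartan, Matrix.diagonal_apply]
    simp only [h]
    have hb : basisVec (.inl l : BasisIdx d) i j = if i = j then
        ((if i = l.castSucc then 1 else 0) - if i = l.succ then 1 else 0 : ℝ) else 0 := by
      simp only [basisVec, Matrix.sub_apply, Matrix.single_apply]
      by_cases hij : i = j
      · subst hij; simp [eq_comm]
      · rw [if_neg hij, if_neg, if_neg, sub_zero]
        · rintro ⟨rfl, h'⟩; exact hij h'
        · rintro ⟨rfl, h'⟩; exact hij h'
    rw [hb]
    by_cases hij : i = j
    · simp only [if_pos hij]
      refine ⟨(contDiff_id.mul contDiff_const).exp, ?_⟩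
      have := ((hasDerivAt_id (0 : ℝ)).mul_const
        ((if i = l.castSucc then 1 else 0) - if i = l.succ then 1 else 0 : ℝ)).exp
      simpa using this
    · simp only [if_neg hij]
      exact ⟨contDiff_const, hasDerivAt_const _ _⟩
  · have h : ∀ τ, (oneParam (.inr p : BasisIdx d) τ).1 i j =
        (1 : Matrix _ _ ℝ) i j + τ * basisVec (.inr p : BasisIdx d) i j := by
      intro τ
      change NormedSpace.exp (τ • basisVec (.inr p)) i j = _
      rw [exp_root]
      simp [Matrix.transvection, basisVec, Matrix.single_apply]
    simp only [h]
    refine ⟨contDiff_const.add (contDiff_id.mul contDiff_const), ?_⟩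
    have := ((hasDerivAt_id (0 : ℝ)).mul_const (basisVec (.inr p : BasisIdx d) i j)).const_add
      ((1 : Matrix (Fin (d + 1)) (Fin (d + 1)) ℝ) i j)
    simpa using this

/-- The basis vector with index `b` conjugated by the inverse of `g`. -/
def conjVec (g : Matrix.SpecialLinearGroup (Fin (d + 1)) ℝ) (b : BasisIdx d) :
    Matrix (Fin (d + 1)) (Fin (d + 1)) ℝ := (g⁻¹).1 * basisVec b * g.1

/-- From `exp(τY) g = g · g⁻¹ exp(τY) g`: the group element moves to the left and the Lie algebra
element gets conjugated. Adapting coordinates to a root vector or to a length scale thus becomes a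
choice of `g`. -/
theorem dRep_rep_vec (odd : Bool) (t : ℝ) (g : Matrix.SpecialLinearGroup (Fin (d + 1)) ℝ)
    (b : BasisIdx d) (f : TestFn d) :
    dRep (indRep d odd t) b (indRep d odd t g (TestFn.vec f)) =
      indRep d odd t g (TestFn.vec (TestFn.liOp t (conjVec g b) f)) := by
  have hmul : ∀ {A B : Matrix (Fin (d + 1)) (Fin (d + 1)) ℝ}
      {M : ℝ → Matrix (Fin (d + 1)) (Fin (d + 1)) ℝ} (i j : Fin (d + 1)) (τ : ℝ),
      (A * M τ * B) i j = ∑ l, (∑ k, A i k * M τ k l) * B l j := by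
    intro A B M i j τ
    simp only [Matrix.mul_apply]
  have hent : ∀ (A B : Matrix (Fin (d + 1)) (Fin (d + 1)) ℝ) (i j : Fin (d + 1)),
      ContDiff ℝ ∞ (fun τ => (A * (oneParam b (-τ)).1 * B) i j) ∧
      HasDerivAt (fun τ => (A * (oneParam b (-τ)).1 * B) i j) (-(A * basisVec b * B) i j) 0 := by
    intro A B i j
    simp only [hmul (M := fun τ => (oneParam b (-τ)).1)]
    constructor
    · exact ContDiff.sum fun l _ => (ContDiff.sum fun k _ => contDiff_const.mul
        ((oneParam_entry b k l).1.comp contDiff_neg)).mul contDiff_const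
    · have : -(A * basisVec b * B) i j = ∑ l, (∑ k, A i k * -(basisVec b k l)) * B l j := by
        simp only [Matrix.mul_apply]
        simp
      rw [this]
      refine HasDerivAt.fun_sum fun l _ => (HasDerivAt.fun_sum fun k _ =>
        HasDerivAt.const_mul _ ?_).mul_const _
      have h0 := (oneParam_entry b k l).2
      rw [← neg_zero] at h0
      exact (HasDerivAt.scomp (0 : ℝ) h0 (hasDerivAt_neg (0 : ℝ))).congr_deriv (by simp)
  have h := hasDerivAt_orbit odd t f (N := fun τ => (g⁻¹).1 * (oneParam b (-τ)).1 * g.1)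
    (Y := conjVec g b) (fun i j => (hent _ _ i j).1) (fun τ => (g⁻¹ * oneParam b (-τ) * g).2)
    (fun i j => (hent _ _ i j).2) (by
      have : oneParam b (-0) = 1 := by
        ext i j; simp [oneParam]
      change (g⁻¹ * oneParam b (-0) * g).1 = 1
      rw [this]; simp)
  have h2 := ((indRep d odd t g).toContinuousLinearMap.restrictScalars ℝ).hasFDerivAt.comp_hasDerivAt
    (0 : ℝ) h
  refine Eq.trans ?_ h2.deriv
  unfold dRep
  congr 1
  funext τ
  have e : oneParam b τ * g = g * (g⁻¹ * oneParam b τ * g) := by group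
  have e2 : (g⁻¹ * oneParam b τ * g)⁻¹ = g⁻¹ * oneParam b (-τ) * g := by
    rw [← oneParam_inv]; group
  change (indRep d odd t (oneParam b τ) * indRep d odd t g) _ = indRep d odd t g _
  rw [← map_mul, e, map_mul]
  change indRep d odd t g (indRep d odd t _ _) = _
  rw [indRep_vec, e2]
  rfl

theorem foldr_dRep_rep_vec (odd : Bool) (t : ℝ) (g : Matrix.SpecialLinearGroup (Fin (d + 1)) ℝ)
    (w : List (BasisIdx d)) (f : TestFn d) :
    w.foldr (dRep (indRep d odd t)) (indRep d odd t g (TestFn.vec f)) =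
      indRep d odd t g (TestFn.vec ((w.map fun b => TestFn.liOp t (conjVec g b)).prod f)) := by
  induction w with
  | nil => rfl
  | cons b w ih => rw [List.foldr_cons, ih, dRep_rep_vec]; rfl

end Test

/-! ### Bounds for words in the Lie algebra, uniform in `t` -/

section Bounds
variable {d : ℕ}

open TestFn in
-- The parameter comes only from the multiplier, which depends on the first coordinate of the
-- transformed vector alone; so only first-row entries of the Lie algebra element are multiplied by
-- `t`.
theorem TestFn.unitOp_eq (t : ℝ) (a b : Fin (d + 1)) :
    unitOp t a b = unitOp 0 a b + (if a = 0 then (t * Complex.I : ℂ) else 0) • mulAff b := by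
  refine Fin.cases ?_ (fun k => ?_) a
  · simp only [unitOp, Fin.cases_zero, if_true]
    simp only [Complex.ofReal_zero, zero_mul, add_zero, add_smul, mul_add, mul_smul_comm, mul_one]
    abel
  · simp [unitOp, Fin.succ_ne_zero]

/-- The size of a matrix which controls `liOp t`: only the first row is weighted with `t`. -/
def rowWeight (t : ℝ) (Y : Matrix (Fin (d + 1)) (Fin (d + 1)) ℝ) : ℝ :=
  ∑ a, ∑ b, |Y a b| * (if a = 0 then 1 + |t| else 1)

theorem rowWeight_nonneg (t : ℝ) (Y : Matrix (Fin (d + 1)) (Fin (d + 1)) ℝ) :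
    0 ≤ rowWeight t Y := by
  refine Finset.sum_nonneg fun a _ => Finset.sum_nonneg fun b _ => ?_
  split_ifs <;> positivity

/-- Induction on the length of the word, peeling off the operator that acts first. It replaces `B`
by finitely many test functions independent of `t`, and for this reason the statement is proved for
all `B` simultaneously. -/
theorem TestFn.norm_vec_prod_le (k : ℕ) : ∀ B : TestFn d, ∃ C : ℝ, 0 ≤ C ∧
    ∀ (t : ℝ) (l : List (Matrix (Fin (d + 1)) (Fin (d + 1)) ℝ)), l.length = k →
      ‖vec ((l.map (liOp t)).prod B)‖ ≤ C * (l.map (rowWeight t)).prod := by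
  induction k with
  | zero =>
    intro B
    refine ⟨‖vec B‖, norm_nonneg _, fun t l hl => ?_⟩
    rw [List.length_eq_zero_iff.1 hl]; simp
  | succ k ih =>
    intro B
    choose C hC0 hC using ih
    refine ⟨∑ a, ∑ b, (C (unitOp 0 a b B) + C (mulAff b B)), Finset.sum_nonneg fun a _ =>
      Finset.sum_nonneg fun b _ => add_nonneg (hC0 _) (hC0 _), fun t l hl => ?_⟩
    obtain rfl | ⟨l', Y, rfl⟩ := List.eq_nil_or_concat' l
    · simp at hl
    have hl' : l'.length = k := by simpa using hl
    set p := (l'.map (rowWeight t)).prod with hp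
    have hp0 : 0 ≤ p := by
      refine List.prod_nonneg fun x hx => ?_
      obtain ⟨y, -, rfl⟩ := List.mem_map.1 hx
      exact rowWeight_nonneg t y
    have hterm : ∀ a b, ‖vec ((l'.map (liOp t)).prod (unitOp t a b B))‖ ≤
        (if a = 0 then 1 + |t| else 1) * (C (unitOp 0 a b B) + C (mulAff b B)) * p := by
      intro a b
      rw [unitOp_eq, LinearMap.add_apply, map_add, map_add, LinearMap.smul_apply, map_smul,
        map_smul]
      refine (norm_add_le _ _).trans ?_
      rw [norm_smul]
      have h1 := hC (unitOp 0 a b B) t l' hl'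
      have h2 := hC (mulAff b B) t l' hl'
      have c1 := mul_nonneg (hC0 (unitOp 0 a b B)) hp0
      have c2 := mul_nonneg (hC0 (mulAff b B)) hp0
      by_cases ha : a = 0
      · simp only [if_pos ha]
        have h3 : ‖(t * Complex.I : ℂ)‖ = |t| := by simp
        rw [h3]
        have := mul_le_mul_of_nonneg_left h2 (abs_nonneg t)
        nlinarith [mul_nonneg (abs_nonneg t) c1]
      · simp only [if_neg ha, norm_zero, zero_mul]
        nlinarith
    have hsum : vec (((l' ++ [Y]).map (liOp t)).prod B) =
        ∑ a, ∑ b, (Y a b : ℂ) • vec ((l'.map (liOp t)).prod (unitOp t a b B)) := by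
      rw [List.map_append, List.prod_append, List.map_singleton, List.prod_singleton]
      change vec ((l'.map (liOp t)).prod (liOp t Y B)) = _
      rw [liOp]
      simp only [LinearMap.sum_apply, map_sum, LinearMap.smul_apply, map_smul]
    have hprod : ((l' ++ [Y]).map (rowWeight t)).prod = p * rowWeight t Y := by
      simp [hp]
    rw [hsum, hprod]
    refine (norm_sum_le _ _).trans ?_
    have hCab : ∀ a b, C (unitOp 0 a b B) + C (mulAff b B) ≤
        ∑ a, ∑ b, (C (unitOp 0 a b B) + C (mulAff b B)) := by
      intro a b
      have hnn : ∀ a b, 0 ≤ C (unitOp 0 a b B) + C (mulAff b B) :=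
        fun a b => add_nonneg (hC0 _) (hC0 _)
      refine (Finset.single_le_sum (f := fun b => C (unitOp 0 a b B) + C (mulAff b B))
        (fun b _ => hnn a b) (Finset.mem_univ b)).trans ?_
      exact Finset.single_le_sum (f := fun a => ∑ b, (C (unitOp 0 a b B) + C (mulAff b B)))
        (fun a _ => Finset.sum_nonneg fun b _ => hnn a b) (Finset.mem_univ a)
    set S := ∑ a, ∑ b, (C (unitOp 0 a b B) + C (mulAff b B)) with hS
    rw [rowWeight, ← mul_assoc, Finset.mul_sum]
    refine Finset.sum_le_sum fun a _ => (norm_sum_le _ _).trans ?_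
    rw [Finset.mul_sum]
    refine Finset.sum_le_sum fun b _ => ?_
    rw [norm_smul, Complex.norm_real, Real.norm_eq_abs]
    refine (mul_le_mul_of_nonneg_left (hterm a b) (abs_nonneg _)).trans ?_
    have hw : 0 ≤ (if a = 0 then 1 + |t| else 1) := by split_ifs <;> positivity
    calc |Y a b| * ((if a = 0 then 1 + |t| else 1) * (C (unitOp 0 a b B) + C (mulAff b B)) * p)
        ≤ |Y a b| * ((if a = 0 then 1 + |t| else 1) * S * p) := by
          gcongr
          exact hCab a b
      _ = S * p * (|Y a b| * (if a = 0 then 1 + |t| else 1)) := by ring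

/-- Unitarity removes `g`, and all dependence on the parameters sits in the size `R` of the
conjugated basis. The constant may therefore be used for group elements varying with `t`. -/
theorem norm_foldr_dRep_le (k : ℕ) (B : TestFn d) : ∃ C : ℝ, 0 ≤ C ∧
    ∀ (odd : Bool) (t : ℝ) (g : Matrix.SpecialLinearGroup (Fin (d + 1)) ℝ) (R : ℝ),
      (∀ b, rowWeight t (conjVec g b) ≤ R) → ∀ w : List (BasisIdx d), w.length = k →
        ‖w.foldr (dRep (indRep d odd t)) (indRep d odd t g (TestFn.vec B))‖ ≤ C * R ^ k := by
  obtain ⟨C, hC0, hC⟩ := TestFn.norm_vec_prod_le k B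
  refine ⟨C, hC0, fun odd t g R hR w hw => ?_⟩
  rw [foldr_dRep_rep_vec, LinearIsometry.norm_map]
  have h1 := hC t (w.map (conjVec g)) (by simpa using hw)
  rw [List.map_map, List.map_map] at h1
  refine h1.trans (mul_le_mul_of_nonneg_left ?_ hC0)
  rw [← hw]
  clear h1 hw
  induction w with
  | nil => simp
  | cons b w ih =>
    rw [List.map_cons, List.prod_cons, List.length_cons, pow_succ']
    refine mul_le_mul (hR b) ih (List.prod_nonneg fun x hx => ?_)
      ((rowWeight_nonneg _ _).trans (hR b))
    obtain ⟨y, -, rfl⟩ := List.mem_map.1 hx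
    exact rowWeight_nonneg _ _

end Bounds

/-! ### Sobolev norms of real order by interpolation -/

section Sobolev
variable {d : ℕ} {H : Type*} [NormedAddCommGroup H] [InnerProductSpace ℂ H]
  (π : Matrix.SpecialLinearGroup (Fin (d + 1)) ℝ →* (H →ₗᵢ[ℂ] H))

theorem wordNormSq_nonneg (k : ℕ) (v : H) : 0 ≤ wordNormSq π k v :=
  Finset.sum_nonneg fun _ _ => Finset.sum_nonneg fun _ _ => sq_nonneg _

theorem foldr_dRep_zero (w : List (BasisIdx d)) : w.foldr (dRep π) 0 = 0 := by
  induction w with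
  | nil => rfl
  | cons b w ih => rw [List.foldr_cons, ih]; simp [dRep]

theorem wordNormSq_zero (k : ℕ) : wordNormSq π k 0 = 0 := by
  simp [wordNormSq, foldr_dRep_zero]

theorem isSmoothVec_zero : IsSmoothVec π 0 := by
  unfold IsSmoothVec
  simp only [map_zero]
  exact contDiffOn_const

theorem kFunctional_nonneg (k : ℕ) (τ : ℝ) (v : H) : 0 ≤ kFunctional π k τ v :=
  Real.iInf_nonneg fun _ => add_nonneg (wordNormSq_nonneg π _ _)
    (mul_nonneg (sq_nonneg _) (wordNormSq_nonneg π _ _))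

theorem kFunctional_le (k : ℕ) (τ : ℝ) (v : H) {w : H} (hw : IsSmoothVec π w) :
    kFunctional π k τ v ≤ wordNormSq π k (v - w) + τ ^ 2 * wordNormSq π (k + 1) w :=
  ciInf_le (f := fun w : {w : H // IsSmoothVec π w} =>
      wordNormSq π k (v - w) + τ ^ 2 * wordNormSq π (k + 1) w)
    ⟨0, by
      rintro _ ⟨w, rfl⟩
      exact add_nonneg (wordNormSq_nonneg π _ _)
        (mul_nonneg (sq_nonneg _) (wordNormSq_nonneg π _ _))⟩ ⟨w, hw⟩

theorem kFunctional_le_left (k : ℕ) (τ : ℝ) (v : H) :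
    kFunctional π k τ v ≤ wordNormSq π k v := by
  simpa [wordNormSq_zero] using kFunctional_le π k τ v (isSmoothVec_zero π)

theorem kFunctional_le_right (k : ℕ) (τ : ℝ) {v : H} (hv : IsSmoothVec π v) :
    kFunctional π k τ v ≤ τ ^ 2 * wordNormSq π (k + 1) v := by
  simpa [wordNormSq_zero] using kFunctional_le π k τ v hv

/-- The two trivial competitors suffice: `w = v` for `τ ≤ T⁻¹` and `w = 0` beyond. -/
theorem integral_kFunctional_le (k : ℕ) {θ : ℝ} (h0 : 0 < θ) (h1 : θ < 1) {v : H}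
    (hv : IsSmoothVec π v) {a b T : ℝ} (hT : 0 < T) (ha : wordNormSq π k v ≤ a)
    (hb : wordNormSq π (k + 1) v ≤ b) :
    ∫ τ in Set.Ioi (0 : ℝ), τ ^ (-(2 * θ + 1)) * kFunctional π k τ v ≤
      b * T ^ (-(2 - 2 * θ)) / (2 - 2 * θ) + a * T ^ (2 * θ) / (2 * θ) := by
  have hTi : 0 < T⁻¹ := inv_pos.2 hT
  have i1 : IntegrableOn (fun τ : ℝ => τ ^ (1 - 2 * θ)) (Set.Ioc 0 T⁻¹) := by
    rw [← intervalIntegrable_iff_integrableOn_Ioc_of_le hTi.le]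
    exact intervalIntegral.intervalIntegrable_rpow' (by linarith)
  have i2 : IntegrableOn (fun τ : ℝ => τ ^ (-(2 * θ + 1))) (Set.Ioi T⁻¹) :=
    integrableOn_Ioi_rpow_of_lt (by linarith) hTi
  have e1 : ∫ τ in Set.Ioc 0 T⁻¹, τ ^ (1 - 2 * θ) = T ^ (-(2 - 2 * θ)) / (2 - 2 * θ) := by
    rw [← intervalIntegral.integral_of_le hTi.le, integral_rpow (Or.inl (by linarith))]
    rw [Real.zero_rpow (by linarith), sub_zero, Real.inv_rpow hT.le, ← Real.rpow_neg hT.le,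
      show 1 - 2 * θ + 1 = 2 - 2 * θ by ring]
  have e2 : ∫ τ in Set.Ioi T⁻¹, τ ^ (-(2 * θ + 1)) = T ^ (2 * θ) / (2 * θ) := by
    rw [integral_Ioi_rpow_of_lt (by linarith) hTi, Real.inv_rpow hT.le, ← Real.rpow_neg hT.le]
    rw [neg_div, ← div_neg]
    congr 2 <;> ring
  set h : ℝ → ℝ := fun τ => (Set.Ioc 0 T⁻¹).indicator (fun τ => b * τ ^ (1 - 2 * θ)) τ +
    (Set.Ioi T⁻¹).indicator (fun τ => a * τ ^ (-(2 * θ + 1))) τ with hh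
  have j1 : Integrable ((Set.Ioc 0 T⁻¹).indicator (fun τ => b * τ ^ (1 - 2 * θ)))
      (volume.restrict (Set.Ioi 0)) :=
    ((integrable_indicator_iff measurableSet_Ioc).2 (i1.const_mul b)).restrict
  have j2 : Integrable ((Set.Ioi T⁻¹).indicator (fun τ => a * τ ^ (-(2 * θ + 1))))
      (volume.restrict (Set.Ioi 0)) :=
    ((integrable_indicator_iff measurableSet_Ioi).2 (i2.const_mul a)).restrict
  have key : ∫ τ in Set.Ioi (0 : ℝ), τ ^ (-(2 * θ + 1)) * kFunctional π k τ v ≤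
      ∫ τ in Set.Ioi (0 : ℝ), h τ := by
    -- Only the majorant has to be integrable, so measurability of the K-functional in `τ` plays no
    -- role.
    refine integral_mono_of_nonneg ?_ (j1.add j2) ?_
    · filter_upwards [ae_restrict_mem measurableSet_Ioi] with τ hτ
      exact mul_nonneg (Real.rpow_nonneg (le_of_lt hτ) _) (kFunctional_nonneg π _ _ _)
    · filter_upwards [ae_restrict_mem measurableSet_Ioi] with τ hτ
      have hτ0 : 0 < τ := hτ
      have hp : 0 ≤ τ ^ (-(2 * θ + 1)) := Real.rpow_nonneg hτ0.le _
      by_cases hle : τ ≤ T⁻¹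
      · have : h τ = b * τ ^ (1 - 2 * θ) := by
          simp [hh, hτ0, hle]
        rw [this]
        refine (mul_le_mul_of_nonneg_left (kFunctional_le_right π k τ hv) hp).trans ?_
        have e : τ ^ (1 - 2 * θ) = τ ^ (-(2 * θ + 1)) * τ ^ 2 := by
          rw [← Real.rpow_natCast, ← Real.rpow_add hτ0]
          congr 1; push_cast; ring
        rw [e]
        have := mul_le_mul_of_nonneg_left hb (mul_nonneg hp (sq_nonneg τ))
        linarith
      · have : h τ = a * τ ^ (-(2 * θ + 1)) := by
          simp only [hh]
          rw [Set.indicator_of_notMem (by simp [hle]), Set.indicator_of_mem (by simpa using hle),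
            zero_add]
        rw [this, mul_comm a]
        exact mul_le_mul_of_nonneg_left ((kFunctional_le_left π k τ v).trans ha) hp
  refine key.trans (le_of_eq ?_)
  rw [integral_add j1 j2, setIntegral_indicator measurableSet_Ioc,
    setIntegral_indicator measurableSet_Ioi,
    Set.inter_eq_right.2 Set.Ioc_subset_Ioi_self,
    Set.inter_eq_right.2 (Set.Ioi_subset_Ioi hTi.le), integral_const_mul, integral_const_mul, e1, e2]
  ring

/-- If a derivative costs a factor `T`, splitting the interpolation integral at `T⁻¹` makes both
pieces of size `T^{2r}`. The constant depends on `Cs` and `r` only, not on the representation. -/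
theorem sobolevNorm_le (Cs : ℕ → ℝ) {r : ℝ} (hr : 0 ≤ r) : ∃ C : ℝ, 0 ≤ C ∧
    ∀ (π : Matrix.SpecialLinearGroup (Fin (d + 1)) ℝ →* (H →ₗᵢ[ℂ] H)) (v : H) (T : ℝ), 0 < T →
      IsSmoothVec π v → (∀ k, wordNormSq π k v ≤ Cs k * T ^ (2 * k)) →
        sobolevNorm π r v ≤ C * T ^ r := by
  set k := ⌊r⌋₊ with hk
  set θ := r - k with hθ
  have hsq : ∀ {C T : ℝ}, 0 < T → √(C * (T ^ r) ^ 2) = √C * T ^ r := by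
    intro C T hT
    rw [Real.sqrt_mul' _ (sq_nonneg _), Real.sqrt_sq (Real.rpow_nonneg hT.le _)]
  by_cases h0 : θ = 0
  · refine ⟨√(Cs k), Real.sqrt_nonneg _, fun π v T hT hv h => ?_⟩
    rw [sobolevNorm, if_pos h0, ← hsq hT]
    refine Real.sqrt_le_sqrt ((h k).trans (le_of_eq ?_))
    have : r = k := by linarith [hθ]
    rw [this, Real.rpow_natCast, ← pow_mul, mul_comm 2 k]
  · have hθ0 : 0 < θ := lt_of_le_of_ne (sub_nonneg.2 (Nat.floor_le hr)) (Ne.symm h0)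
    have hθ1 : θ < 1 := by have := Nat.lt_floor_add_one r; rw [hθ]; linarith
    refine ⟨√(2 * Real.sin (Real.pi * θ) / Real.pi *
      (Cs (k + 1) / (2 - 2 * θ) + Cs k / (2 * θ))), Real.sqrt_nonneg _, fun π v T hT hv h => ?_⟩
    rw [sobolevNorm, if_neg h0, ← hsq hT]
    have hs : 0 ≤ 2 * Real.sin (Real.pi * θ) / Real.pi := by
      have := Real.sin_nonneg_of_nonneg_of_le_pi (x := Real.pi * θ) (by positivity)
        (by nlinarith [Real.pi_pos])
      positivity
    refine Real.sqrt_le_sqrt ?_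
    rw [mul_assoc]
    refine mul_le_mul_of_nonneg_left ?_ hs
    refine (integral_kFunctional_le π k hθ0 hθ1 hv hT (h k) (h (k + 1))).trans (le_of_eq ?_)
    have e1 : T ^ (2 * (k + 1)) * T ^ (-(2 - 2 * θ)) = (T ^ r) ^ 2 := by
      rw [← Real.rpow_natCast, ← Real.rpow_natCast, ← Real.rpow_mul hT.le, ← Real.rpow_add hT]
      congr 1; push_cast; rw [hθ]; ring
    have e2 : T ^ (2 * k) * T ^ (2 * θ) = (T ^ r) ^ 2 := by
      rw [← Real.rpow_natCast, ← Real.rpow_natCast, ← Real.rpow_mul hT.le, ← Real.rpow_add hT]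
      congr 1; push_cast; rw [hθ]; ring
    rw [mul_assoc, mul_assoc, e1, e2]; ring

/-- As `R ≥ 1`, the words of maximal length dominate. -/
theorem wordNormSq_le (C : ℕ → ℝ) (k : ℕ) {v : H} {R : ℝ} (hR : 1 ≤ R)
    (h : ∀ w : List (BasisIdx d), ‖w.foldr (dRep π) v‖ ≤ C w.length * R ^ w.length) :
    wordNormSq π k v ≤
      (∑ m ∈ Finset.range (k + 1), Fintype.card (Fin m → BasisIdx d) * C m ^ 2) * R ^ (2 * k) := by
  rw [wordNormSq, Finset.sum_mul]
  refine Finset.sum_le_sum fun m hm => ?_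
  have hmk : m ≤ k := Nat.lt_succ_iff.1 (Finset.mem_range.1 hm)
  have : ∀ w : Fin m → BasisIdx d, ‖(List.ofFn w).foldr (dRep π) v‖ ^ 2 ≤ C m ^ 2 * R ^ (2 * k) := by
    intro w
    have h1 := h (List.ofFn w)
    rw [List.length_ofFn] at h1
    refine (pow_le_pow_left₀ (norm_nonneg _) h1 2).trans ?_
    rw [mul_pow, ← pow_mul]
    refine mul_le_mul_of_nonneg_left (pow_le_pow_right₀ hR (by omega)) (sq_nonneg _)
  refine (Finset.sum_le_card_nsmul _ _ _ fun w _ => this w).trans (le_of_eq ?_)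
  rw [Finset.card_univ, nsmul_eq_mul]; ring

end Sobolev

/-! ### The oscillatory integral with phase `z - log z` -/

section StationaryPhase
open Filter Topology Set

theorem integrable_exp_neg_mul_id : IntegrableOn (fun x : ℝ => x * Real.exp (-x)) (Ioi 0) := by
  have := Real.GammaIntegral_convergent (s := 2) (by norm_num)
  refine this.congr_fun (fun x hx => ?_) measurableSet_Ioi
  norm_num [mul_comm]

/-- The integral `∫ x^{a-1} e^{-(1-iu)x}` on the positive half line. -/
theorem integral_cpow_mul_exp_mul_cpow {a : ℂ} (ha : a.re = 1) (u : ℝ) :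
    (∫ x in Ioi (0 : ℝ), (x : ℂ) ^ (a - 1) * Complex.exp (-(1 - u * Complex.I) * x)) *
      (1 - u * Complex.I) ^ a = Complex.Gamma a := by
  set F : ℝ → ℝ → ℂ := fun u x => (x : ℂ) ^ (a - 1) * Complex.exp (-(1 - u * Complex.I) * x) with hF
  have hFc : ∀ u, ContinuousOn (F u) (Ioi 0) := by
    intro u
    refine ContinuousOn.mul ?_ (by fun_prop)
    intro x hx
    refine ContinuousAt.continuousWithinAt ?_
    exact (continuousAt_cpow_const (Or.inl (by simpa using hx))).comp
      Complex.continuous_ofReal.continuousAt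
  -- Because `Re a = 1`, the modulus does not depend on `u`, which gives a dominating function for
  -- differentiation in `u`.
  have hFn : ∀ u, ∀ x ∈ Ioi (0 : ℝ), ‖F u x‖ = Real.exp (-x) := by
    intro u x hx
    rw [hF, norm_mul, Complex.norm_cpow_eq_rpow_re_of_pos hx, Complex.norm_exp]
    simp [ha]
  have hFm : ∀ u, AEStronglyMeasurable (F u) (volume.restrict (Ioi 0)) := fun u =>
    (hFc u).aestronglyMeasurable measurableSet_Ioi
  have hexp : IntegrableOn (fun x : ℝ => Real.exp (-x)) (Ioi 0) := integrableOn_exp_neg_Ioi 0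
  have hFi : ∀ u, IntegrableOn (F u) (Ioi 0) := fun u => by
    refine Integrable.mono' hexp (hFm u) ?_
    filter_upwards [ae_restrict_mem measurableSet_Ioi] with x hx using (hFn u x hx).le
  set F' : ℝ → ℝ → ℂ := fun u x => Complex.I * x * F u x with hF'
  have hder : ∀ u, IntegrableOn (F' u) (Ioi 0) ∧
      HasDerivAt (fun u => ∫ x in Ioi 0, F u x) (∫ x in Ioi 0, F' u x) u := by
    intro u
    refine hasDerivAt_integral_of_dominated_loc_of_deriv_le (s := univ)
      (bound := fun x => x * Real.exp (-x)) univ_mem (Eventually.of_forall hFm) (hFi u) ?_ ?_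
      integrable_exp_neg_mul_id ?_
    · exact ((by fun_prop : Continuous fun x : ℝ => Complex.I * (x : ℂ)).aestronglyMeasurable).mul
        (hFm u)
    · filter_upwards [ae_restrict_mem measurableSet_Ioi] with x hx v _
      have hx' : 0 < x := hx
      simp only [hF']
      rw [norm_mul, hFn v x hx]
      simp [abs_of_pos hx']
    · refine Eventually.of_forall fun x v _ => ?_
      have h1 : HasDerivAt (fun v : ℝ => -(1 - (v : ℂ) * Complex.I) * x) (Complex.I * x) v := by
        have := ((((hasDerivAt_id v).ofReal_comp).mul_const Complex.I).const_sub 1).neg.mul_const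
          (x : ℂ)
        simpa using this
      have := h1.cexp.const_mul ((x : ℂ) ^ (a - 1))
      refine this.congr_deriv ?_
      simp only [hF', hF]; ring
  have hibp : ∀ u, a * (∫ x in Ioi 0, F u x) =
      (1 - u * Complex.I) * ∫ x in Ioi 0, x * F u x := by
    intro u
    have hxF : IntegrableOn (fun x : ℝ => x * F u x) (Ioi 0) := by
      have : IntegrableOn (fun x => -Complex.I * F' u x) (Ioi 0) := (hder u).1.const_mul (-Complex.I)
      refine this.congr_fun (fun x _ => ?_) measurableSet_Ioi
      change -Complex.I * (Complex.I * x * F u x) = x * F u x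
      linear_combination (-(x * F u x)) * Complex.I_mul_I
    have h0 := integral_Ioi_of_hasDerivAt_of_tendsto (a := (0 : ℝ)) (m := (0 : ℂ))
      (f := fun x : ℝ => x * F u x)
      (f' := fun x => a * F u x - (1 - u * Complex.I) * (x * F u x)) ?_ ?_ ?_ ?_
    · rw [integral_sub ((hFi u).const_mul a) (hxF.const_mul _), integral_const_mul,
        integral_const_mul] at h0
      simp only [Complex.ofReal_zero, zero_mul, sub_zero] at h0
      exact sub_eq_zero.1 h0
    · have hle : ∀ x ∈ Ici (0 : ℝ), ‖x * F u x‖ ≤ x := by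
        intro x hx
        rcases (show (0 : ℝ) ≤ x from hx).eq_or_lt with rfl | h
        · simp
        · rw [norm_mul, hFn u x h, Complex.norm_real, Real.norm_of_nonneg h.le]
          have : Real.exp (-x) ≤ 1 := Real.exp_le_one_iff.2 (by linarith)
          nlinarith
      rw [ContinuousWithinAt]
      simp only [Complex.ofReal_zero, zero_mul]
      refine squeeze_zero_norm' (a := fun x : ℝ => x) ?_ ?_
      · filter_upwards [self_mem_nhdsWithin] with x hx using hle x hx
      · exact (continuous_id.tendsto (0 : ℝ)).mono_left nhdsWithin_le_nhds
    · intro x hx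
      have hx0 : (0 : ℝ) < x := hx
      have hxc : (x : ℂ) ≠ 0 := by exact_mod_cast hx0.ne'
      have hid : HasDerivAt (fun x : ℝ => (x : ℂ)) 1 x := (hasDerivAt_id x).ofReal_comp
      have h1 : HasDerivAt (fun x : ℝ => (x : ℂ) ^ a) (a * (x : ℂ) ^ (a - 1)) x := by
        have h1' : HasDerivAt (fun z : ℂ => z ^ a) (a * (x : ℂ) ^ (a - 1) * 1) (x : ℂ) :=
          (hasDerivAt_id (x : ℂ)).cpow_const (Or.inl (by simpa using hx0))
        rw [mul_one] at h1'
        exact h1'.comp_ofReal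
      have h2 : HasDerivAt (fun x : ℝ => Complex.exp (-(1 - u * Complex.I) * x))
          (Complex.exp (-(1 - u * Complex.I) * x) * (-(1 - u * Complex.I) * 1)) x :=
        (hid.const_mul _).cexp
      refine ((h1.mul h2).congr_of_eventuallyEq ?_).congr_deriv ?_
      · filter_upwards [lt_mem_nhds hx0] with y hy
        have hyc : (y : ℂ) ≠ 0 := by exact_mod_cast hy.ne'
        simp only [hF]
        rw [← mul_assoc, Complex.cpow_sub _ _ hyc, Complex.cpow_one]
        simp only [Pi.mul_apply]
        field_simp
      · simp only [hF]
        have : (x : ℂ) ^ a = x * (x : ℂ) ^ (a - 1) := by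
          rw [Complex.cpow_sub _ _ hxc, Complex.cpow_one]; field_simp
        rw [this]; ring
    · exact ((hFi u).const_mul a).sub (hxF.const_mul _)
    · rw [tendsto_zero_iff_norm_tendsto_zero]
      have h1 := Real.tendsto_pow_mul_exp_neg_atTop_nhds_zero 1
      refine h1.congr' ?_
      filter_upwards [eventually_gt_atTop 0] with x hx
      rw [norm_mul, hFn u x hx, Complex.norm_real, Real.norm_of_nonneg hx.le, pow_one]
  have hr0 : ∀ u : ℝ, (1 - u * Complex.I : ℂ) ∈ Complex.slitPlane := fun u => Or.inl (by simp)
  -- Integration by parts turns the `u`-derivative of the integral into `ia/(1 - iu)` times the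
  -- integral, exactly opposite to the logarithmic derivative of `(1 - iu)^a`. The product is
  -- constant, and its value at `u = 0` is the Gamma integral.
  have hconst : ∀ u : ℝ, HasDerivAt (fun u : ℝ =>
      (∫ x in Ioi 0, F u x) * (1 - u * Complex.I : ℂ) ^ a) 0 u := by
    intro u
    have h1 : HasDerivAt (fun u : ℝ => (1 - u * Complex.I : ℂ)) (-Complex.I) u := by
      simpa using (((hasDerivAt_id u).ofReal_comp).mul_const Complex.I).const_sub 1
    have h2 : HasDerivAt (fun u : ℝ => (1 - u * Complex.I : ℂ) ^ a)
        (a * (1 - u * Complex.I) ^ (a - 1) * (-Complex.I)) u := by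
      have h3 : HasDerivAt (fun z : ℂ => z ^ a) (a * (1 - u * Complex.I) ^ (a - 1) * 1)
        (1 - u * Complex.I) := (hasDerivAt_id _).cpow_const (hr0 u)
      rw [mul_one] at h3
      exact h3.comp u h1
    refine ((hder u).2.mul h2).congr_deriv ?_
    have hne : (1 - u * Complex.I : ℂ) ≠ 0 := Complex.slitPlane_ne_zero (hr0 u)
    have h3 : ∫ x in Ioi 0, F' u x = Complex.I * ∫ x in Ioi 0, x * F u x := by
      rw [← integral_const_mul]
      refine integral_congr_ae (Eventually.of_forall fun x => ?_)
      simp only [hF']; ring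
    rw [h3]
    have h4 := hibp u
    rw [Complex.cpow_sub _ _ hne, Complex.cpow_one]
    have h5 : a * (∫ x in Ioi 0, F u x) / (1 - u * Complex.I) = ∫ x in Ioi 0, x * F u x := by
      rw [h4]; field_simp
    rw [← h5]
    field_simp
    ring
  have hdiff : Differentiable ℝ (fun u : ℝ =>
      (∫ x in Ioi 0, F u x) * (1 - u * Complex.I : ℂ) ^ a) := fun u => (hconst u).differentiableAt
  have := is_const_of_deriv_eq_zero hdiff (fun u => (hconst u).deriv) u 0
  rw [this]
  simp only [Complex.ofReal_zero, zero_mul, sub_zero, Complex.one_cpow, mul_one]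
  rw [Complex.Gamma_eq_integral (by rw [ha]; norm_num), Complex.GammaIntegral]
  refine integral_congr_ae (Eventually.of_forall fun x => ?_)
  simp [hF, mul_comm]

/-- The reflection formula together with `Γ(1 + it) = it Γ(it)`, the conjugate of `Γ(1 - it)`, gives
`|Γ(1 - it)|² = πt / sinh(πt)`. -/
theorem norm_Gamma_one_sub_sq {t : ℝ} (ht : t ≠ 0) :
    Real.pi * |t| * Real.exp (-(Real.pi * |t|)) ≤ ‖Complex.Gamma (1 - t * Complex.I)‖ ^ 2 := by
  have htI : (t * Complex.I : ℂ) ≠ 0 := by simp [ht]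
  have h1 := Complex.Gamma_mul_Gamma_one_sub (t * Complex.I)
  have h2 := Complex.Gamma_add_one (t * Complex.I) htI
  have h3 : Complex.Gamma (t * Complex.I + 1) = (starRingEnd ℂ) (Complex.Gamma (1 - t * Complex.I)) := by
    rw [← Complex.Gamma_conj]
    congr 1
    simp [add_comm]
  have h4 : ‖Complex.Gamma (1 - t * Complex.I)‖ ^ 2 = |t| * ‖(Real.pi : ℂ) /
      Complex.sin (Real.pi * (t * Complex.I))‖ := by
    rw [← h1, norm_mul, ← mul_assoc]
    have : |t| * ‖Complex.Gamma (t * Complex.I)‖ = ‖Complex.Gamma (1 - t * Complex.I)‖ := by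
      rw [← Complex.norm_conj (Complex.Gamma (1 - t * Complex.I)), ← h3, h2, norm_mul]; simp
    rw [this, sq]
  have h5 : Complex.sin (Real.pi * (t * Complex.I)) = (Real.sinh (Real.pi * t) : ℂ) * Complex.I := by
    rw [← mul_assoc, Complex.sin_mul_I]; push_cast; rfl
  have h6 : |Real.sinh (Real.pi * t)| ≤ Real.exp (Real.pi * |t|) := by
    rw [Real.abs_sinh, abs_mul, abs_of_pos Real.pi_pos, Real.sinh_eq]
    have := Real.exp_pos (-(Real.pi * |t|))
    have := Real.exp_pos ((Real.pi * |t|))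
    linarith
  have h7 : 0 < |Real.sinh (Real.pi * t)| := by
    rw [abs_pos, Real.sinh_ne_zero]; exact mul_ne_zero Real.pi_ne_zero ht
  rw [h4, h5, norm_div, norm_mul, Complex.norm_I, mul_one, Complex.norm_real, Complex.norm_real,
    Real.norm_of_nonneg Real.pi_pos.le, Real.norm_eq_abs, Real.exp_neg, mul_comm Real.pi, mul_assoc]
  refine mul_le_mul_of_nonneg_left ?_ (abs_nonneg t)
  rw [div_eq_mul_inv]
  refine mul_le_mul_of_nonneg_left ?_ Real.pi_pos.le
  exact inv_anti₀ h7 (by rw [mul_comm |t|]; exact h6)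

/-- For `t > 0`, `arctan t = π/2 - arctan(1/t)` and `arctan(1/t) ≤ 1/t`; the expression is even. -/
theorem mul_arctan_ge {t : ℝ} (ht : t ≠ 0) : Real.pi / 2 * |t| - 1 ≤ t * Real.arctan t := by
  have hpos : ∀ s : ℝ, 0 < s → Real.pi / 2 * s - 1 ≤ s * Real.arctan s := by
    intro s hs
    have h1 := Real.arctan_inv_of_pos hs
    have h2 : Real.arctan s⁻¹ ≤ s⁻¹ := by
      have h0 : 0 ≤ Real.arctan s⁻¹ := Real.arctan_nonneg.2 (by positivity)
      have := Real.le_tan h0 (Real.arctan_lt_pi_div_two _)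
      rwa [Real.tan_arctan] at this
    have h3 : Real.arctan s = Real.pi / 2 - Real.arctan s⁻¹ := by linarith
    rw [h3]
    have : s * Real.arctan s⁻¹ ≤ 1 := by
      have := mul_le_mul_of_nonneg_left h2 hs.le
      rwa [mul_inv_cancel₀ hs.ne'] at this
    linarith
  rcases lt_or_gt_of_ne ht with h | h
  · have := hpos (-t) (by linarith)
    rw [Real.arctan_neg] at this
    rw [abs_of_neg h]; linarith
  · rw [abs_of_pos h]; exact hpos t h

/-- The phase `z - log z`, which is stationary at `1`, with exponential amplitude. -/
theorem norm_integral_phase_exp_ge : ∃ c : ℝ, 0 < c ∧ ∀ t : ℝ, 1 ≤ |t| →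
    c / √|t| ≤ ‖∫ z in Ioi (0 : ℝ), Complex.exp (t * (z - Real.log z : ℝ) * Complex.I) *
      Real.exp (-z)‖ := by
  refine ⟨√(Real.pi * Real.exp (-2) / 2), by positivity, fun t ht => ?_⟩
  have ht0 : t ≠ 0 := by rintro rfl; norm_num at ht
  -- With this exponent, and `u = t`, the integrand of the Gamma formula is the desired one, so the
  -- integral equals `Γ(a) / a^a` exactly.
  set a : ℂ := 1 - t * Complex.I with ha
  have h1 := integral_cpow_mul_exp_mul_cpow (a := a) (by simp [ha]) t
  have h2 : (∫ x in Ioi (0 : ℝ), (x : ℂ) ^ (a - 1) * Complex.exp (-(1 - t * Complex.I) * x)) =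
      ∫ z in Ioi (0 : ℝ), Complex.exp (t * (z - Real.log z : ℝ) * Complex.I) * Real.exp (-z) := by
    refine setIntegral_congr_fun measurableSet_Ioi fun x hx => ?_
    have hx0 : (0 : ℝ) < x := hx
    have hxc : (x : ℂ) ≠ 0 := by exact_mod_cast hx0.ne'
    rw [Complex.cpow_def_of_ne_zero hxc, ← Complex.ofReal_log hx0.le, ← Complex.exp_add,
      Complex.ofReal_exp, ← Complex.exp_add]
    congr 1
    rw [ha]; push_cast; ring
  rw [← h2]
  set I := ∫ x in Ioi (0 : ℝ), (x : ℂ) ^ (a - 1) * Complex.exp (-(1 - t * Complex.I) * x) with hI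
  have hane : a ≠ 0 := by
    intro h; have := congrArg Complex.re h; simp [ha] at this
  have harg : Complex.arg a = -Real.arctan t := by
    have h3 : |Complex.arg a| < Real.pi / 2 :=
      Complex.abs_arg_lt_pi_div_two_iff.2 (Or.inl (by simp [ha]))
    rw [abs_lt] at h3
    rw [← Real.arctan_tan h3.1 h3.2, Complex.tan_arg]
    simp [ha, Real.arctan_neg]
  have hnorm : ‖a‖ ^ 2 = 1 + t ^ 2 := by
    rw [← Complex.normSq_eq_norm_sq, Complex.normSq_apply]; simp [ha]; ring
  have h4 : ‖a ^ a‖ = ‖a‖ * Real.exp (-(t * Real.arctan t)) := by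
    rw [Complex.norm_cpow_of_ne_zero hane, harg, Real.exp_neg, div_eq_mul_inv]
    have : a.re = 1 := by simp [ha]
    rw [this, Real.rpow_one]
    congr 3
    simp [ha]; ring
  have h5 : ‖I‖ ^ 2 * ((1 + t ^ 2) * Real.exp (-(t * Real.arctan t)) ^ 2) =
      ‖Complex.Gamma a‖ ^ 2 := by
    rw [← h1, norm_mul, h4, ← hnorm]; ring
  have h6 := norm_Gamma_one_sub_sq ht0
  rw [← ha, ← h5] at h6
  have h7 := mul_arctan_ge ht0
  -- The exponential decay of `|a^a|²` matches that of `|Γ(a)|²` up to the factor `e²`; only powers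
  -- of `t` remain.
  have h8 : Real.exp (-(t * Real.arctan t)) ^ 2 ≤
      Real.exp (-(Real.pi * |t|)) * Real.exp 2 := by
    rw [← Real.exp_nat_mul, ← Real.exp_add]
    refine Real.exp_le_exp.2 ?_
    push_cast; linarith
  have htt : 1 + t ^ 2 ≤ 2 * |t| ^ 2 := by rw [sq_abs]; nlinarith [sq_abs t]
  have hE := Real.exp_pos (-(Real.pi * |t|))
  have h9 : Real.pi * |t| ≤ ‖I‖ ^ 2 * (2 * |t| ^ 2 * Real.exp 2) := by
    have hstep : Real.pi * |t| * Real.exp (-(Real.pi * |t|)) ≤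
        ‖I‖ ^ 2 * (2 * |t| ^ 2 * Real.exp 2) * Real.exp (-(Real.pi * |t|)) := by
      refine h6.trans ?_
      rw [mul_assoc]
      refine mul_le_mul_of_nonneg_left ?_ (sq_nonneg _)
      calc (1 + t ^ 2) * Real.exp (-(t * Real.arctan t)) ^ 2
          ≤ (2 * |t| ^ 2) * (Real.exp (-(Real.pi * |t|)) * Real.exp 2) := by gcongr
        _ = _ := by ring
    exact le_of_mul_le_mul_right hstep hE
  have hT : 0 < |t| := by linarith
  rw [← Real.sqrt_div (by positivity)]
  refine Real.sqrt_le_iff.2 ⟨norm_nonneg _, ?_⟩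
  rw [div_le_iff₀ hT, Real.exp_neg]
  have hE2 := Real.exp_pos 2
  rw [div_le_iff₀ (by norm_num), ← div_eq_mul_inv, div_le_iff₀ hE2]
  have : Real.pi * |t| ≤ (‖I‖ ^ 2 * |t| * 2 * Real.exp 2) * |t| := by
    refine h9.trans (le_of_eq ?_); ring
  exact le_of_mul_le_mul_right this hT

/-- A cutoff near the stationary point `1`. -/
def statBump : ContDiffBump (1 : ℝ) := ⟨1 / 4, 1 / 2, by norm_num, by norm_num⟩

/-- The amplitude of the wave packet at the stationary point. -/
def statAmp (z : ℝ) : ℝ := Real.exp (-z) * statBump z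

theorem contDiff_statAmp : ContDiff ℝ ∞ statAmp :=
  (contDiff_neg.exp).mul statBump.contDiff

theorem statAmp_eq_zero {z : ℝ} (hz : z ≤ 1 / 2 ∨ 3 / 2 ≤ z) : statAmp z = 0 := by
  rw [statAmp, statBump.zero_of_le_dist, mul_zero]
  rw [Real.dist_eq]
  change 1 / 2 ≤ _
  rcases hz with h | h
  · rw [abs_of_neg (by linarith)]; linarith
  · rw [abs_of_pos (by linarith)]; linarith

/-- The amplitude vanishes near the only stationary point `z = 1`, so it can be divided by the phase
derivative `1 - 1/z`. The quotient is `H`, and one integration by parts gains `1/|t|` with constant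
`∫ |H'|`. -/
theorem exists_nonstationary_bound : ∃ M : ℝ, ∀ t : ℝ, t ≠ 0 →
    ‖∫ z in Ioi (0 : ℝ), Complex.exp (t * (z - Real.log z : ℝ) * Complex.I) *
      (Real.exp (-z) - statAmp z : ℝ)‖ ≤ M / |t| := by
  -- The numerator vanishes near `z = 1`, so the value 0 of the quotient `0/0` there is the smooth
  -- one.
  set h : ℝ → ℝ := fun z => (1 - statBump z) / (z - 1) with hh
  have hb1 : ∀ z : ℝ, |z - 1| ≤ 1 / 4 → statBump z = 1 := fun z hz =>
    statBump.one_of_mem_closedBall (by rw [Metric.mem_closedBall, Real.dist_eq]; exact hz)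
  have hnear : ∀ z : ℝ, |z - 1| ≤ 1 / 4 → h z = 0 := by
    intro z hz
    simp only [hh]
    rw [hb1 z hz]; simp
  have hhsm : ContDiff ℝ ∞ h := by
    refine contDiff_iff_contDiffAt.2 fun z => ?_
    by_cases hz : z = 1
    · refine (contDiffAt_const (c := (0 : ℝ))).congr_of_eventuallyEq ?_
      filter_upwards [Metric.ball_mem_nhds z (ε := 1 / 4) (by norm_num)] with y hy
      rw [Metric.mem_ball, Real.dist_eq, hz] at hy
      exact hnear y hy.le
    · exact (contDiffAt_const.sub statBump.contDiff.contDiffAt).div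
        (contDiffAt_id.sub contDiffAt_const) (sub_ne_zero.2 hz)
  have hhb : ∀ z, |h z| ≤ 4 := by
    intro z
    by_cases hz : |z - 1| ≤ 1 / 4
    · rw [hnear z hz]; norm_num
    · simp only [hh]
      rw [abs_div, div_le_iff₀ (by linarith), abs_of_nonneg (by linarith [statBump.le_one (x := z)])]
      linarith [statBump.nonneg (x := z)]
  have hd := hhsm.differentiable (by simp)
  have hdc : Continuous (deriv h) := hhsm.continuous_deriv (by simp)
  obtain ⟨M₀, hM₀⟩ : ∃ M₀, ∀ z, |deriv h z| ≤ M₀ := by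
    obtain ⟨M₁, hM₁⟩ := (isCompact_Icc (a := (-1 : ℝ)) (b := 3)).exists_bound_of_continuousOn
      hdc.continuousOn
    refine ⟨max M₁ 1, fun z => ?_⟩
    by_cases hz : z ∈ Icc (-1 : ℝ) 3
    · exact (hM₁ z hz).trans (le_max_left _ _)
    · have hz2 : 2 < |z - 1| := by
        rw [mem_Icc, not_and_or, not_le, not_le] at hz
        rcases hz with h | h
        · rw [abs_of_neg (by linarith)]; linarith
        · rw [abs_of_pos (by linarith)]; linarith
      have hev : h =ᶠ[𝓝 z] fun y => (y - 1)⁻¹ := by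
        have : ∀ᶠ y in 𝓝 z, 2 < |y - 1| :=
          continuousAt_const.eventually_lt (by fun_prop) hz2
        filter_upwards [this] with y hy
        simp only [hh]
        rw [statBump.zero_of_le_dist, sub_zero, one_div]
        rw [Real.dist_eq]
        change (1 / 2 : ℝ) ≤ _
        linarith
      have hne : z - 1 ≠ 0 := by intro h0; rw [h0] at hz2; norm_num at hz2
      rw [hev.deriv_eq, show deriv (fun y => (y - 1)⁻¹) z = _ from
        (((hasDerivAt_id z).sub_const 1).inv hne).deriv, abs_div, abs_neg, abs_one,
        abs_of_nonneg (sq_nonneg _), id]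
      refine le_trans ?_ (le_max_right _ _)
      rw [div_le_one (by positivity), ← sq_abs]
      nlinarith
  set H : ℝ → ℝ := fun z => z * Real.exp (-z) * h z with hH
  set H' : ℝ → ℝ := fun z => (Real.exp (-z) - z * Real.exp (-z)) * h z +
    z * Real.exp (-z) * deriv h z with hH'
  have hHd : ∀ z, HasDerivAt H (H' z) z := by
    intro z
    have h1 : HasDerivAt (fun z => z * Real.exp (-z)) (Real.exp (-z) - z * Real.exp (-z)) z := by
      have := (hasDerivAt_id z).mul (hasDerivAt_neg z).exp
      refine this.congr_deriv ?_
      simp; ring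
    exact h1.mul (hd z).hasDerivAt
  have hH'c : Continuous H' := by
    have := hhsm.continuous
    simp only [hH']; fun_prop
  have hH'i : IntegrableOn H' (Ioi 0) := by
    have hexp : IntegrableOn (fun x : ℝ => Real.exp (-x)) (Ioi 0) := integrableOn_exp_neg_Ioi 0
    refine Integrable.mono' ((hexp.const_mul 4).add (integrable_exp_neg_mul_id.const_mul (4 + M₀)))
      hH'c.aestronglyMeasurable ?_
    filter_upwards [ae_restrict_mem measurableSet_Ioi] with z hz
    have hz0 : 0 < z := hz
    have hE := Real.exp_pos (-z)
    simp only [hH', Real.norm_eq_abs, Pi.add_apply]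
    refine (abs_add_le _ _).trans ?_
    rw [abs_mul, abs_mul, abs_of_pos (mul_pos hz0 hE)]
    have h1 : |Real.exp (-z) - z * Real.exp (-z)| ≤ Real.exp (-z) + z * Real.exp (-z) := by
      rw [abs_le]; constructor <;> nlinarith [mul_pos hz0 hE]
    have h2 := mul_le_mul h1 (hhb z) (abs_nonneg _) (by positivity)
    have h3 := mul_le_mul_of_nonneg_left (hM₀ z) (mul_pos hz0 hE).le
    linarith
  refine ⟨∫ z in Ioi 0, |H' z|, fun t ht => ?_⟩
  set e : ℝ → ℂ := fun z => Complex.exp (t * (z - Real.log z : ℝ) * Complex.I) with he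
  have hen : ∀ z, ‖e z‖ = 1 := by
    intro z
    simp only [he]
    rw [← Complex.ofReal_mul, Complex.norm_exp_ofReal_mul_I]
  have hec : ContinuousOn e (Ioi 0) := by
    have : ContinuousOn Real.log (Ioi 0) :=
      Real.continuousOn_log.mono fun x hx => ne_of_gt hx
    simp only [he]; fun_prop
  have hem : AEStronglyMeasurable e (volume.restrict (Ioi 0)) :=
    hec.aestronglyMeasurable measurableSet_Ioi
  set B : ℝ → ℝ := fun z => Real.exp (-z) - statAmp z with hB
  have hBc : Continuous B := by
    have := contDiff_statAmp.continuous
    simp only [hB]; fun_prop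
  have i1 : IntegrableOn (fun z => e z * (B z : ℂ)) (Ioi 0) := by
    refine Integrable.mono' (integrableOn_exp_neg_Ioi 0)
      (hem.mul (Complex.continuous_ofReal.comp hBc).aestronglyMeasurable) (Eventually.of_forall ?_)
    intro z
    rw [norm_mul, hen, one_mul, Complex.norm_real, Real.norm_eq_abs]
    simp only [hB, statAmp]
    have hE := Real.exp_pos (-z)
    have h0 := statBump.nonneg (x := z)
    have h1 := statBump.le_one (x := z)
    rw [abs_le]; constructor <;> nlinarith
  have i2 : IntegrableOn (fun z => e z * (H' z : ℂ)) (Ioi 0) := by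
    refine Integrable.mono' hH'i.norm
      (hem.mul (Complex.continuous_ofReal.comp hH'c).aestronglyMeasurable) (Eventually.of_forall ?_)
    intro z
    rw [norm_mul, hen, one_mul, Complex.norm_real]
  have hHle : ∀ z, 0 ≤ z → |H z| ≤ 4 * (z ^ 1 * Real.exp (-z)) := by
    intro z hz
    simp only [hH]
    rw [abs_mul, abs_of_nonneg (by positivity : 0 ≤ z * Real.exp (-z)), pow_one, mul_comm]
    exact mul_le_mul_of_nonneg_right (hhb z) (by positivity)
  have hWn : ∀ z, ‖e z * (H z : ℂ)‖ = |H z| := by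
    intro z; rw [norm_mul, hen, one_mul, Complex.norm_real, Real.norm_eq_abs]
  have hint := integral_Ioi_of_hasDerivAt_of_tendsto (a := (0 : ℝ)) (m := (0 : ℂ))
    (f := fun z => e z * (H z : ℂ))
    (f' := fun z => t * Complex.I * (e z * (B z : ℂ)) + e z * (H' z : ℂ)) ?_ ?_ ?_ ?_
  · rw [integral_add (i1.const_mul _) i2, integral_const_mul] at hint
    have hH0 : H 0 = 0 := by simp [hH]
    rw [hH0, Complex.ofReal_zero, mul_zero, sub_zero] at hint
    have h1 : (t * Complex.I : ℂ) * ∫ z in Ioi 0, e z * (B z : ℂ) =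
        -∫ z in Ioi 0, e z * (H' z : ℂ) := eq_neg_of_add_eq_zero_left hint
    have h2 := congrArg norm h1
    rw [norm_mul, norm_neg] at h2
    have h3 : ‖∫ z in Ioi 0, e z * (H' z : ℂ)‖ ≤ ∫ z in Ioi 0, |H' z| := by
      refine (norm_integral_le_integral_norm _).trans (le_of_eq ?_)
      refine integral_congr_ae (Eventually.of_forall fun z => ?_)
      simp only
      rw [norm_mul, hen, one_mul, Complex.norm_real, Real.norm_eq_abs]
    rw [le_div_iff₀ (abs_pos.2 ht), mul_comm]
    have h4 : ‖(t * Complex.I : ℂ)‖ = |t| := by simp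
    rw [h4] at h2
    exact h2.le.trans h3
  · have hc0 : Tendsto (fun z => |H z|) (𝓝[Ici 0] 0) (𝓝 0) := by
      have hHc : Continuous H := continuous_iff_continuousAt.2 fun z => (hHd z).continuousAt
      have : Tendsto (fun z => |H z|) (𝓝 0) (𝓝 |H 0|) := (hHc.abs).tendsto 0
      have hH0 : H 0 = 0 := by simp [hH]
      rw [hH0, abs_zero] at this
      exact this.mono_left nhdsWithin_le_nhds
    have hH0 : H 0 = 0 := by simp [hH]
    rw [ContinuousWithinAt]
    simp only [hH0, Complex.ofReal_zero, mul_zero]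
    rw [tendsto_zero_iff_norm_tendsto_zero]
    simpa only [hWn] using hc0
  · intro z hz
    have hz0 : 0 < z := hz
    have h1 : HasDerivAt (fun z : ℝ => z - Real.log z) (1 - z⁻¹) z :=
      (hasDerivAt_id z).sub (Real.hasDerivAt_log hz0.ne')
    have h2 := ((h1.ofReal_comp.const_mul (t : ℂ)).mul_const Complex.I).cexp
    refine (h2.mul (hHd z).ofReal_comp).congr_deriv ?_
    have h3 : (1 - z⁻¹) * H z = B z := by
      simp only [hH, hB, statAmp, hh]
      by_cases hz1 : z = 1
      · rw [hz1, hb1 1 (by norm_num)]; simp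
      · have : z - 1 ≠ 0 := sub_ne_zero.2 hz1
        field_simp
    rw [← h3]
    simp only [he]
    push_cast
    ring
  · exact (i1.const_mul _).add i2
  · rw [tendsto_zero_iff_norm_tendsto_zero]
    have h1 := (Real.tendsto_pow_mul_exp_neg_atTop_nhds_zero 1).const_mul 4
    rw [mul_zero] at h1
    refine squeeze_zero' (Eventually.of_forall fun z => norm_nonneg _) ?_ h1
    filter_upwards [eventually_ge_atTop 0] with z hz
    rw [hWn]
    exact hHle z hz

/-- The oscillating wave packet `e^{it(z - log z)} χ(z)`. -/
def statWave (t z : ℝ) : ℂ := Complex.exp (t * (z - Real.log z : ℝ) * Complex.I) * statAmp z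

/-- Lower bound for the oscillatory integral with the stationary point `1`. -/
theorem norm_integral_statWave_ge : ∃ c : ℝ, 0 < c ∧ ∃ t₀ : ℝ, 1 ≤ t₀ ∧ ∀ t : ℝ, t₀ ≤ |t| →
    c / √|t| ≤ ‖∫ z in (0 : ℝ)..2, statWave t z‖ := by
  obtain ⟨c, hc, h1⟩ := norm_integral_phase_exp_ge
  obtain ⟨M, hM⟩ := exists_nonstationary_bound
  -- Beyond this threshold the nonstationary error `M/|t|` is at most half of the main term
  -- `c/√|t|`.
  refine ⟨c / 2, by positivity, max 1 ((2 * M / c) ^ 2), le_max_left _ _, fun t ht => ?_⟩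
  have ht1 : 1 ≤ |t| := (le_max_left _ _).trans ht
  have hT : 0 < |t| := by linarith
  have ht0 : t ≠ 0 := abs_pos.1 hT
  set e : ℝ → ℂ := fun z => Complex.exp (t * (z - Real.log z : ℝ) * Complex.I) with he
  have hen : ∀ z, ‖e z‖ = 1 := by
    intro z
    simp only [he]
    rw [← Complex.ofReal_mul, Complex.norm_exp_ofReal_mul_I]
  have hec : ContinuousOn e (Ioi 0) := by
    have : ContinuousOn Real.log (Ioi 0) :=
      Real.continuousOn_log.mono fun x hx => ne_of_gt hx
    simp only [he]; fun_prop
  have hem : AEStronglyMeasurable e (volume.restrict (Ioi 0)) :=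
    hec.aestronglyMeasurable measurableSet_Ioi
  have hi : ∀ g : ℝ → ℝ, Continuous g → (∀ z, |g z| ≤ Real.exp (-z)) →
      IntegrableOn (fun z => e z * (g z : ℂ)) (Ioi 0) := by
    intro g hg hgb
    refine Integrable.mono' (integrableOn_exp_neg_Ioi 0)
      (hem.mul (Complex.continuous_ofReal.comp hg).aestronglyMeasurable) (Eventually.of_forall ?_)
    intro z
    rw [norm_mul, hen, one_mul, Complex.norm_real]; exact hgb z
  have hAb : ∀ z, 0 ≤ statAmp z ∧ statAmp z ≤ Real.exp (-z) := by
    intro z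
    have hE := Real.exp_pos (-z)
    have h0 := statBump.nonneg (x := z)
    have h1 := statBump.le_one (x := z)
    rw [statAmp]; constructor <;> nlinarith
  have i1 := hi statAmp contDiff_statAmp.continuous fun z => by
    rw [abs_of_nonneg (hAb z).1]; exact (hAb z).2
  have i2 := hi (fun z => Real.exp (-z) - statAmp z)
    ((by fun_prop : Continuous fun z : ℝ => Real.exp (-z)).sub contDiff_statAmp.continuous)
    fun z => by
      rw [abs_of_nonneg (by linarith [(hAb z).2])]; linarith [(hAb z).1]
  have h2 : (∫ z in Ioi (0 : ℝ), e z * Real.exp (-z)) =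
      (∫ z in Ioi (0 : ℝ), e z * statAmp z) +
      ∫ z in Ioi (0 : ℝ), e z * (Real.exp (-z) - statAmp z : ℝ) := by
    rw [← integral_add i1 i2]
    refine integral_congr_ae (Eventually.of_forall fun z => ?_)
    simp only; push_cast; ring
  have h3 : (∫ z in (0 : ℝ)..2, statWave t z) = ∫ z in Ioi (0 : ℝ), e z * statAmp z := by
    rw [intervalIntegral.integral_of_le (by norm_num)]
    refine (setIntegral_eq_of_subset_of_forall_sdiff_eq_zero measurableSet_Ioi
      Ioc_subset_Ioi_self fun z hz => ?_).symm
    have : 2 < z := by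
      by_contra hle
      exact hz.2 ⟨hz.1, not_lt.1 hle⟩
    rw [statWave, statAmp_eq_zero (z := z) (Or.inr (by linarith)), Complex.ofReal_zero, mul_zero]
  rw [h3]
  have h4 := h1 t ht1
  have h5 := hM t ht0
  rw [h2] at h4
  have h6 := h4.trans (norm_add_le _ _)
  have h7 : M / |t| ≤ c / 2 / √|t| := by
    have hs : 0 < √|t| := Real.sqrt_pos.2 hT
    have h8 : 2 * M / c ≤ √|t| := Real.le_sqrt_of_sq_le ((le_max_right _ _).trans ht)
    have h9 : |t| = √|t| * √|t| := (Real.mul_self_sqrt hT.le).symm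
    rw [div_div, div_le_div_iff₀ hT (by positivity)]
    rw [div_le_iff₀ hc] at h8
    nlinarith [mul_le_mul_of_nonneg_right h8 hs.le]
  have h10 : c / √|t| = c / 2 / √|t| + c / 2 / √|t| := by ring
  linarith

end StationaryPhase

/-! ### Fourier transform and the spectral measure of a root direction -/

section Fourier
open scoped SchwartzMap FourierTransform LineDeriv
variable {d : ℕ}

namespace TestFn

/-- A test function as a Schwartz function on Euclidean space. -/
def toSchwartz : TestFn d →ₗ[ℂ] 𝓢(EuclideanSpace ℝ (Fin d), ℂ) where
  toFun f := HasCompactSupport.toSchwartzMap (f := fun x => f.1 (WithLp.ofLp x))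
    (f.2.2.comp_homeomorph (PiLp.homeomorph 2 fun _ : Fin d => ℝ))
    (f.2.1.comp (PiLp.contDiff_ofLp))
  map_add' f g := by ext x; rfl
  map_smul' c f := by ext x; rfl

/-- The Fourier transform of a test function. -/
def ft (f : TestFn d) : 𝓢(EuclideanSpace ℝ (Fin d), ℂ) := 𝓕 (toSchwartz f)

theorem ft_sub (f g : TestFn d) : ft (f - g) = ft f - ft g := by
  rw [ft, map_sub, sub_eq_add_neg, ← neg_one_smul ℂ, FourierTransform.fourier_add,
    FourierTransform.fourier_smul, neg_one_smul, ← sub_eq_add_neg]; rfl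

theorem integral_euclidean (F : (Fin d → ℝ) → ℂ) :
    ∫ x : EuclideanSpace ℝ (Fin d), F (WithLp.ofLp x) = ∫ x, F x :=
  (PiLp.volume_preserving_ofLp (Fin d)).integral_comp
    (MeasurableEquiv.toLp 2 _).symm.measurableEmbedding F

theorem integral_conj_ft_mul_ft (f g : TestFn d) :
    ∫ p, (starRingEnd ℂ) (ft f p) * ft g p = ∫ x, (starRingEnd ℂ) (f.1 x) * g.1 x := by
  have h := SchwartzMap.integral_inner_fourier_fourier (toSchwartz f) (toSchwartz g)
  simp only [RCLike.inner_apply'] at h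
  exact h.trans (integral_euclidean fun x => (starRingEnd ℂ) (f.1 x) * g.1 x)

theorem integral_norm_sq_ft (f : TestFn d) :
    ∫ p, ‖ft f p‖ ^ 2 = ∫ x, ‖f.1 x‖ ^ 2 := by
  refine (SchwartzMap.integral_norm_sq_fourier (toSchwartz f)).trans ?_
  exact (PiLp.volume_preserving_ofLp (Fin d)).integral_comp
    (MeasurableEquiv.toLp 2 _).symm.measurableEmbedding fun x => ‖f.1 x‖ ^ 2

theorem norm_vec_sq (f : TestFn d) : ‖vec f‖ ^ 2 = ∫ x, ‖f.1 x‖ ^ 2 := by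
  have h := L2.inner_def (𝕜 := ℂ) (vec f) (vec f)
  rw [inner_self_eq_norm_sq_to_K] at h
  have h2 : ∫ x, inner ℂ ((vec f : Model d) x) ((vec f : Model d) x) =
      ((∫ x, ‖f.1 x‖ ^ 2 : ℝ) : ℂ) := by
    rw [← integral_complex_ofReal]
    refine integral_congr_ae ?_
    filter_upwards [coeFn_toL2 (memLp f)] with x hx
    have : (vec f : Model d) x = f.1 x := hx
    rw [this, inner_self_eq_norm_sq_to_K]; norm_cast
  rw [h2] at h
  have h3 : ((‖vec f‖ ^ 2 : ℝ) : ℂ) = ((∫ x, ‖f.1 x‖ ^ 2 : ℝ) : ℂ) := by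
    rw [← h]; push_cast; rfl
  exact Complex.ofReal_injective h3

theorem integrable_norm_sq_ft (f : TestFn d) : Integrable fun p => ‖ft f p‖ ^ 2 :=
  ((ft f).memLp 2).integrable_norm_pow (by norm_num)

theorem ft_pd (k : Fin d) (f : TestFn d) (p : EuclideanSpace ℝ (Fin d)) :
    ft (pd k f) p = (2 * Real.pi * Complex.I) * p k * ft f p := by
  have h1 : toSchwartz (pd k f) = ∂_{(EuclideanSpace.single k (1 : ℝ))} (toSchwartz f) := by
    ext x
    rw [SchwartzMap.lineDerivOp_apply_eq_fderiv]
    have hd : DifferentiableAt ℝ f.1 (WithLp.ofLp x) := f.2.1.differentiable (by simp) _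
    have h2 := hd.hasFDerivAt.comp x (PiLp.hasFDerivAt_ofLp 2 x)
    have h3 : fderiv ℝ (toSchwartz f) x = _ := h2.fderiv
    rw [h3]
    rfl
  have hg : Function.HasTemperateGrowth
      fun x : EuclideanSpace ℝ (Fin d) => inner ℝ x (EuclideanSpace.single k (1 : ℝ)) :=
    ((innerSL ℝ).flip (EuclideanSpace.single k (1 : ℝ))).hasTemperateGrowth
  rw [ft, h1, SchwartzMap.fourier_lineDerivOp_eq, smul_apply,
    SchwartzMap.smulLeftCLM_apply_apply hg, EuclideanSpace.inner_single_right]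
  simp [ft, mul_assoc]

/-- The squared frequency weight in the `k`-th coordinate. -/
def freqWeight (k : Fin d) (p : EuclideanSpace ℝ (Fin d)) : ℝ := 1 + (2 * Real.pi * p k) ^ 2

theorem one_le_freqWeight (k : Fin d) (p : EuclideanSpace ℝ (Fin d)) : 1 ≤ freqWeight k p :=
  le_add_of_nonneg_right (sq_nonneg _)

theorem continuous_freqWeight (k : Fin d) : Continuous (freqWeight k) := by
  unfold freqWeight; fun_prop

theorem ft_bessel_pow (k : Fin d) (N : ℕ) (f : TestFn d) (p : EuclideanSpace ℝ (Fin d)) :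
    ft (((1 - pd k * pd k : Module.End ℂ (TestFn d)) ^ N) f) p =
      (freqWeight k p : ℂ) ^ N * ft f p := by
  induction N with
  | zero => simp
  | succ N ih =>
    rw [pow_succ', Module.End.mul_apply]
    set F := ((1 - pd k * pd k : Module.End ℂ (TestFn d)) ^ N) f
    change ft (F - pd k (pd k F)) p = _
    rw [ft_sub, sub_apply, ft_pd, ft_pd, ih, freqWeight]
    push_cast
    ring_nf
    rw [Complex.I_sq]; ring

/-- For a natural number `N ≥ s` the function is dominated by the squared Fourier transform of `(1 -
∂²)^N f`, which is again a test function. Negative `s` is included. -/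
theorem integrable_freqWeight_rpow (k : Fin d) (s : ℝ) (f : TestFn d) :
    Integrable fun p => freqWeight k p ^ s * ‖ft f p‖ ^ 2 := by
  obtain ⟨N, hN⟩ := exists_nat_ge s
  have h1 := integrable_norm_sq_ft (((1 - pd k * pd k : Module.End ℂ (TestFn d)) ^ N) f)
  refine Integrable.mono' h1 ?_ (Filter.Eventually.of_forall fun p => ?_)
  · refine Continuous.aestronglyMeasurable ?_
    refine Continuous.mul ?_ ((ft f).continuous.norm.pow 2)
    exact (continuous_freqWeight k).rpow_const fun p =>
      Or.inl (by have := one_le_freqWeight k p; linarith)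
  · have hw := one_le_freqWeight k p
    have hw0 : 0 < freqWeight k p := by linarith
    rw [ft_bessel_pow, norm_mul (_ ^ N), norm_pow, Complex.norm_real, Real.norm_of_nonneg hw0.le,
      mul_pow, Real.norm_of_nonneg (by positivity)]
    refine mul_le_mul_of_nonneg_right ?_ (sq_nonneg _)
    rw [← pow_mul, ← Real.rpow_natCast]
    refine Real.rpow_le_rpow_of_exponent_le hw ?_
    push_cast
    have : (0 : ℝ) ≤ N := Nat.cast_nonneg N
    linarith

/-- Translation of test functions. -/
def shift (a : Fin d → ℝ) (f : TestFn d) : TestFn d :=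
  ⟨fun x => f.1 (x - a), f.2.1.comp (contDiff_id.sub contDiff_const),
    f.2.2.comp_homeomorph (Homeomorph.subRight a)⟩

theorem ft_shift (k : Fin d) (τ : ℝ) (f : TestFn d) (p : EuclideanSpace ℝ (Fin d)) :
    ft (shift (Pi.single k τ) f) p =
      Complex.exp (-(2 * Real.pi * τ * p k) * Complex.I) * ft f p := by
  have h := VectorFourier.fourierIntegral_comp_add_right Real.fourierChar
    (volume : Measure (EuclideanSpace ℝ (Fin d))) (innerₗ (EuclideanSpace ℝ (Fin d)))
    (toSchwartz f) (-(EuclideanSpace.single k τ))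
  have h2 := congrFun h p
  have e1 : (fun x : EuclideanSpace ℝ (Fin d) => toSchwartz f (x + -EuclideanSpace.single k τ)) =
      toSchwartz (shift (Pi.single k τ) f) := by
    funext x
    rw [← sub_eq_add_neg]
    rfl
  have e2 : ((toSchwartz f : EuclideanSpace ℝ (Fin d) → ℂ) ∘
      fun v => v + -EuclideanSpace.single k τ) = toSchwartz (shift (Pi.single k τ) f) := e1
  rw [e2] at h2
  refine h2.trans ?_
  rw [Circle.smul_def, Real.fourierChar_apply, smul_eq_mul]
  congr 2
  simp only [map_neg, LinearMap.neg_apply, innerₗ_apply_apply, EuclideanSpace.inner_single_left]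
  push_cast
  simp
  ring

end TestFn

open TestFn in
/-- Vectors `π(g) h` such that `g` conjugates the one-parameter group with index `p` into the
translations in the direction `k`. -/
theorem rep_conj_vec (odd : Bool) (t : ℝ) (g : Matrix.SpecialLinearGroup (Fin (d + 1)) ℝ)
    (p : {p : Fin (d + 1) × Fin (d + 1) // p.1 ≠ p.2}) (k : Fin d) (κ : ℝ)
    (hg : conjVec g (.inr p) = Matrix.single k.succ 0 κ) (τ : ℝ) (h : TestFn d) :
    indRep d odd t (oneParam (.inr p) τ) (indRep d odd t g (vec h)) =
      indRep d odd t g (vec (shift (Pi.single k (κ * τ)) h)) := by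
  have e : oneParam (.inr p) τ * g = g * (g⁻¹ * oneParam (.inr p) τ * g) := by group
  change (indRep d odd t (oneParam (.inr p) τ) * indRep d odd t g) _ = _
  rw [← map_mul, e, map_mul]
  change indRep d odd t g (indRep d odd t _ _) = _
  congr 1
  rw [indRep_vec]
  have e2 : (g⁻¹ * oneParam (.inr p) τ * g)⁻¹ = g⁻¹ * oneParam (.inr p) (-τ) * g := by
    rw [← oneParam_inv]; group
  -- The exponential of a root vector is affine in `τ`, so conjugating it amounts to conjugating the
  -- root vector.
  have e3 : ((g⁻¹ * oneParam (.inr p) τ * g)⁻¹).1 = 1 - Matrix.single k.succ 0 (κ * τ) := by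
    rw [e2]
    change (g⁻¹).1 * NormedSpace.exp (-τ • basisVec (.inr p)) * g.1 = _
    rw [exp_root, Matrix.transvection]
    have : Matrix.single p.1.1 p.1.2 (-τ) = (-τ) • basisVec (.inr p) := by
      rw [basisVec, Matrix.smul_single, smul_eq_mul, mul_one]
    rw [this, mul_add, add_mul, mul_one, Matrix.mul_smul, Matrix.smul_mul]
    have h1 : (g⁻¹).1 * g.1 = 1 := by
      exact congrArg Subtype.val (inv_mul_cancel g)
    have h2 : (g⁻¹).1 * basisVec (.inr p) * g.1 = Matrix.single k.succ 0 κ := hg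
    rw [h1, h2, neg_smul, Matrix.smul_single, smul_eq_mul, sub_eq_add_neg, mul_comm]
  rw [e3]
  change _ = toL2 _
  congr 1
  funext x
  have hd : den (1 - Matrix.single k.succ 0 (κ * τ) : Matrix (Fin (d + 1)) (Fin (d + 1)) ℝ) x = 1 := by
    rw [den, Matrix.sub_mulVec]
    simp [affVec, Matrix.single_mulVec, (Fin.succ_ne_zero k).symm]
  have hp : proj (1 - Matrix.single k.succ 0 (κ * τ) : Matrix (Fin (d + 1)) (Fin (d + 1)) ℝ) x =
      x - Pi.single k (κ * τ) := by
    funext l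
    rw [proj, hd, div_one, Matrix.sub_mulVec]
    simp [affVec, Matrix.single_mulVec, Function.update_apply, Pi.single_apply]
  rw [indFun, hd, hp]
  simp [multiplier, lineChar, shift]

open TestFn in
-- In these coordinates the one-parameter group is translation, so Plancherel exhibits the spectral
-- measure: the image of `‖ft h q‖² dq` under `q ↦ -2πκ q_k`. Uniqueness identifies it with the
-- chosen one, and `κ² = 1` removes the sign.
theorem besselNorm_rep_vec (odd : Bool) (t : ℝ) (g : Matrix.SpecialLinearGroup (Fin (d + 1)) ℝ)
    (p : {p : Fin (d + 1) × Fin (d + 1) // p.1 ≠ p.2}) (k : Fin d) (κ : ℝ) (hκ : κ ^ 2 = 1)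
    (hg : conjVec g (.inr p) = Matrix.single k.succ 0 κ) (s : ℝ) (h : TestFn d) :
    besselNorm (fun τ => indRep d odd t (oneParam (.inr p) τ)) s (indRep d odd t g (vec h)) =
      √(∫ q, freqWeight k q ^ s * ‖ft h q‖ ^ 2) := by
  set ρ : EuclideanSpace ℝ (Fin d) → ENNReal := fun q => ENNReal.ofReal (‖ft h q‖ ^ 2) with hρ
  set m : EuclideanSpace ℝ (Fin d) → ℝ := fun q => -(2 * Real.pi * κ * q k) with hm
  have hmc : Continuous m := by simp only [hm]; fun_prop
  have hρm : Measurable fun q => ‖ft h q‖ ^ 2 := ((ft h).continuous.norm.pow 2).measurable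
  set μ : Measure ℝ := (volume.withDensity ρ).map m with hμ
  have hwd : ∀ F : EuclideanSpace ℝ (Fin d) → ℂ, ∫ q, F q ∂(volume.withDensity ρ) =
      ∫ q, ((‖ft h q‖ ^ 2 : ℝ) : ℂ) * F q := by
    intro F
    rw [hρ, integral_withDensity_eq_integral_toReal_smul hρm.ennreal_ofReal
      (Filter.Eventually.of_forall fun q => ENNReal.ofReal_lt_top)]
    refine integral_congr_ae (Filter.Eventually.of_forall fun q => ?_)
    simp only
    rw [ENNReal.toReal_ofReal (by positivity), Complex.real_smul]
  have hwdr : ∀ F : EuclideanSpace ℝ (Fin d) → ℝ, ∫ q, F q ∂(volume.withDensity ρ) =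
      ∫ q, ‖ft h q‖ ^ 2 * F q := by
    intro F
    rw [hρ, integral_withDensity_eq_integral_toReal_smul hρm.ennreal_ofReal
      (Filter.Eventually.of_forall fun q => ENNReal.ofReal_lt_top)]
    refine integral_congr_ae (Filter.Eventually.of_forall fun q => ?_)
    simp only
    rw [ENNReal.toReal_ofReal (by positivity), smul_eq_mul]
  have hspec : IsSpectralMeasure (fun τ => indRep d odd t (oneParam (.inr p) τ))
      (indRep d odd t g (vec h)) μ := by
    constructor
    · have : IsFiniteMeasure (volume.withDensity ρ) :=
        isFiniteMeasure_withDensity_ofReal (integrable_norm_sq_ft h).2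
      exact Measure.isFiniteMeasure_map _ _
    · intro τ
      rw [rep_conj_vec odd t g p k κ hg, LinearIsometry.inner_map_map, L2.inner_def]
      have h1 : ∫ x, inner ℂ ((vec h : Model d) x)
          ((vec (shift (Pi.single k (κ * τ)) h) : Model d) x) =
          ∫ x, (starRingEnd ℂ) (h.1 x) * (shift (Pi.single k (κ * τ)) h).1 x := by
        refine integral_congr_ae ?_
        filter_upwards [coeFn_toL2 (memLp h),
          coeFn_toL2 (memLp (shift (Pi.single k (κ * τ)) h))] with x h1 h2
        have h1' : (vec h : Model d) x = h.1 x := h1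
        have h2' : (vec (shift (Pi.single k (κ * τ)) h) : Model d) x = _ := h2
        rw [h1', h2', RCLike.inner_apply']
      rw [h1, ← integral_conj_ft_mul_ft, charFun_apply_real, hμ,
        integral_map hmc.aemeasurable (by fun_prop), hwd]
      refine integral_congr_ae (Filter.Eventually.of_forall fun q => ?_)
      simp only
      rw [ft_shift, mul_left_comm, Complex.conj_mul', mul_comm]
      push_cast
      congr 2
      simp only [hm]
      push_cast; ring
  have hex : ∃ μ : Measure ℝ, IsSpectralMeasure (fun τ => indRep d odd t (oneParam (.inr p) τ))
      (indRep d odd t g (vec h)) μ := ⟨μ, hspec⟩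
  rw [besselNorm, dif_pos hex, hex.choose_spec.unique hspec, hμ,
    integral_map hmc.aemeasurable ?_, hwdr]
  · congr 1
    refine integral_congr_ae (Filter.Eventually.of_forall fun q => ?_)
    simp only
    rw [mul_comm]
    congr 2
    simp only [hm, freqWeight]
    linear_combination (2 * Real.pi * q k) ^ 2 * hκ
  · exact Measurable.aestronglyMeasurable (by fun_prop)

end Fourier

/-! ### Oscillating waves: smallness in negative order, largeness in positive order -/

section NegativeNorm
variable {d m : ℕ}

namespace TestFn

/-- Dilation of test functions. -/
def dil (L : ℝ) (hL : L ≠ 0) (f : TestFn d) : TestFn d :=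
  ⟨fun x => f.1 (L • x), f.2.1.comp (contDiff_const_smul L),
    f.2.2.comp_homeomorph (Homeomorph.smulOfNeZero L hL)⟩

theorem pd_dil (L : ℝ) (hL : L ≠ 0) (k : Fin d) (f : TestFn d) :
    pd k (dil L hL f) = (L : ℂ) • dil L hL (pd k f) := by
  ext x
  change fderiv ℝ (fun x => f.1 (L • x)) x _ = L * fderiv ℝ f.1 (L • x) _
  have h1 : HasFDerivAt (fun x : Fin d → ℝ => L • x) (L • ContinuousLinearMap.id ℝ (Fin d → ℝ)) x :=
    (hasFDerivAt_id x).const_smul L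
  have h2 := (f.2.1.differentiable (by simp) (L • x)).hasFDerivAt.comp x h1
  rw [show fderiv ℝ (fun x => f.1 (L • x)) x = _ from h2.fderiv]
  simp

theorem integral_norm_sq_dil (L : ℝ) (hL : L ≠ 0) (f : TestFn d) :
    ∫ x, ‖(dil L hL f).1 x‖ ^ 2 = (|L| ^ d)⁻¹ * ∫ x, ‖f.1 x‖ ^ 2 := by
  have := Measure.integral_comp_smul (volume : Measure (Fin d → ℝ)) (fun x => ‖f.1 x‖ ^ 2) L
  rw [Module.finrank_fin_fun, abs_inv, abs_pow, smul_eq_mul] at this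
  exact this

theorem integral_comp_dil (L : ℝ) (F : (Fin d → ℝ) → ℂ) :
    ∫ x, F (L • x) = ((|L| ^ d)⁻¹ : ℝ) * ∫ x, F x := by
  have := Measure.integral_comp_smul (volume : Measure (Fin d → ℝ)) F L
  rw [Module.finrank_fin_fun, abs_inv, abs_pow, Complex.real_smul] at this
  exact this

theorem tsupport_mulOn_subset (φ : (Fin d → ℝ) → ℂ) (f : TestFn d)
    (h : ∀ x ∈ tsupport f.1, ContDiffAt ℝ ∞ φ x) : tsupport (mulOn φ f h).1 ⊆ tsupport f.1 :=
  tsupport_mul_subset_right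

theorem tsupport_pd_subset (k : Fin d) (f : TestFn d) : tsupport (pd k f).1 ⊆ tsupport f.1 :=
  tsupport_fderiv_apply_subset ℝ _

/-- The oscillating factor with phase `log ζ - ζ`, `ζ = -1 / y`. -/
def oscFactor (t y : ℝ) : ℂ := Complex.exp ((t * (-Real.log (-y) + y⁻¹) : ℝ) * Complex.I)

theorem norm_oscFactor (t y : ℝ) : ‖oscFactor t y‖ = 1 := Complex.norm_exp_ofReal_mul_I _

/-- The derivative of the phase of `oscFactor`. -/
def oscRate (y : ℝ) : ℝ := -y⁻¹ - (y ^ 2)⁻¹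

/-- The phase is stationary only at `y = -1`. -/
theorem oscRate_ne_zero {y : ℝ} (hy : y < -1) : oscRate y ≠ 0 := by
  have hy0 : y ≠ 0 := by linarith
  have : oscRate y = -(y + 1) / y ^ 2 := by rw [oscRate]; field_simp; ring
  rw [this]
  exact div_ne_zero (by linarith) (pow_ne_zero 2 hy0)

theorem hasDerivAt_oscFactor (t : ℝ) {y : ℝ} (hy : y < -1) :
    HasDerivAt (oscFactor t) (t * oscRate y * Complex.I * oscFactor t y) y := by
  have hy0 : y ≠ 0 := by linarith
  have h1 : HasDerivAt (fun y => -Real.log (-y) + y⁻¹) (oscRate y) y := by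
    have := ((hasDerivAt_neg y).log (by simpa using hy0)).neg.add (hasDerivAt_inv hy0)
    refine this.congr_deriv ?_
    rw [oscRate]; field_simp; ring
  have h2 := ((h1.const_mul t).ofReal_comp.mul_const Complex.I).cexp
  refine h2.congr_deriv ?_
  rw [oscFactor]; push_cast; ring

theorem contDiffAt_coord {F : ℝ → ℂ} {x : Fin (m + 1) → ℝ} (h : ContDiffAt ℝ ∞ F (x 0)) :
    ContDiffAt ℝ ∞ (fun x : Fin (m + 1) → ℝ => F (x 0)) x :=
  ContDiffAt.comp x h (contDiff_apply ℝ ℝ (0 : Fin (m + 1))).contDiffAt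

theorem contDiffAt_oscFactor (t : ℝ) {y : ℝ} (hy : y < -1) : ContDiffAt ℝ ∞ (oscFactor t) y := by
  have hy0 : y ≠ 0 := by linarith
  have h1 : ContDiffAt ℝ ∞ (fun y : ℝ => t * (-Real.log (-y) + y⁻¹)) y :=
    contDiffAt_const.mul
      (((contDiffAt_id.neg.log (by simpa using hy0)).neg).add (contDiffAt_inv ℝ hy0))
  exact ((Complex.ofRealCLM.contDiff.contDiffAt.comp y h1).mul contDiffAt_const).cexp

theorem contDiffAt_oscRate {y : ℝ} (hy : y < -1) :
    ContDiffAt ℝ ∞ (fun y => ((oscRate y : ℝ) : ℂ)) y := by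
  have hy0 : y ≠ 0 := by linarith
  have h1 : ContDiffAt ℝ ∞ oscRate y :=
    (contDiffAt_inv ℝ hy0).neg.sub ((contDiffAt_id.pow 2).inv (pow_ne_zero 2 hy0))
  exact Complex.ofRealCLM.contDiff.contDiffAt.comp y h1

/-- The test functions supported where the phase of `oscFactor` is not stationary. -/
def LeftSupp (b : TestFn (m + 1)) : Prop := ∀ x ∈ tsupport b.1, x 0 < -1

/-- A test function times the oscillating factor. -/
def wave (t : ℝ) (b : TestFn (m + 1)) (hb : LeftSupp b) : TestFn (m + 1) :=
  mulOn (fun x => oscFactor t (x 0)) b fun x hx => contDiffAt_coord (contDiffAt_oscFactor t (hb x hx))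

/-- Multiplication by the inverse of the rate of oscillation. -/
def divRate (b : TestFn (m + 1)) (hb : LeftSupp b) : TestFn (m + 1) :=
  mulOn (fun x => ((oscRate (x 0) : ℝ) : ℂ)⁻¹) b fun x hx => contDiffAt_coord
    (F := fun y => ((oscRate y : ℝ) : ℂ)⁻¹) ((contDiffAt_oscRate (hb x hx)).inv
      (by exact_mod_cast oscRate_ne_zero (hb x hx)))

theorem leftSupp_divRate {b : TestFn (m + 1)} (hb : LeftSupp b) : LeftSupp (divRate b hb) :=
  fun x hx => hb x (tsupport_mulOn_subset _ _ _ hx)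

theorem leftSupp_pd {b : TestFn (m + 1)} (hb : LeftSupp b) : LeftSupp (pd 0 b) :=
  fun x hx => hb x (tsupport_pd_subset _ _ hx)

/-- The identity behind integration by parts: it expresses `it` times a wave by the derivative of a
wave and a wave, both with amplitudes independent of `t`. -/
theorem pd_wave_divRate (t : ℝ) (b : TestFn (m + 1)) (hb : LeftSupp b) :
    pd 0 (wave t (divRate b hb) (leftSupp_divRate hb)) =
      wave t (pd 0 (divRate b hb)) (leftSupp_pd (leftSupp_divRate hb)) +
        (t * Complex.I : ℂ) • wave t b hb := by
  ext x
  set b₁ := divRate b hb with hb₁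
  by_cases hx : x ∈ tsupport b₁.1
  · have hx0 := leftSupp_divRate hb x hx
    have hpr : HasFDerivAt (fun x : Fin (m + 1) → ℝ => x 0)
        (ContinuousLinearMap.proj (R := ℝ) (φ := fun _ : Fin (m + 1) => ℝ) 0) x :=
      (ContinuousLinearMap.proj (R := ℝ) (φ := fun _ : Fin (m + 1) => ℝ) 0).hasFDerivAt
    have h1 := (hasDerivAt_oscFactor t hx0).hasFDerivAt.comp x hpr
    have h2 := h1.mul (b₁.2.1.differentiable (by simp) x).hasFDerivAt
    change fderiv ℝ ((oscFactor t ∘ fun x : Fin (m + 1) → ℝ => x 0) * b₁.1) x (Pi.single 0 1) =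
      oscFactor t (x 0) * fderiv ℝ b₁.1 x (Pi.single 0 1) +
        (t * Complex.I) * (oscFactor t (x 0) * b.1 x)
    rw [h2.fderiv]
    have hbx : b.1 x = oscRate (x 0) * b₁.1 x := by
      have hr : ((oscRate (x 0) : ℝ) : ℂ) ≠ 0 := by exact_mod_cast oscRate_ne_zero hx0
      have : b₁.1 x = ((oscRate (x 0) : ℝ) : ℂ)⁻¹ * b.1 x := rfl
      rw [this, mul_inv_cancel_left₀ hr]
    rw [hbx]
    simp
    ring
  · have e1 : (pd 0 (wave t b₁ (leftSupp_divRate hb))).1 x = 0 :=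
      image_eq_zero_of_notMem_tsupport fun h =>
        hx (tsupport_mulOn_subset _ _ _ (tsupport_pd_subset _ _ h))
    have e2 : (pd 0 b₁).1 x = 0 :=
      image_eq_zero_of_notMem_tsupport fun h => hx (tsupport_pd_subset _ _ h)
    have e3 : b.1 x = 0 := by
      have : b₁.1 x = ((oscRate (x 0) : ℝ) : ℂ)⁻¹ * b.1 x := rfl
      have h0 : b₁.1 x = 0 := image_eq_zero_of_notMem_tsupport hx
      rw [h0] at this
      by_contra hne
      have hx0 := hb x (subset_tsupport _ hne)
      have hr : ((oscRate (x 0) : ℝ) : ℂ) ≠ 0 := by exact_mod_cast oscRate_ne_zero hx0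
      exact mul_ne_zero (inv_ne_zero hr) hne this.symm
    rw [e1]
    change 0 = oscFactor t (x 0) * (pd 0 b₁).1 x + (t * Complex.I) * (oscFactor t (x 0) * b.1 x)
    rw [e2, e3]; simp

/-- The frequency weight at scale `L`. -/
def scaledWeight (L : ℝ) (p : EuclideanSpace ℝ (Fin (m + 1))) : ℝ := 1 + (2 * Real.pi * p 0 / L) ^ 2

theorem one_le_scaledWeight (L : ℝ) (p : EuclideanSpace ℝ (Fin (m + 1))) : 1 ≤ scaledWeight L p :=
  le_add_of_nonneg_right (sq_nonneg _)

theorem continuous_scaledWeight (L : ℝ) : Continuous (scaledWeight (m := m) L) := by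
  unfold scaledWeight; fun_prop

theorem integrable_scaledWeight (L : ℝ) (N : ℕ) (f : TestFn (m + 1)) :
    Integrable fun p => (scaledWeight L p ^ N)⁻¹ * ‖ft f p‖ ^ 2 := by
  refine Integrable.mono' (integrable_norm_sq_ft f) ?_ (Filter.Eventually.of_forall fun p => ?_)
  · refine Continuous.aestronglyMeasurable (Continuous.mul ?_ ((ft f).continuous.norm.pow 2))
    exact ((continuous_scaledWeight L).pow N).inv₀ fun p =>
      (pow_pos (lt_of_lt_of_le one_pos (one_le_scaledWeight L p)) N).ne'
  · have h1 := one_le_pow₀ (n := N) (one_le_scaledWeight L p)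
    rw [Real.norm_of_nonneg (by positivity)]
    exact mul_le_of_le_one_left (sq_nonneg _) (inv_le_one_of_one_le₀ h1)

theorem ft_add (f g : TestFn d) : ft (f + g) = ft f + ft g := by
  rw [ft, map_add, FourierTransform.fourier_add]; rfl

theorem ft_smul (c : ℂ) (f : TestFn d) : ft (c • f) = c • ft f := by
  rw [ft, map_smul, FourierTransform.fourier_smul]; rfl

theorem dil_add (L : ℝ) (hL : L ≠ 0) (f g : TestFn d) :
    dil L hL (f + g) = dil L hL f + dil L hL g := rfl

theorem dil_smul (L : ℝ) (hL : L ≠ 0) (c : ℂ) (f : TestFn d) :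
    dil L hL (c • f) = c • dil L hL f := rfl

/-- Each use of `pd_wave_divRate` gains `|t|⁻²` in the square and produces one derivative; after
dilation by `L` that derivative is multiplication by `2πi p₀/L`, which one factor of the weight
absorbs. -/
theorem integral_scaledWeight_wave_le (N : ℕ) : ∀ (b : TestFn (m + 1)) (hb : LeftSupp b),
    ∃ C : ℝ, 0 ≤ C ∧ ∀ (t L : ℝ) (_ : t ≠ 0) (hL : L ≠ 0),
      ∫ p, (scaledWeight L p ^ N)⁻¹ * ‖ft (dil L hL (wave t b hb)) p‖ ^ 2 ≤
        C * (|L| ^ (m + 1))⁻¹ * (|t| ^ (2 * N))⁻¹ := by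
  induction N with
  | zero =>
    intro b hb
    refine ⟨∫ x, ‖b.1 x‖ ^ 2, integral_nonneg fun x => by positivity, fun t L ht hL => ?_⟩
    simp only [pow_zero, inv_one, one_mul, mul_zero, mul_one]
    rw [integral_norm_sq_ft, integral_norm_sq_dil, mul_comm]
    refine le_of_eq ?_
    congr 1
    refine integral_congr_ae (Filter.Eventually.of_forall fun x => ?_)
    change ‖oscFactor t (x 0) * b.1 x‖ ^ 2 = _
    rw [norm_mul, norm_oscFactor, one_mul]
  | succ N ih =>
    intro b hb
    set b₁ := divRate b hb with hb₁
    have hl₁ := leftSupp_divRate hb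
    obtain ⟨C₁, hC₁, h₁⟩ := ih b₁ hl₁
    obtain ⟨C₂, hC₂, h₂⟩ := ih (pd 0 b₁) (leftSupp_pd hl₁)
    refine ⟨2 * (C₁ + C₂), by positivity, fun t L ht hL => ?_⟩
    set A := ft (dil L hL (wave t b₁ hl₁)) with hA
    set B := ft (dil L hL (wave t (pd 0 b₁) (leftSupp_pd hl₁))) with hB
    set Q := ft (dil L hL (wave t b hb)) with hQ
    have hT : 0 < |t| := abs_pos.2 ht
    have hkey : ∀ p, (t * Complex.I : ℂ) * Q p =
        (2 * Real.pi * p 0 / L : ℝ) * Complex.I * A p - B p := by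
      intro p
      have h := congrArg (fun f => ft (dil L hL f) p) (pd_wave_divRate t b hb)
      simp only [dil_add, dil_smul, ft_add, ft_smul, add_apply, smul_apply,
        smul_eq_mul] at h
      have h2 := congrArg (fun f => ft f p) (pd_dil L hL 0 (wave t b₁ hl₁))
      simp only [ft_smul, smul_apply, smul_eq_mul, ft_pd] at h2
      rw [h] at h2
      have hLc : (L : ℂ) ≠ 0 := by exact_mod_cast hL
      have h3 : (t * Complex.I : ℂ) * Q p = ((2 * Real.pi * Complex.I) * p 0 * A p) / L - B p := by
        rw [h2]; field_simp; simp [hB, hQ, hb₁]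
      rw [h3]; push_cast; field_simp
    have hpt : ∀ p, (scaledWeight L p ^ (N + 1))⁻¹ * ‖Q p‖ ^ 2 ≤
        2 * (|t| ^ 2)⁻¹ * ((scaledWeight L p ^ N)⁻¹ * ‖A p‖ ^ 2 +
          (scaledWeight L p ^ N)⁻¹ * ‖B p‖ ^ 2) := by
      intro p
      have hw := one_le_scaledWeight L p
      set w := scaledWeight L p with hwdef
      have hw0 : 0 < w := by linarith
      set y := 2 * Real.pi * p 0 / L with hy
      have hwy : w = 1 + y ^ 2 := rfl
      have h1 : |t| * ‖Q p‖ ≤ |y| * ‖A p‖ + ‖B p‖ := by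
        have h := congrArg norm (hkey p)
        rw [norm_mul, norm_mul, Complex.norm_I, mul_one, Complex.norm_real, Real.norm_eq_abs] at h
        rw [h]
        refine (norm_sub_le _ _).trans ?_
        rw [norm_mul, norm_mul, Complex.norm_I, mul_one, Complex.norm_real, Real.norm_eq_abs]
      have h2 : |t| ^ 2 * ‖Q p‖ ^ 2 ≤ 2 * w * (‖A p‖ ^ 2 + ‖B p‖ ^ 2) := by
        have h3 : (|t| * ‖Q p‖) ^ 2 ≤ (|y| * ‖A p‖ + ‖B p‖) ^ 2 :=
          pow_le_pow_left₀ (by positivity) h1 2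
        have h4 : (|y| * ‖A p‖ + ‖B p‖) ^ 2 ≤ 2 * ((|y| * ‖A p‖) ^ 2 + ‖B p‖ ^ 2) := add_sq_le
        rw [mul_pow] at h3
        rw [mul_pow |y|, sq_abs] at h4
        rw [hwy]
        nlinarith [sq_nonneg ‖A p‖, mul_nonneg (sq_nonneg y) (sq_nonneg ‖B p‖)]
      have h5 : ‖Q p‖ ^ 2 ≤ (|t| ^ 2)⁻¹ * (2 * w * (‖A p‖ ^ 2 + ‖B p‖ ^ 2)) := by
        rw [inv_mul_eq_div, le_div_iff₀ (by positivity), mul_comm]; exact h2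
      calc (w ^ (N + 1))⁻¹ * ‖Q p‖ ^ 2
          ≤ (w ^ (N + 1))⁻¹ * ((|t| ^ 2)⁻¹ * (2 * w * (‖A p‖ ^ 2 + ‖B p‖ ^ 2))) := by gcongr
        _ = _ := by field_simp; ring
    have iA := integrable_scaledWeight L N (dil L hL (wave t b₁ hl₁))
    have iB := integrable_scaledWeight L N (dil L hL (wave t (pd 0 b₁) (leftSupp_pd hl₁)))
    calc ∫ p, (scaledWeight L p ^ (N + 1))⁻¹ * ‖Q p‖ ^ 2
        ≤ ∫ p, 2 * (|t| ^ 2)⁻¹ * ((scaledWeight L p ^ N)⁻¹ * ‖A p‖ ^ 2 +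
          (scaledWeight L p ^ N)⁻¹ * ‖B p‖ ^ 2) :=
          integral_mono (integrable_scaledWeight L (N + 1) _) ((iA.add iB).const_mul _) hpt
      _ = 2 * (|t| ^ 2)⁻¹ * ((∫ p, (scaledWeight L p ^ N)⁻¹ * ‖A p‖ ^ 2) +
          ∫ p, (scaledWeight L p ^ N)⁻¹ * ‖B p‖ ^ 2) := by
          rw [integral_const_mul, integral_add iA iB]
      _ ≤ 2 * (|t| ^ 2)⁻¹ * (C₁ * (|L| ^ (m + 1))⁻¹ * (|t| ^ (2 * N))⁻¹ +
          C₂ * (|L| ^ (m + 1))⁻¹ * (|t| ^ (2 * N))⁻¹) := by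
          gcongr
          · exact h₁ t L ht hL
          · exact h₂ t L ht hL
      _ = _ := by
          rw [show 2 * (N + 1) = 2 * N + 2 by ring, pow_add, mul_inv]; ring

/-- Reduces a real order `-s` to the integer order `-N` and order 0. With `w` the scaled weight: for
`w ≤ 2` the term `|t|^{2N-4s} w^{-N}` is bounded below because `N ≥ 2s`. For `w > 2` the frequency
weight is at least a multiple of `t² w`, and `(t²/w)^s` is at most `1 + (t²/w)^N`. -/
theorem rpow_neg_freqWeight_le {s : ℝ} (hs : 0 ≤ s) {N : ℕ} (hN : 2 * s ≤ N) {Λ : ℝ}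
    (hΛ : 0 < Λ) : ∃ C : ℝ, 0 ≤ C ∧ ∀ (t L : ℝ), 1 ≤ |t| → |L| = |t| / Λ →
      ∀ p : EuclideanSpace ℝ (Fin (m + 1)), freqWeight 0 p ^ (-s) ≤
        C * |t| ^ (-(4 * s)) * (1 + |t| ^ (2 * N) * (scaledWeight L p ^ N)⁻¹) := by
  refine ⟨max (2 ^ N) ((2 * Λ ^ 2) ^ s), by positivity, fun t L ht hL p => ?_⟩
  set T := |t| with hT
  have hT0 : 0 < T := by linarith
  set C := max ((2 : ℝ) ^ N) ((2 * Λ ^ 2) ^ s) with hC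
  have hC0 : 0 < C := lt_of_lt_of_le (by positivity) (le_max_left _ _)
  set w := scaledWeight L p with hw
  have hw1 : 1 ≤ w := one_le_scaledWeight L p
  have hw0 : 0 < w := by linarith
  have hL2 : L ^ 2 = T ^ 2 / Λ ^ 2 := by rw [← sq_abs L, hL, div_pow]
  have hL0 : L ≠ 0 := by
    rintro rfl; rw [abs_zero] at hL
    have := div_pos hT0 hΛ; linarith
  have hfw : freqWeight 0 p = 1 + T ^ 2 / Λ ^ 2 * (w - 1) := by
    rw [← hL2, hw, scaledWeight, freqWeight]; field_simp; ring
  have hT4 : 0 < T ^ (-(4 * s)) := Real.rpow_pos_of_pos hT0 _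
  by_cases h2 : w ≤ 2
  · have h3 : freqWeight 0 p ^ (-s) ≤ 1 :=
      Real.rpow_le_one_of_one_le_of_nonpos (one_le_freqWeight 0 p) (by linarith)
    have h4 : 1 ≤ T ^ (-(4 * s)) * T ^ (2 * N) := by
      rw [← Real.rpow_natCast, ← Real.rpow_add hT0]
      refine Real.one_le_rpow ht ?_
      push_cast; linarith
    have h5 : 1 ≤ C * (w ^ N)⁻¹ := by
      rw [← div_eq_mul_inv, one_le_div (by positivity)]
      exact (pow_le_pow_left₀ hw0.le h2 N).trans (le_max_left _ _)
    calc freqWeight 0 p ^ (-s) ≤ 1 := h3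
      _ ≤ (T ^ (-(4 * s)) * T ^ (2 * N)) * (C * (w ^ N)⁻¹) := one_le_mul_of_one_le_of_one_le h4 h5
      _ = C * T ^ (-(4 * s)) * (T ^ (2 * N) * (w ^ N)⁻¹) := by ring
      _ ≤ C * T ^ (-(4 * s)) * (1 + T ^ (2 * N) * (w ^ N)⁻¹) := by
          gcongr; linarith
  · rw [not_le] at h2
    have h3 : T ^ 2 * w / (2 * Λ ^ 2) ≤ freqWeight 0 p := by
      rw [hfw, div_mul_eq_mul_div, div_le_iff₀ (by positivity)]
      have : (1 + T ^ 2 * (w - 1) / Λ ^ 2) * (2 * Λ ^ 2) = 2 * Λ ^ 2 + 2 * T ^ 2 * (w - 1) := by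
        field_simp
      rw [this]
      nlinarith [sq_nonneg Λ, sq_nonneg T]
    have h4 : freqWeight 0 p ^ (-s) ≤ (T ^ 2 * w / (2 * Λ ^ 2)) ^ (-s) :=
      Real.rpow_le_rpow_of_nonpos (by positivity) h3 (by linarith)
    have hu0 : 0 < T ^ 2 / w := by positivity
    have h5 : (T ^ 2 / w) ^ s ≤ 1 + T ^ (2 * N) * (w ^ N)⁻¹ := by
      have e : T ^ (2 * N) * (w ^ N)⁻¹ = (T ^ 2 / w) ^ N := by
        rw [div_pow, pow_mul, div_eq_mul_inv]
      rw [e]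
      by_cases hu : T ^ 2 / w ≤ 1
      · have := Real.rpow_le_one hu0.le hu hs
        have h0 : 0 ≤ (T ^ 2 / w) ^ N := by positivity
        linarith
      · rw [not_le] at hu
        have : (T ^ 2 / w) ^ s ≤ (T ^ 2 / w) ^ (N : ℝ) :=
          Real.rpow_le_rpow_of_exponent_le hu.le (by linarith)
        rw [Real.rpow_natCast] at this
        linarith
    have h6 : (T ^ 2 * w / (2 * Λ ^ 2)) ^ (-s) =
        (2 * Λ ^ 2) ^ s * T ^ (-(4 * s)) * (T ^ 2 / w) ^ s := by
      have e1 : T ^ (-(4 * s)) = (T ^ 4) ^ (-s) := by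
        rw [← Real.rpow_natCast T 4, ← Real.rpow_mul hT0.le]; congr 1; push_cast; ring
      rw [e1, Real.rpow_neg (by positivity), Real.rpow_neg (by positivity),
        ← Real.inv_rpow (by positivity), ← Real.inv_rpow (by positivity),
        ← Real.mul_rpow (by positivity) (by positivity),
        ← Real.mul_rpow (by positivity) (by positivity)]
      congr 1
      field_simp
    rw [h6] at h4
    refine h4.trans ?_
    gcongr
    exact le_max_right _ _

/-- Lower bound for the positive order norm of a function which is an oscillating wave on the
support of a fixed test function. -/
theorem exists_le_integral_freqWeight (b : TestFn (m + 1)) (hb : LeftSupp b)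
    (a : (Fin (m + 1) → ℝ) → ℂ) (hA : ∫ x, (starRingEnd ℂ) (b.1 x) * a x ≠ 0) {s : ℝ} (hs : 0 ≤ s)
    {Λ : ℝ} (hΛ : 0 < Λ) : ∃ c₀ : ℝ, 0 < c₀ ∧ ∀ (t L : ℝ), 1 ≤ |t| → |L| = |t| / Λ →
      ∀ (c : ℂ) (h : TestFn (m + 1)), (∀ x, L • x ∈ tsupport b.1 →
        h.1 x = c * oscFactor t (L * x 0) * a (L • x)) →
        c₀ * ‖c‖ ^ 2 * (|L| ^ (m + 1))⁻¹ * |t| ^ (4 * s) ≤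
          ∫ p, freqWeight 0 p ^ s * ‖ft h p‖ ^ 2 := by
  obtain ⟨N, hN⟩ := exists_nat_ge (2 * s)
  obtain ⟨C, hC0, hC⟩ := rpow_neg_freqWeight_le (m := m) hs hN hΛ
  obtain ⟨C₁, hC₁0, hC₁⟩ := integral_scaledWeight_wave_le 0 b hb
  obtain ⟨C₂, hC₂0, hC₂⟩ := integral_scaledWeight_wave_le N b hb
  set A := ∫ x, (starRingEnd ℂ) (b.1 x) * a x with hAdef
  have hA0 : 0 < ‖A‖ := norm_pos_iff.2 hA
  set D := C * (C₁ + C₂) + 1 with hD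
  have hD0 : 0 < D := by positivity
  refine ⟨‖A‖ ^ 2 / D, by positivity, fun t L ht hL c h hh => ?_⟩
  have hT0 : 0 < |t| := by linarith
  have ht0 : t ≠ 0 := abs_pos.1 hT0
  have hL' : 0 < |L| := by rw [hL]; positivity
  have hL0 : L ≠ 0 := abs_pos.1 hL'
  set Q := dil L hL0 (wave t b hb) with hQ
  set V := (|L| ^ (m + 1))⁻¹ with hV
  have hV0 : 0 < V := by positivity
  -- The dual wave oscillates with frequency of order `tL`, that is `t²`, so a negative order `s`
  -- gains `|t|^{-4s}` in the square.
  have hneg : ∫ p, freqWeight 0 p ^ (-s) * ‖ft Q p‖ ^ 2 ≤ D * V * |t| ^ (-(4 * s)) := by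
    have i1 := integrable_norm_sq_ft Q
    have i2 := integrable_scaledWeight L N Q
    have h1 : ∫ p, freqWeight 0 p ^ (-s) * ‖ft Q p‖ ^ 2 ≤
        ∫ p, C * |t| ^ (-(4 * s)) * (‖ft Q p‖ ^ 2 + |t| ^ (2 * N) *
          ((scaledWeight L p ^ N)⁻¹ * ‖ft Q p‖ ^ 2)) := by
      refine integral_mono (integrable_freqWeight_rpow 0 (-s) Q)
        ((i1.add (i2.const_mul _)).const_mul _) fun p => ?_
      refine (mul_le_mul_of_nonneg_right (hC t L ht hL p) (sq_nonneg ‖ft Q p‖)).trans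
        (le_of_eq ?_)
      ring
    rw [integral_const_mul, integral_add i1 (i2.const_mul _), integral_const_mul] at h1
    have h2 := hC₁ t L ht0 hL0
    simp only [pow_zero, inv_one, one_mul, mul_zero, mul_one] at h2
    have h3 := mul_le_mul_of_nonneg_left (hC₂ t L ht0 hL0) (by positivity : 0 ≤ |t| ^ (2 * N))
    have h4 : |t| ^ (2 * N) * (C₂ * V * (|t| ^ (2 * N))⁻¹) = C₂ * V := by field_simp
    rw [h4] at h3
    have hT4 : 0 ≤ |t| ^ (-(4 * s)) := Real.rpow_nonneg hT0.le _
    calc _ ≤ _ := h1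
      _ ≤ C * |t| ^ (-(4 * s)) * (C₁ * V + C₂ * V) := by gcongr
      _ = (C * (C₁ + C₂)) * V * |t| ^ (-(4 * s)) := by ring
      _ ≤ D * V * |t| ^ (-(4 * s)) := by
          gcongr; rw [hD]; linarith
  -- In the pairing the two oscillating factors cancel, and after rescaling an integral independent
  -- of `t` remains.
  have hpair : ∫ p, (starRingEnd ℂ) (ft Q p) * ft h p = c * (V * A) := by
    rw [integral_conj_ft_mul_ft, hAdef, hV, ← integral_comp_dil, ← integral_const_mul]
    refine integral_congr_ae (Filter.Eventually.of_forall fun x => ?_)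
    change (starRingEnd ℂ) (oscFactor t (L * x 0) * b.1 (L • x)) * h.1 x = _
    by_cases hx : L • x ∈ tsupport b.1
    · rw [hh x hx, map_mul]
      have : (starRingEnd ℂ) (oscFactor t (L * x 0)) * oscFactor t (L * x 0) = 1 := by
        rw [Complex.conj_mul', norm_oscFactor]; simp
      linear_combination ((starRingEnd ℂ) (b.1 (L • x)) * c * a (L • x)) * this
    · have h0 : b.1 (L • x) = 0 := image_eq_zero_of_notMem_tsupport hx
      simp [h0]
  have hmem : ∀ (r : ℝ) (f : TestFn (m + 1)),
      MemLp (fun p => freqWeight 0 p ^ (r / 2) * ‖ft f p‖) (ENNReal.ofReal 2) ∧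
      ∀ p, (freqWeight 0 p ^ (r / 2) * ‖ft f p‖) ^ (2 : ℝ) = freqWeight 0 p ^ r * ‖ft f p‖ ^ 2 := by
    intro r f
    have hsq : ∀ p : EuclideanSpace ℝ (Fin (m + 1)),
        (freqWeight 0 p ^ (r / 2) * ‖ft f p‖) ^ 2 = freqWeight 0 p ^ r * ‖ft f p‖ ^ 2 := by
      intro p
      have hw : 0 < freqWeight 0 p := lt_of_lt_of_le one_pos (one_le_freqWeight 0 p)
      rw [mul_pow, ← Real.rpow_natCast, ← Real.rpow_mul hw.le]
      congr 2; push_cast; ring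
    refine ⟨?_, fun p => by rw [Real.rpow_two]; exact hsq p⟩
    rw [ENNReal.ofReal_ofNat, memLp_two_iff_integrable_sq]
    · simp only [hsq]
      exact integrable_freqWeight_rpow 0 r f
    · refine Continuous.aestronglyMeasurable (Continuous.mul ?_ (ft f).continuous.norm)
      exact (continuous_freqWeight 0).rpow_const fun p =>
        Or.inl (by have := one_le_freqWeight 0 p; linarith)
  -- Cauchy–Schwarz with the weights to the powers `-s/2` and `s/2`: the duality of the orders `-s`
  -- and `s`.
  have hCS := integral_mul_le_Lp_mul_Lq_of_nonneg Real.HolderConjugate.two_two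
    (Filter.Eventually.of_forall fun p => by
      have := one_le_freqWeight 0 p
      positivity) (Filter.Eventually.of_forall fun p => by
      have := one_le_freqWeight 0 p
      positivity) (hmem (-s) Q).1 (hmem s h).1
  simp only [(hmem _ _).2] at hCS
  have hle : ‖c‖ * (V * ‖A‖) ≤ ∫ p, freqWeight 0 p ^ (-s / 2) * ‖ft Q p‖ *
      (freqWeight 0 p ^ (s / 2) * ‖ft h p‖) := by
    have h1 := norm_integral_le_integral_norm (μ := volume)
      fun p => (starRingEnd ℂ) (ft Q p) * ft h p
    rw [hpair, norm_mul, norm_mul, Complex.norm_real, Real.norm_of_nonneg hV0.le] at h1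
    refine h1.trans (le_of_eq (integral_congr_ae (Filter.Eventually.of_forall fun p => ?_)))
    have hw : 0 < freqWeight 0 p := lt_of_lt_of_le one_pos (one_le_freqWeight 0 p)
    have e : freqWeight 0 p ^ (-s / 2) * freqWeight 0 p ^ (s / 2) = 1 := by
      rw [← Real.rpow_add hw]; simp [neg_div]
    simp only [norm_mul, RCLike.norm_conj]
    linear_combination (-(‖ft Q p‖ * ‖ft h p‖)) * e
  set X := ∫ p, freqWeight 0 p ^ s * ‖ft h p‖ ^ 2 with hX
  set Y := ∫ p, freqWeight 0 p ^ (-s) * ‖ft Q p‖ ^ 2 with hY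
  have hX0 : 0 ≤ X := integral_nonneg fun p => by
    have := one_le_freqWeight 0 p
    positivity
  have hY0 : 0 ≤ Y := integral_nonneg fun p => by
    have := one_le_freqWeight 0 p
    positivity
  have h5 : (‖c‖ * (V * ‖A‖)) ^ 2 ≤ Y * X := by
    have h6 := pow_le_pow_left₀ (by positivity) (hle.trans hCS) 2
    rw [← Real.sqrt_eq_rpow, ← Real.sqrt_eq_rpow, mul_pow (√Y), Real.sq_sqrt hY0, Real.sq_sqrt hX0]
      at h6
    exact h6
  have h7 : (‖c‖ * (V * ‖A‖)) ^ 2 ≤ D * V * |t| ^ (-(4 * s)) * X :=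
    h5.trans (mul_le_mul_of_nonneg_right hneg hX0)
  have hT4 : 0 < |t| ^ (4 * s) := Real.rpow_pos_of_pos hT0 _
  have hT4' : |t| ^ (-(4 * s)) = (|t| ^ (4 * s))⁻¹ := Real.rpow_neg hT0.le _
  rw [hT4'] at h7
  have h8 := mul_le_mul_of_nonneg_left h7 (by positivity : 0 ≤ |t| ^ (4 * s) / (D * V))
  calc ‖A‖ ^ 2 / D * ‖c‖ ^ 2 * V * |t| ^ (4 * s)
      = |t| ^ (4 * s) / (D * V) * (‖c‖ * (V * ‖A‖)) ^ 2 := by field_simp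
    _ ≤ _ := h8
    _ = X := by field_simp

theorem liOp_single (t : ℝ) (k : Fin d) (κ : ℝ) :
    liOp t (Matrix.single k.succ 0 κ) = (-κ : ℂ) • (pd k : Module.End ℂ (TestFn d)) := by
  ext f x
  rw [liOp_apply]
  change _ = (-κ : ℂ) * fderiv ℝ f.1 x (Pi.single k 1)
  have h0 : (Matrix.single k.succ 0 κ).mulVec (affVec x) 0 = 0 := by
    simp [Matrix.single_mulVec, (Fin.succ_ne_zero k).symm]
  have h1 : (fun l : Fin d => (Matrix.single k.succ 0 κ).mulVec (affVec x) l.succ -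
      x l * (Matrix.single k.succ 0 κ).mulVec (affVec x) 0) = κ • Pi.single k 1 := by
    funext l
    rw [h0]
    simp [Matrix.single_mulVec, Function.update_apply, affVec, Pi.single_apply]
  rw [h1, h0, map_smul]
  simp

end TestFn

open TestFn in
-- On the Fourier side `(1 + y)^S ≤ 2^S (1 + y^S)`, and the two summands belong to the empty word
-- and to the root vector repeated `S` times. For `S ≥ 1` these words are distinct, so both are
-- counted in the word norm.
theorem besselNorm_le_wordNormSq (odd : Bool) (t : ℝ)
    (g : Matrix.SpecialLinearGroup (Fin (d + 1)) ℝ)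
    (p : {p : Fin (d + 1) × Fin (d + 1) // p.1 ≠ p.2}) (k : Fin d) (κ : ℝ) (hκ : κ ^ 2 = 1)
    (hg : conjVec g (.inr p) = Matrix.single k.succ 0 κ) {S : ℕ} (hS : 1 ≤ S) (h : TestFn d) :
    besselNorm (fun τ => indRep d odd t (oneParam (.inr p) τ)) S (indRep d odd t g (vec h)) ≤
      √(2 ^ S) * √(wordNormSq (indRep d odd t) S (indRep d odd t g (vec h))) := by
  rw [besselNorm_rep_vec odd t g p k κ hκ hg, ← Real.sqrt_mul (by positivity)]
  refine Real.sqrt_le_sqrt ?_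
  set D := (pd k ^ S : Module.End ℂ (TestFn d)) h with hD
  have hft : ∀ (N : ℕ) q, ft ((pd k ^ N : Module.End ℂ (TestFn d)) h) q =
      ((2 * Real.pi * Complex.I) * q k) ^ N * ft h q := by
    intro N q
    induction N with
    | zero => simp
    | succ N ih => rw [pow_succ', Module.End.mul_apply, ft_pd, ih]; ring
  have hword : (List.replicate S (Sum.inr p : BasisIdx d)).foldr (dRep (indRep d odd t))
      (indRep d odd t g (vec h)) = (-κ : ℂ) ^ S • indRep d odd t g (vec D) := by
    rw [foldr_dRep_rep_vec, List.map_replicate, List.prod_replicate, hg, liOp_single, smul_pow]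
    rw [LinearMap.smul_apply, map_smul, map_smul]
  have hnword : ‖(List.replicate S (Sum.inr p : BasisIdx d)).foldr (dRep (indRep d odd t))
      (indRep d odd t g (vec h))‖ ^ 2 = ‖vec D‖ ^ 2 := by
    rw [hword, norm_smul, LinearIsometry.norm_map, mul_pow, norm_pow, norm_neg, Complex.norm_real,
      Real.norm_eq_abs, ← pow_mul, mul_comm S 2, pow_mul, sq_abs, hκ, one_pow, one_mul]
  have hlow : ‖vec h‖ ^ 2 + ‖vec D‖ ^ 2 ≤
      wordNormSq (indRep d odd t) S (indRep d odd t g (vec h)) := by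
    rw [wordNormSq, Finset.sum_range_succ]
    refine add_le_add ?_ ?_
    · refine le_trans (le_of_eq ?_) (Finset.single_le_sum (fun i _ => Finset.sum_nonneg
        fun w _ => sq_nonneg _) (Finset.mem_range.2 hS))
      simp
    · rw [← hnword]
      refine le_trans (le_of_eq ?_) (Finset.single_le_sum (fun w _ => sq_nonneg _)
        (Finset.mem_univ fun _ : Fin S => (Sum.inr p : BasisIdx d)))
      rw [List.ofFn_const]
  refine le_trans ?_ (mul_le_mul_of_nonneg_left hlow (by positivity))
  rw [norm_vec_sq, norm_vec_sq, ← integral_norm_sq_ft, ← integral_norm_sq_ft,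
    ← integral_add (integrable_norm_sq_ft h) (integrable_norm_sq_ft D), ← integral_const_mul]
  refine integral_mono (integrable_freqWeight_rpow k S h)
    (((integrable_norm_sq_ft h).add (integrable_norm_sq_ft D)).const_mul _) fun q => ?_
  simp only
  rw [hD, hft, norm_mul, norm_pow, mul_pow, Real.rpow_natCast]
  have e : ‖(2 * Real.pi * Complex.I) * q k‖ ^ 2 = (2 * Real.pi * q k) ^ 2 := by
    rw [norm_mul, norm_mul, Complex.norm_I, norm_mul, Complex.norm_real, Complex.norm_real,
      mul_one, mul_pow, mul_pow]
    simp only [Complex.norm_ofNat, Real.norm_eq_abs, sq_abs]; ring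
  rw [← pow_mul, mul_comm S 2, pow_mul, e]
  set y := (2 * Real.pi * q k) ^ 2 with hy
  have hy0 : 0 ≤ y := sq_nonneg _
  have h1 : freqWeight k q ^ S ≤ 2 ^ S * (1 + y ^ S) := by
    have := add_pow_le zero_le_one hy0 S
    rw [one_pow] at this
    refine this.trans ?_
    refine mul_le_mul_of_nonneg_right (pow_le_pow_right₀ one_le_two (Nat.sub_le S 1)) (by positivity)
  calc freqWeight k q ^ S * ‖ft h q‖ ^ 2 ≤ 2 ^ S * (1 + y ^ S) * ‖ft h q‖ ^ 2 := by gcongr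
    _ = _ := by ring

end NegativeNorm

/-! ### Weyl group elements and dilations -/

section GroupElements
variable {d m : ℕ}

/-- The weights making a permutation matrix unimodular. -/
def permWeight (σ : Equiv.Perm (Fin (d + 1))) (c b : Fin (d + 1)) : ℝ :=
  if b = c then ((Equiv.Perm.sign σ : ℤ) : ℝ) else 1

theorem permWeight_sq (σ : Equiv.Perm (Fin (d + 1))) (c b : Fin (d + 1)) :
    permWeight σ c b ^ 2 = 1 := by
  rw [permWeight]
  split_ifs
  · rcases Int.units_eq_one_or (Equiv.Perm.sign σ) with h | h <;> rw [h] <;> simp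
  · exact one_pow 2

/-- The permutation matrix of `σ` with the sign of `σ` in the column `c`. -/
def signedPerm (σ : Equiv.Perm (Fin (d + 1))) (c : Fin (d + 1)) :
    Matrix.SpecialLinearGroup (Fin (d + 1)) ℝ :=
  ⟨(1 : Matrix (Fin (d + 1)) (Fin (d + 1)) ℝ).submatrix id σ * Matrix.diagonal (permWeight σ c), by
    rw [Matrix.det_mul, Matrix.det_permute', Matrix.det_one, Matrix.det_diagonal]
    simp only [permWeight, Finset.prod_ite_eq', Finset.mem_univ, if_true]
    rcases Int.units_eq_one_or (Equiv.Perm.sign σ) with h | h <;> rw [h] <;> simp⟩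

theorem signedPerm_apply (σ : Equiv.Perm (Fin (d + 1))) (c a b : Fin (d + 1)) :
    (signedPerm σ c).1 a b = if a = σ b then permWeight σ c b else 0 := by
  simp [signedPerm, Matrix.mul_diagonal, Matrix.one_apply]

theorem signedPerm_mulVec (σ : Equiv.Perm (Fin (d + 1))) (c b : Fin (d + 1)) (v : Fin (d + 1) → ℝ) :
    (signedPerm σ c).1.mulVec v (σ b) = permWeight σ c b * v b := by
  simp [Matrix.mulVec, dotProduct, signedPerm_apply]

theorem conjVec_eq {g : Matrix.SpecialLinearGroup (Fin (d + 1)) ℝ} {b : BasisIdx d}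
    {Z : Matrix (Fin (d + 1)) (Fin (d + 1)) ℝ} (h : basisVec b * g.1 = g.1 * Z) :
    conjVec g b = Z := by
  have h1 : (g⁻¹).1 * g.1 = 1 := congrArg Subtype.val (inv_mul_cancel g)
  rw [conjVec, Matrix.mul_assoc, h, ← Matrix.mul_assoc, h1, Matrix.one_mul]

theorem conjVec_mul (g h : Matrix.SpecialLinearGroup (Fin (d + 1)) ℝ) (b : BasisIdx d) :
    conjVec (g * h) b = (h⁻¹).1 * conjVec g b * h.1 := by
  have h1 : ((g * h)⁻¹).1 = (h⁻¹).1 * (g⁻¹).1 := by rw [mul_inv_rev]; rfl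
  have h2 : (g * h).1 = g.1 * h.1 := rfl
  rw [conjVec, conjVec, h1, h2]
  simp only [Matrix.mul_assoc]

theorem conjVec_signedPerm (σ : Equiv.Perm (Fin (d + 1))) (c k l : Fin (d + 1))
    (p : {p : Fin (d + 1) × Fin (d + 1) // p.1 ≠ p.2}) (hk : σ k = p.1.1) (hl : σ l = p.1.2) :
    conjVec (signedPerm σ c) (.inr p) =
      Matrix.single k l (permWeight σ c l * permWeight σ c k) := by
  refine conjVec_eq ?_
  ext a b
  have h1 := permWeight_sq σ c k
  simp only [basisVec, Matrix.mul_apply, Matrix.single_apply, signedPerm_apply, ← hk, ← hl]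
  rw [Finset.sum_eq_single (σ l), Finset.sum_eq_single k]
  · by_cases ha : a = σ k <;> by_cases hb : b = l
    · subst ha hb
      simp only [and_self, if_true, one_mul]
      linear_combination (-permWeight σ c b) * h1
    · simp [ha, Ne.symm hb]
    · simp [Ne.symm ha, ha]
    · simp [Ne.symm ha, ha]
  · intro x _ hx; simp [Ne.symm hx]
  · simp
  · intro x _ hx; simp [Ne.symm hx]
  · simp

/-- The Weyl group element exchanging the first two coordinate lines. -/
def flip (m : ℕ) : Matrix.SpecialLinearGroup (Fin (m + 2)) ℝ :=
  signedPerm (Equiv.swap 0 (Fin.succ 0)) (Fin.succ 0)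

theorem permWeight_flip (b : Fin (m + 2)) :
    permWeight (Equiv.swap 0 (Fin.succ 0)) (Fin.succ 0) b = if b = Fin.succ 0 then -1 else 1 := by
  rw [permWeight, Equiv.Perm.sign_swap (Fin.succ_ne_zero _).symm]
  split_ifs <;> simp

theorem den_flip (x : Fin (m + 1) → ℝ) : den (flip m).1 x = -x 0 := by
  have h := signedPerm_mulVec (Equiv.swap 0 (Fin.succ 0)) (Fin.succ 0) (Fin.succ 0) (affVec x)
  rw [Equiv.swap_apply_right, permWeight_flip, if_pos rfl] at h
  rw [den, flip, h]
  simp [affVec]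

theorem proj_flip (x : Fin (m + 1) → ℝ) :
    proj (flip m).1 x = fun k => (if k = 0 then 1 else x k) / (-x 0) := by
  funext k
  rw [proj, den_flip]
  congr 1
  split_ifs with hk
  · subst hk
    have h := signedPerm_mulVec (Equiv.swap 0 (Fin.succ 0)) (Fin.succ 0) 0 (affVec x)
    rw [Equiv.swap_apply_left, permWeight_flip, if_neg (Fin.succ_ne_zero _).symm] at h
    rw [flip, h]
    simp [affVec]
  · have h1 : k.succ ≠ Fin.succ 0 := fun h => hk (Fin.succ_injective _ h)
    have h := signedPerm_mulVec (Equiv.swap 0 (Fin.succ 0)) (Fin.succ 0) k.succ (affVec x)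
    rw [Equiv.swap_apply_of_ne_of_ne (Fin.succ_ne_zero _) h1, permWeight_flip, if_neg h1] at h
    rw [flip, h]
    simp [affVec]

/-- A permutation sending 0 to `j` and 1 to `i` turns `E_{i,j}` into `±E_{1,0}` and `E_{j,i}` into
`±E_{0,1}`; `flip` then carries the latter to `±E_{1,0}`. -/
theorem exists_adapted_element (i j : Fin (m + 2)) (hij : i ≠ j) :
    ∃ (g : Matrix.SpecialLinearGroup (Fin (m + 2)) ℝ) (κ κ' : ℝ), κ ^ 2 = 1 ∧ κ' ^ 2 = 1 ∧
      conjVec g (root i j hij) = Matrix.single (Fin.succ 0) 0 κ ∧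
      conjVec (g * flip m) (root j i hij.symm) = Matrix.single (Fin.succ 0) 0 κ' := by
  set u : Fin (m + 2) := Fin.succ 0 with hu
  have hu0 : u ≠ 0 := Fin.succ_ne_zero _
  -- The first transposition sends 0 to `j` and `u` to `x`; the second moves `x` to `i` and fixes
  -- `j`, since `j` is neither `x` nor `i`.
  set x := Equiv.swap 0 j u with hx
  set σ : Equiv.Perm (Fin (m + 2)) := Equiv.swap x i * Equiv.swap 0 j with hσ
  have hjx : j ≠ x := by
    intro h
    have : Equiv.swap 0 j u = Equiv.swap 0 j 0 := by rw [Equiv.swap_apply_left, ← hx, ← h]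
    exact hu0 ((Equiv.swap 0 j).injective this)
  have h0 : σ 0 = j := by
    rw [hσ, Equiv.Perm.mul_apply, Equiv.swap_apply_left, Equiv.swap_apply_of_ne_of_ne hjx hij.symm]
  have h1 : σ u = i := by
    rw [hσ, Equiv.Perm.mul_apply, ← hx, Equiv.swap_apply_left]
  have e1 := conjVec_signedPerm σ 0 u 0 ⟨(i, j), hij⟩ h1 h0
  have e2 := conjVec_signedPerm σ 0 0 u ⟨(j, i), hij.symm⟩ h0 h1
  have e3 := conjVec_signedPerm (Equiv.swap 0 u) u u 0 ⟨(0, u), hu0.symm⟩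
    (Equiv.swap_apply_right _ _) (Equiv.swap_apply_left _ _)
  refine ⟨signedPerm σ 0, _, permWeight σ 0 u * permWeight σ 0 0 *
    (permWeight (Equiv.swap 0 u) u 0 * permWeight (Equiv.swap 0 u) u u), ?_, ?_, e1, ?_⟩
  · rw [mul_pow, permWeight_sq, permWeight_sq, one_mul]
  · simp only [mul_pow, permWeight_sq, one_mul]
  · have e4 : ∀ v : ℝ, Matrix.single (0 : Fin (m + 2)) u v =
        v • basisVec (.inr ⟨(0, u), hu0.symm⟩ : BasisIdx (m + 1)) := by
      intro v; simp [basisVec, Matrix.smul_single]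
    rw [conjVec_mul, root, e2, e4, Matrix.mul_smul, Matrix.smul_mul]
    have e5 : ((flip m)⁻¹).1 * basisVec (.inr ⟨(0, u), hu0.symm⟩ : BasisIdx (m + 1)) * (flip m).1 =
      _ := e3
    rw [e5, Matrix.smul_single, smul_eq_mul]

/-- The diagonal element acting in the line model by the dilation with factor `s ^ (d + 1)`. -/
def dilation (d : ℕ) (s : ℝ) (hs : s ≠ 0) : Matrix.SpecialLinearGroup (Fin (d + 1)) ℝ :=
  ⟨Matrix.diagonal (Fin.cons (s ^ d)⁻¹ fun _ => s), by
    rw [Matrix.det_diagonal, Fin.prod_univ_succ]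
    simp [hs]⟩

theorem den_dilation (s : ℝ) (hs : s ≠ 0) (x : Fin d → ℝ) :
    den (dilation d s hs).1 x = (s ^ d)⁻¹ := by
  simp [den, dilation, Matrix.mulVec_diagonal, affVec]

theorem proj_dilation (s : ℝ) (hs : s ≠ 0) (x : Fin d → ℝ) :
    proj (dilation d s hs).1 x = s ^ (d + 1) • x := by
  funext k
  rw [proj, den_dilation]
  simp [dilation, Matrix.mulVec_diagonal, affVec, pow_succ]
  ring

theorem conjVec_mul_dilation_inv (g : Matrix.SpecialLinearGroup (Fin (d + 1)) ℝ) (s : ℝ) (hs : s ≠ 0)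
    (b : BasisIdx d) (a c : Fin (d + 1)) :
    conjVec (g * (dilation d s hs)⁻¹) b a c =
      (Fin.cons (s ^ d)⁻¹ (fun _ => s) : Fin (d + 1) → ℝ) a * conjVec g b a c *
        ((Fin.cons (s ^ d)⁻¹ fun _ => s : Fin (d + 1) → ℝ) c)⁻¹ := by
  set v : Fin (d + 1) → ℝ := Fin.cons (s ^ d)⁻¹ fun _ => s with hv
  have hv0 : ∀ a, v a ≠ 0 := by
    intro a
    refine Fin.cases ?_ (fun k => ?_) a
    · simp [hv, hs]
    · simpa [hv] using hs
  have h1 : (dilation d s hs).1 = Matrix.diagonal v := rfl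
  have h2 : ((dilation d s hs)⁻¹).1 = Matrix.diagonal fun a => (v a)⁻¹ := by
    have e1 : ((dilation d s hs)⁻¹).1 * (dilation d s hs).1 = 1 :=
      congrArg Subtype.val (inv_mul_cancel (dilation d s hs))
    have e2 : (dilation d s hs).1 * Matrix.diagonal (fun a => (v a)⁻¹) = 1 := by
      rw [h1, Matrix.diagonal_mul_diagonal]
      simp [hv0]
    exact left_inv_eq_right_inv e1 e2
  rw [conjVec_mul, inv_inv, h1, h2, Matrix.mul_diagonal, Matrix.diagonal_mul]

/-- Conjugation by dilations does not increase the weight of the Lie algebra basis by more than a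
multiple of the parameter of the representation. -/
theorem exists_rowWeight_conjVec_le (g : Matrix.SpecialLinearGroup (Fin (d + 1)) ℝ) {Λ : ℝ}
    (hΛ : 0 < Λ) : ∃ M : ℝ, 1 ≤ M ∧ ∀ (t : ℝ) (b : BasisIdx d),
      rowWeight t (conjVec g b) ≤ M * (1 + |t|) ∧
      ∀ (s : ℝ) (hs : s ≠ 0), 0 < s → 1 ≤ s ^ (d + 1) → s ^ (d + 1) ≤ |t| / Λ →
        rowWeight t (conjVec (g * (dilation d s hs)⁻¹) b) ≤ M * (1 + |t|) := by
  set N := ∑ b : BasisIdx d, ∑ a, ∑ c, |conjVec g b a c| with hN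
  have hb : ∀ b : BasisIdx d, ∑ a, ∑ c, |conjVec g b a c| ≤ N := fun b =>
    Finset.single_le_sum (f := fun b : BasisIdx d => ∑ a, ∑ c, |conjVec g b a c|)
      (fun b _ => Finset.sum_nonneg fun a _ => Finset.sum_nonneg fun c _ => abs_nonneg _)
      (Finset.mem_univ b)
  have hN0 : 0 ≤ N := Finset.sum_nonneg fun b _ => Finset.sum_nonneg fun a _ =>
    Finset.sum_nonneg fun c _ => abs_nonneg _
  have hΛ' : 0 < Λ⁻¹ := inv_pos.2 hΛ
  have key : ∀ (t : ℝ) (b : BasisIdx d) (Y : Matrix (Fin (d + 1)) (Fin (d + 1)) ℝ),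
      (∀ a c, |Y a c| * (if a = 0 then 1 + |t| else 1) ≤
        (1 + Λ⁻¹) * (1 + |t|) * |conjVec g b a c|) →
      rowWeight t Y ≤ (N * (1 + Λ⁻¹) + 1) * (1 + |t|) := by
    intro t b Y hY
    have ht : 0 ≤ |t| := abs_nonneg t
    calc rowWeight t Y ≤ ∑ a, ∑ c, (1 + Λ⁻¹) * (1 + |t|) * |conjVec g b a c| :=
          Finset.sum_le_sum fun a _ => Finset.sum_le_sum fun c _ => hY a c
      _ = (1 + Λ⁻¹) * (1 + |t|) * ∑ a, ∑ c, |conjVec g b a c| := by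
          simp only [Finset.mul_sum]
      _ ≤ (1 + Λ⁻¹) * (1 + |t|) * N := by gcongr; exact hb b
      _ ≤ _ := by nlinarith
  refine ⟨N * (1 + Λ⁻¹) + 1, by nlinarith, fun t b => ?_⟩
  have ht : 0 ≤ |t| := abs_nonneg t
  refine ⟨key t b _ fun a c => ?_, fun s hs hs0 h1 h2 => key t b _ fun a c => ?_⟩
  · rw [mul_comm]
    gcongr
    split_ifs <;> nlinarith
  · have hY := abs_nonneg (conjVec g b a c)
    have hsd : s * s ^ d = s ^ (d + 1) := by ring
    have hsd0 : 0 < s ^ (d + 1) := by positivity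
    have h2' : s ^ (d + 1) ≤ Λ⁻¹ * |t| := by rw [inv_mul_eq_div]; exact h2
    have hb1 : 1 + |t| ≤ (1 + Λ⁻¹) * (1 + |t|) := by nlinarith
    have hb2 : s ^ (d + 1) ≤ (1 + Λ⁻¹) * (1 + |t|) := by nlinarith
    rw [conjVec_mul_dilation_inv, abs_mul, abs_mul]
    suffices h : |(Fin.cons (s ^ d)⁻¹ (fun _ => s) : Fin (d + 1) → ℝ) a| *
        |((Fin.cons (s ^ d)⁻¹ fun _ => s : Fin (d + 1) → ℝ) c)⁻¹| *
        (if a = 0 then 1 + |t| else 1) ≤ (1 + Λ⁻¹) * (1 + |t|) by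
      calc _ = |(Fin.cons (s ^ d)⁻¹ (fun _ => s) : Fin (d + 1) → ℝ) a| *
        |((Fin.cons (s ^ d)⁻¹ fun _ => s : Fin (d + 1) → ℝ) c)⁻¹| *
        (if a = 0 then 1 + |t| else 1) * |conjVec g b a c| := by ring
        _ ≤ _ := mul_le_mul_of_nonneg_right h hY
    -- The entry `(a, c)` is scaled by `v_a / v_c`. First-row entries off the corner, which carry
    -- the weight `1 + |t|`, shrink; first-column entries off the corner grow by `s^{d+1} ≤ |t|/Λ`
    -- but carry no weight; all others are unchanged.
    refine Fin.cases ?_ (fun k => ?_) a <;> refine Fin.cases ?_ (fun l => ?_) c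
    · simp only [Fin.cons_zero, if_true, inv_inv, ← abs_mul]
      rw [inv_mul_cancel₀ (by positivity), abs_one, one_mul]
      exact hb1
    · simp only [Fin.cons_zero, Fin.cons_succ, if_true, ← abs_mul]
      rw [← mul_inv, mul_comm (s ^ d), hsd, abs_of_pos (by positivity)]
      refine le_trans ?_ hb1
      exact mul_le_of_le_one_left (by positivity) (inv_le_one_of_one_le₀ h1)
    · simp only [Fin.cons_zero, Fin.cons_succ, inv_inv, ← abs_mul, Fin.succ_ne_zero, if_false,
        mul_one]
      rw [hsd, abs_of_pos hsd0]
      exact hb2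
    · simp only [Fin.cons_succ, ← abs_mul, Fin.succ_ne_zero, if_false, mul_one]
      rw [mul_inv_cancel₀ hs, abs_one]
      linarith

end GroupElements

/-! ### Passing to the second chart -/

section ChartChange
variable {d m : ℕ}
open TestFn

theorem contDiffAt_multiplier (odd : Bool) (t : ℝ) {a : ℝ} (ha : a ≠ 0) :
    ContDiffAt ℝ ∞ (multiplier d odd t) a := by
  have hpos : ∀ {a : ℝ}, 0 < a → ContDiffAt ℝ ∞ (multiplier d odd t) a := by
    intro a ha
    have h1 := (contDiffAt_const (c := -((((d : ℝ) + 1) / 2 : ℝ) + t * Complex.I : ℂ))).mul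
      (Complex.ofRealCLM.contDiff.contDiffAt.comp a (Real.contDiffAt_log (n := ∞) |>.2 ha.ne'))
    refine h1.cexp.congr_of_eventuallyEq ?_
    filter_upwards [lt_mem_nhds ha] with y hy
    rw [multiplier_of_pos odd t hy]; rfl
  rcases lt_or_gt_of_ne ha with h | h
  · have h1 : ContDiffAt ℝ ∞ (fun a => multiplier d odd t (-1) * multiplier d odd t (-a)) a :=
      contDiffAt_const.mul ((hpos (neg_pos.2 h)).comp a contDiff_neg.contDiffAt)
    refine h1.congr_of_eventuallyEq ?_
    filter_upwards [gt_mem_nhds h] with y hy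
    rw [← multiplier_mul odd t _ _ (by norm_num) (by linarith)]
    simp
  · exact hpos h

theorem contDiffAt_proj_flip {x : Fin (m + 1) → ℝ} (hx : x 0 ≠ 0) :
    ContDiffAt ℝ ∞ (proj (flip m).1) x := by
  have : proj (flip m).1 = fun x k => (if k = 0 then 1 else x k) / (-x 0) := funext proj_flip
  rw [this]
  refine contDiffAt_pi.2 fun k => ContDiffAt.div ?_ ?_ (neg_ne_zero.2 hx)
  · split_ifs
    · exact contDiffAt_const
    · exact (contDiff_apply ℝ ℝ k).contDiffAt
  · exact (contDiff_apply ℝ ℝ (0 : Fin (m + 1))).contDiffAt.neg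

/-- The expression in the chart of `flip m` of a test function vanishing near its exceptional
hyperplane. -/
def flipFn (odd : Bool) (t : ℝ) (f : TestFn (m + 1)) (hf : ∀ x ∈ tsupport f.1, x 0 ≠ 0) :
    TestFn (m + 1) := by
  refine ⟨indFun odd t (flip m).1 f.1, ?_⟩
  -- The image of the support under the inverse chart change, which is continuous there.
  set K := (fun y : Fin (m + 1) → ℝ => fun k => (if k = 0 then -1 else y k) / y 0) ''
    tsupport f.1 with hK
  have hKc : IsCompact K := by
    refine f.2.2.isCompact.image_of_continuousOn ?_
    refine continuousOn_pi.2 fun k => ContinuousOn.div ?_ (continuous_apply 0).continuousOn hf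
    split_ifs
    · exact continuousOn_const
    · exact (continuous_apply k).continuousOn
  have hK0 : ∀ x ∈ K, x 0 ≠ 0 := by
    rintro _ ⟨y, hy, rfl⟩
    have := hf y hy
    simp [this]
  have hz : ∀ x, x ∉ K → indFun odd t (flip m).1 f.1 x = 0 := by
    intro x hx
    rw [indFun, den_flip]
    by_cases h0 : x 0 = 0
    · rw [h0, neg_zero, multiplier_zero, zero_mul]
    · have : f.1 (proj (flip m).1 x) = 0 := by
        refine image_eq_zero_of_notMem_tsupport fun h => hx ⟨_, h, ?_⟩
        rw [proj_flip]
        funext k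
        by_cases hk : k = 0
        · subst hk; simp
        · simp only [hk, if_false, if_true]
          field_simp
      rw [this, mul_zero]
  refine ⟨contDiff_iff_contDiffAt.2 fun x => ?_, HasCompactSupport.intro hKc hz⟩
  by_cases hx : x ∈ K
  · have hx0 := hK0 x hx
    have h1 : ContDiffAt ℝ ∞ (fun x : Fin (m + 1) → ℝ => multiplier (m + 1) odd t (-x 0)) x :=
      ContDiffAt.comp x (contDiffAt_multiplier odd t (neg_ne_zero.2 hx0))
        (contDiff_apply ℝ ℝ (0 : Fin (m + 1))).contDiffAt.neg
    have h2 : indFun odd t (flip m).1 f.1 =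
        fun x => multiplier (m + 1) odd t (-x 0) * f.1 (proj (flip m).1 x) := by
      funext x; rw [indFun, den_flip]
    rw [h2]
    exact h1.mul (f.2.1.contDiffAt.comp x (contDiffAt_proj_flip hx0))
  · refine (contDiffAt_const (c := (0 : ℂ))).congr_of_eventuallyEq ?_
    filter_upwards [hKc.isClosed.isOpen_compl.mem_nhds hx] with y hy
    exact hz y hy

theorem flipFn_apply (odd : Bool) (t : ℝ) (f : TestFn (m + 1)) (hf : ∀ x ∈ tsupport f.1, x 0 ≠ 0)
    (x : Fin (m + 1) → ℝ) : (flipFn odd t f hf).1 x =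
      multiplier (m + 1) odd t (-x 0) * f.1 (fun k => (if k = 0 then 1 else x k) / (-x 0)) := by
  change indFun odd t (flip m).1 f.1 x = _
  rw [indFun, den_flip, proj_flip]

/-- The same vector read in two charts: the first makes `u_{i,j}` a derivative, the second
`u_{j,i}`. -/
theorem indRep_vec_eq_flipFn (odd : Bool) (t : ℝ) (g : Matrix.SpecialLinearGroup (Fin (m + 2)) ℝ)
    (f : TestFn (m + 1)) (hf : ∀ x ∈ tsupport f.1, x 0 ≠ 0) :
    indRep (m + 1) odd t g (vec f) = indRep (m + 1) odd t (g * flip m) (vec (flipFn odd t f hf)) := by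
  have h : vec (flipFn odd t f hf) = indRep (m + 1) odd t (flip m)⁻¹ (vec f) := by
    rw [indRep_vec, inv_inv]; rfl
  rw [h]
  change _ = (indRep (m + 1) odd t (g * flip m) * indRep (m + 1) odd t (flip m)⁻¹) (vec f)
  rw [← map_mul, mul_inv_cancel_right]

theorem indRep_dilation_inv_vec (odd : Bool) (t s : ℝ) (hs : s ≠ 0)
    (g : Matrix.SpecialLinearGroup (Fin (d + 1)) ℝ) (f : TestFn d) :
    indRep d odd t (g * (dilation d s hs)⁻¹) (vec f) = indRep d odd t g
      (vec (multiplier d odd t (s ^ d)⁻¹ • dil (s ^ (d + 1)) (pow_ne_zero _ hs) f)) := by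
  rw [map_mul]
  change indRep d odd t g (indRep d odd t _ (vec f)) = _
  rw [indRep_vec, inv_inv]
  congr 1
  change _ = toL2 _
  congr 1
  funext x
  rw [indFun, den_dilation, proj_dilation]
  rfl

end ChartChange

/-! ### The amplitude of the solution -/

section Profile

/-- The primitive of `ψ` vanishing at `0`. -/
def primitive (ψ : ℝ → ℂ) (v : ℝ) : ℂ := ∫ u in (0 : ℝ)..v, ψ u

theorem hasDerivAt_primitive {ψ : ℝ → ℂ} (hψ : Continuous ψ) (v : ℝ) :
    HasDerivAt (primitive ψ) (ψ v) v :=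
  (hψ.integral_hasStrictDerivAt 0 v).hasDerivAt

theorem contDiff_primitive {ψ : ℝ → ℂ} (hψ : ContDiff ℝ ∞ ψ) : ContDiff ℝ ∞ (primitive ψ) := by
  have h := hasDerivAt_primitive hψ.continuous
  rw [contDiff_infty_iff_deriv]
  refine ⟨fun v => (h v).differentiableAt, ?_⟩
  rw [show deriv (primitive ψ) = ψ from funext fun v => (h v).deriv]
  exact hψ

theorem primitive_eq_zero {ψ : ℝ → ℂ} {a v : ℝ} (ha : 0 ≤ a) (h : ∀ u ≤ a, ψ u = 0) (hv : v ≤ a) :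
    primitive ψ v = 0 := by
  rw [primitive, intervalIntegral.integral_congr (g := fun _ => 0) fun u hu =>
    h u (hu.2.trans (max_le ha hv))]
  simp

theorem primitive_eq_of_le {ψ : ℝ → ℂ} (hψ : Continuous ψ) {a v w : ℝ} (h : ∀ u, a ≤ u → ψ u = 0)
    (hv : a ≤ v) (hw : a ≤ w) : primitive ψ v = primitive ψ w := by
  rw [primitive, primitive, ← intervalIntegral.integral_add_adjacent_intervals
    (hψ.intervalIntegrable 0 w) (hψ.intervalIntegrable w v),
    intervalIntegral.integral_congr (a := w) (b := v) (g := fun _ => 0) fun u hu =>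
      h u ((le_min hw hv).trans hu.1)]
  simp

/-- A smooth density on `[1, 2]` with integral one. -/
def unitMass (u : ℝ) : ℂ :=
  (((⟨1 / 4, 1 / 2, by norm_num, by norm_num⟩ : ContDiffBump (3 / 2 : ℝ)).normed volume u : ℝ) : ℂ)

theorem contDiff_unitMass : ContDiff ℝ ∞ unitMass :=
  Complex.ofRealCLM.contDiff.comp (ContDiffBump.contDiff_normed _)

theorem unitMass_eq_zero {u : ℝ} (hu : u ≤ 1 ∨ 2 ≤ u) : unitMass u = 0 := by
  rw [unitMass, Complex.ofReal_eq_zero, ← Function.notMem_support, ContDiffBump.support_normed_eq,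
    Real.ball_eq_Ioo]
  rintro ⟨h1, h2⟩
  norm_num at h1 h2
  rcases hu with h | h <;> linarith

theorem primitive_unitMass {v : ℝ} (hv : 2 ≤ v) : primitive unitMass v = 1 := by
  have h2 := fun u (hu : (2 : ℝ) ≤ u) => unitMass_eq_zero (Or.inr hu)
  rw [primitive_eq_of_le contDiff_unitMass.continuous h2 hv le_rfl, primitive,
    intervalIntegral.integral_eq_integral_of_support_subset]
  · unfold unitMass
    rw [integral_complex_ofReal, ContDiffBump.integral_normed, Complex.ofReal_one]
  · intro u hu
    by_contra h
    refine hu (unitMass_eq_zero ?_)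
    by_contra! h'
    exact h ⟨by linarith, h'.2.le⟩

theorem contDiff_statWave (t : ℝ) : ContDiff ℝ ∞ (statWave t) := by
  refine contDiff_iff_contDiffAt.2 fun z => ?_
  rcases lt_or_ge z (1 / 2) with hz | hz
  · refine (contDiffAt_const (c := (0 : ℂ))).congr_of_eventuallyEq ?_
    filter_upwards [gt_mem_nhds hz] with y hy
    rw [statWave, statAmp_eq_zero (Or.inl hy.le), Complex.ofReal_zero, mul_zero]
  · have hz0 : z ≠ 0 := by linarith
    have h1 : ContDiffAt ℝ ∞ (fun z : ℝ => z - Real.log z) z :=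
      contDiffAt_id.sub (contDiffAt_id.log hz0)
    have h2 : ContDiffAt ℝ ∞ (fun z : ℝ => ((z - Real.log z : ℝ) : ℂ)) z :=
      Complex.ofRealCLM.contDiff.contDiffAt.comp z h1
    exact (((contDiffAt_const (c := (t : ℂ))).mul h2).mul contDiffAt_const).cexp.mul
      (Complex.ofRealCLM.contDiff.contDiffAt.comp z contDiff_statAmp.contDiffAt)

theorem statWave_eq_zero (t : ℝ) {z : ℝ} (hz : z ≤ 1 / 2 ∨ 3 / 2 ≤ z) : statWave t z = 0 := by
  rw [statWave, statAmp_eq_zero hz, Complex.ofReal_zero, mul_zero]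

/-- The amplitude of the solution: it rises to one over a fixed interval and decays over a
stationary point of the phase at the distance `ℓ`. The sign `ς` gives the direction. -/
def amplitude (ς ℓ t X : ℝ) : ℂ :=
  primitive unitMass (ς * X) - (primitive (statWave t) 2)⁻¹ * primitive (statWave t) (ς / ℓ * X)

theorem contDiff_amplitude (ς ℓ t : ℝ) : ContDiff ℝ ∞ (amplitude ς ℓ t) :=
  ((contDiff_primitive contDiff_unitMass).comp (contDiff_const.mul contDiff_id)).sub
    (contDiff_const.mul
      ((contDiff_primitive (contDiff_statWave t)).comp (contDiff_const.mul contDiff_id)))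

theorem hasDerivAt_amplitude (ς ℓ t X : ℝ) : HasDerivAt (amplitude ς ℓ t)
    (ς * unitMass (ς * X) -
      (primitive (statWave t) 2)⁻¹ * ((ς / ℓ : ℝ) * statWave t (ς / ℓ * X))) X := by
  have h : ∀ a : ℝ, HasDerivAt (fun X : ℝ => a * X) a X := fun a => by
    simpa using (hasDerivAt_id X).const_mul a
  have h1 := (hasDerivAt_primitive contDiff_unitMass.continuous (ς * X)).scomp X (h ς)
  have h2 := (hasDerivAt_primitive (contDiff_statWave t).continuous (ς / ℓ * X)).scomp X (h (ς / ℓ))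
  exact (h1.sub (h2.const_mul _)).congr_deriv (by simp only [Complex.real_smul])

variable {ς ℓ t X : ℝ}

/-- Beyond the falling region both primitives have reached their total integrals, and dividing by
the second one makes them cancel. The solution thereby has compact support. -/
theorem amplitude_eq_zero (hℓ : 2 ≤ ℓ) (hJ : primitive (statWave t) 2 ≠ 0)
    (hX : ς * X ≤ 1 ∨ 3 / 2 * ℓ ≤ ς * X) : amplitude ς ℓ t X = 0 := by
  have hℓ0 : 0 < ℓ := by linarith
  have hq : ς / ℓ * X = ς * X / ℓ := by ring
  rw [amplitude, hq]
  rcases hX with h | h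
  · rw [primitive_eq_zero zero_le_one (fun u hu => unitMass_eq_zero (Or.inl hu)) h,
      primitive_eq_zero (a := 1 / 2) (v := ς * X / ℓ) (by norm_num) (fun u hu => statWave_eq_zero t (Or.inl hu))
        (by rw [div_le_iff₀ hℓ0]; linarith)]
    simp
  · rw [primitive_unitMass (by linarith), primitive_eq_of_le (contDiff_statWave t).continuous
      (a := 3 / 2) (v := ς * X / ℓ) (w := 2) (fun u hu => statWave_eq_zero t (Or.inr hu))
        (by rw [le_div_iff₀ hℓ0]; linarith) (by norm_num), inv_mul_cancel₀ hJ, sub_self]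

theorem amplitude_eq_one (hℓ : 0 < ℓ) (h1 : 2 ≤ ς * X) (h2 : ς * X ≤ ℓ / 2) :
    amplitude ς ℓ t X = 1 := by
  have hq : ς / ℓ * X = ς * X / ℓ := by ring
  rw [amplitude, hq, primitive_unitMass h1,
    primitive_eq_zero (a := 1 / 2) (v := ς * X / ℓ) (by norm_num) (fun u hu => statWave_eq_zero t (Or.inl hu))
      (by rw [div_le_iff₀ hℓ]; linarith)]
  simp

end Profile

/-! ### Functions of the first coordinate with a cutoff in the others -/

namespace TestFn
variable {m : ℕ}

/-- A cutoff in the coordinates other than the first. -/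
def tailBump (m : ℕ) : ContDiffBump (0 : Fin m → ℝ) := ⟨1, 2, one_pos, one_lt_two⟩

/-- A function of the first coordinate times a fixed cutoff in the others. -/
def prodFn (m : ℕ) (F : ℝ → ℂ) (hF : ContDiff ℝ ∞ F) (hc : HasCompactSupport F) : TestFn (m + 1) :=
  ⟨fun x => F (x 0) * ((tailBump m (Fin.tail x) : ℝ) : ℂ), by
    have ht : ContDiff ℝ ∞ (fun x : Fin (m + 1) → ℝ => Fin.tail x) :=
      contDiff_pi.2 fun k => contDiff_apply ℝ ℝ k.succ
    refine ⟨(hF.comp (contDiff_apply ℝ ℝ 0)).mul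
      (Complex.ofRealCLM.contDiff.comp ((tailBump m).contDiff.comp ht)), ?_⟩
    have hcont : Continuous fun p : ℝ × (Fin m → ℝ) => (Fin.cons p.1 p.2 : Fin (m + 1) → ℝ) :=
      continuous_pi fun k => by
        refine Fin.cases ?_ (fun k => ?_) k
        · simpa using continuous_fst
        · simp only [Fin.cons_succ]
          exact (continuous_apply k).comp continuous_snd
    refine HasCompactSupport.intro
      ((hc.isCompact.prod (tailBump m).hasCompactSupport.isCompact).image hcont) fun x hx => ?_
    by_contra h
    refine hx ⟨(x 0, Fin.tail x), ⟨subset_tsupport _ (left_ne_zero_of_mul h), subset_tsupport _ ?_⟩,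
      Fin.cons_self_tail x⟩
    exact_mod_cast right_ne_zero_of_mul h⟩

theorem prodFn_apply (F : ℝ → ℂ) (hF : ContDiff ℝ ∞ F) (hc : HasCompactSupport F)
    (x : Fin (m + 1) → ℝ) :
    (prodFn m F hF hc).1 x = F (x 0) * ((tailBump m (Fin.tail x) : ℝ) : ℂ) := rfl

theorem le_of_mem_tsupport_prodFn {F : ℝ → ℂ} {hF : ContDiff ℝ ∞ F} {hc : HasCompactSupport F}
    {ς a : ℝ} (h : ∀ u, F u ≠ 0 → a ≤ ς * u) {x : Fin (m + 1) → ℝ}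
    (hx : x ∈ tsupport (prodFn m F hF hc).1) : a ≤ ς * x 0 := by
  have hcl : IsClosed {x : Fin (m + 1) → ℝ | a ≤ ς * x 0} :=
    isClosed_le continuous_const (continuous_const.mul (continuous_apply 0))
  exact closure_minimal (fun x hx => h _ (left_ne_zero_of_mul hx)) hcl hx

theorem ne_zero_of_mem_tsupport_prodFn {F : ℝ → ℂ} {hF : ContDiff ℝ ∞ F} {hc : HasCompactSupport F}
    {ς a : ℝ} (ha : 0 < a) (h : ∀ u, F u ≠ 0 → a ≤ ς * u) :
    ∀ x ∈ tsupport (prodFn m F hF hc).1, x 0 ≠ 0 := by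
  intro x hx h0
  have := le_of_mem_tsupport_prodFn h hx
  rw [h0, mul_zero] at this
  linarith

theorem pd_prodFn {F F' : ℝ → ℂ} (hF : ContDiff ℝ ∞ F) (hc : HasCompactSupport F)
    (h : ∀ u, HasDerivAt F (F' u) u) (x : Fin (m + 1) → ℝ) :
    (pd 0 (prodFn m F hF hc)).1 x = F' (x 0) * ((tailBump m (Fin.tail x) : ℝ) : ℂ) := by
  change fderiv ℝ (prodFn m F hF hc).1 x (Pi.single 0 1) = _
  have hd := (prodFn m F hF hc).2.1.differentiable (by simp) x
  rw [← hd.lineDeriv_eq_fderiv]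
  have hl : HasDerivAt (fun τ : ℝ => x 0 + τ) 1 0 := by
    simpa using (hasDerivAt_id (0 : ℝ)).const_add (x 0)
  have h1 : HasDerivAt (fun τ : ℝ => F (x 0 + τ)) (F' (x 0)) 0 := by
    have h2 : HasDerivAt F (F' (x 0)) (x 0 + 0) := by rw [add_zero]; exact h (x 0)
    exact (HasDerivAt.scomp (0 : ℝ) h2 hl).congr_deriv (one_smul ℝ _)
  refine Eq.trans ?_ (h1.mul_const ((tailBump m (Fin.tail x) : ℝ) : ℂ)).deriv
  unfold lineDeriv
  congr 1
  funext τ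
  rw [prodFn_apply]
  have e1 : (x + τ • Pi.single 0 1 : Fin (m + 1) → ℝ) 0 = x 0 + τ := by simp
  have e2 : Fin.tail (x + τ • Pi.single 0 1 : Fin (m + 1) → ℝ) = Fin.tail x := by
    funext k; simp [Fin.tail]
  rw [e1, e2]

end TestFn

/-! ### Phase and modulus of the multiplier -/

section Multiplier
variable {d : ℕ}

theorem multiplier_one (odd : Bool) (t : ℝ) : multiplier d odd t 1 = 1 := by
  rw [multiplier_of_pos odd t one_pos]; simp

theorem multiplier_inv (odd : Bool) (t : ℝ) {a : ℝ} (ha : a ≠ 0) :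
    multiplier d odd t a⁻¹ = (multiplier d odd t a)⁻¹ := by
  refine eq_inv_of_mul_eq_one_left ?_
  rw [← multiplier_mul odd t _ _ (inv_ne_zero ha) ha, inv_mul_cancel₀ ha, multiplier_one]

/-- On positive arguments `t` enters only through the phase `y^{-it}`; removing it leaves the
multiplier of the even series at `t = 0`. -/
theorem multiplier_mul_phase (odd : Bool) (t : ℝ) {y : ℝ} (hy : 0 < y) :
    multiplier d odd t y * Complex.exp ((t * Real.log y : ℝ) * Complex.I) =
      multiplier d false 0 y := by
  rw [multiplier_of_pos odd t hy, multiplier_of_pos false 0 hy, ← Complex.exp_add]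
  congr 1
  push_cast; ring

theorem multiplier_sign_mul {ς : ℝ} (hς : ς = 1 ∨ ς = -1) (y : ℝ) :
    multiplier d false 0 (ς * y) = multiplier d false 0 y := by
  rcases hς with rfl | rfl <;> simp [multiplier, lineChar]

theorem norm_multiplier_sign (odd : Bool) (t : ℝ) {ς : ℝ} (hς : ς = 1 ∨ ς = -1) :
    ‖multiplier d odd t ς‖ = 1 := by
  have h := norm_multiplier_sq (d := d) odd t ς (by rcases hς with rfl | rfl <;> norm_num)
  have h1 : |ς| = 1 := by rcases hς with rfl | rfl <;> simp
  rw [h1, one_pow, inv_one] at h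
  exact (pow_eq_one_iff_of_nonneg (norm_nonneg _) two_ne_zero).1 h

end Multiplier

/-! ### The solution, its right hand side and their images in the second chart -/

namespace TestFn
variable {m : ℕ}

theorem hasCompactSupport_of_sign {F : ℝ → ℂ} {ς b : ℝ} (hς : ς = 1 ∨ ς = -1)
    (h : ∀ u, F u ≠ 0 → 0 ≤ ς * u ∧ ς * u ≤ b) : HasCompactSupport F := by
  refine HasCompactSupport.intro (isCompact_Icc (a := -b) (b := b)) fun u hu => ?_
  by_contra hne
  obtain ⟨h1, h2⟩ := h u hne
  refine hu ?_
  rcases hς with rfl | rfl <;> constructor <;> linarith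

/-- The character of the line with frequency `lam`. -/
def planeWave (lam u : ℝ) : ℂ := Complex.exp ((lam * u : ℝ) * Complex.I)

theorem hasDerivAt_planeWave (lam u : ℝ) :
    HasDerivAt (planeWave lam) (lam * Complex.I * planeWave lam u) u := by
  have h : HasDerivAt (fun u : ℝ => lam * u) lam u := by
    simpa using (hasDerivAt_id u).const_mul lam
  refine (h.ofReal_comp.mul_const Complex.I).cexp.congr_deriv ?_
  rw [planeWave]; ring

theorem contDiff_planeWave (lam : ℝ) : ContDiff ℝ ∞ (planeWave lam) :=
  ((Complex.ofRealCLM.contDiff.comp (contDiff_const.mul contDiff_id)).mul contDiff_const).cexp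

theorem statWave_ne_zero {t z : ℝ} (h : statWave t z ≠ 0) : 1 / 2 < z ∧ z < 3 / 2 := by
  by_contra hz
  refine h (statWave_eq_zero t ?_)
  by_contra! h'
  exact hz h'

theorem statAmp_ne_zero {z : ℝ} (h : ((statAmp z : ℝ) : ℂ) ≠ 0) : 1 / 2 < z ∧ z < 3 / 2 := by
  by_contra hz
  refine h ?_
  rw [statAmp_eq_zero, Complex.ofReal_zero]
  by_contra! h'
  exact hz h'

theorem unitMass_ne_zero {u : ℝ} (h : unitMass u ≠ 0) : 1 < u ∧ u < 2 := by
  by_contra hz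
  refine h (unitMass_eq_zero ?_)
  by_contra! h'
  exact hz h'

theorem amplitude_ne_zero {ς ℓ t X : ℝ} (hℓ : 2 ≤ ℓ) (hJ : primitive (statWave t) 2 ≠ 0)
    (h : amplitude ς ℓ t X ≠ 0) : 1 < ς * X ∧ ς * X < 3 / 2 * ℓ := by
  by_contra hz
  refine h (amplitude_eq_zero hℓ hJ ?_)
  by_contra! h'
  exact hz h'

/-- The part of the right hand side of the twisted equation near the origin. -/
def riseFn (m : ℕ) (lam ς : ℝ) (hς : ς = 1 ∨ ς = -1) : TestFn (m + 1) :=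
  prodFn m (fun u => planeWave lam u * unitMass (ς * u))
    ((contDiff_planeWave lam).mul (contDiff_unitMass.comp (contDiff_const.mul contDiff_id)))
    (hasCompactSupport_of_sign (b := 2) hς fun u hu => by
      have := unitMass_ne_zero (right_ne_zero_of_mul hu)
      constructor <;> linarith)

/-- The part of the right hand side of the twisted equation far from the origin. -/
def fallFn (m : ℕ) (lam ς ℓ t : ℝ) (hς : ς = 1 ∨ ς = -1) (hℓ : 0 < ℓ) : TestFn (m + 1) :=
  prodFn m (fun u => planeWave lam u * statWave t (ς / ℓ * u))
    ((contDiff_planeWave lam).mul ((contDiff_statWave t).comp (contDiff_const.mul contDiff_id)))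
    (hasCompactSupport_of_sign (b := 3 / 2 * ℓ) hς fun u hu => by
      have := statWave_ne_zero (right_ne_zero_of_mul hu)
      rw [div_mul_eq_mul_div, lt_div_iff₀ hℓ, div_lt_iff₀ hℓ] at this
      constructor <;> linarith)

/-- The solution of the twisted equation. -/
def solFn (m : ℕ) (lam ς ℓ t : ℝ) (hς : ς = 1 ∨ ς = -1) (hℓ : 2 ≤ ℓ)
    (hJ : primitive (statWave t) 2 ≠ 0) : TestFn (m + 1) :=
  prodFn m (fun u => planeWave lam u * amplitude ς ℓ t u)
    ((contDiff_planeWave lam).mul (contDiff_amplitude ς ℓ t))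
    (hasCompactSupport_of_sign (b := 3 / 2 * ℓ) hς fun u hu => by
      have := amplitude_ne_zero hℓ hJ (right_ne_zero_of_mul hu)
      constructor <;> linarith)

theorem contDiff_ofReal_statAmp (ς : ℝ) : ContDiff ℝ ∞ fun u => ((statAmp (ς * u) : ℝ) : ℂ) :=
  Complex.ofRealCLM.contDiff.comp (contDiff_statAmp.comp (contDiff_const.mul contDiff_id))

/-- The image under the chart change and a dilation of the far part of the right hand side. -/
def statFn (m : ℕ) (ς : ℝ) (hς : ς = 1 ∨ ς = -1) : TestFn (m + 1) :=
  prodFn m (fun u => ((statAmp (ς * u) : ℝ) : ℂ))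
    (contDiff_ofReal_statAmp ς)
    (hasCompactSupport_of_sign (b := 2) hς fun u hu => by
      have := statAmp_ne_zero hu
      constructor <;> linarith)

variable {lam ς ℓ t : ℝ} (hς : ς = 1 ∨ ς = -1)

theorem solFn_support (hℓ : 2 ≤ ℓ) (hJ : primitive (statWave t) 2 ≠ 0) :
    ∀ x ∈ tsupport (solFn m lam ς ℓ t hς hℓ hJ).1, x 0 ≠ 0 :=
  ne_zero_of_mem_tsupport_prodFn one_pos fun _ hu =>
    (amplitude_ne_zero hℓ hJ (right_ne_zero_of_mul hu)).1.le

theorem fallFn_support (hℓ : 0 < ℓ) :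
    ∀ x ∈ tsupport (fallFn m lam ς ℓ t hς hℓ).1, x 0 ≠ 0 := by
  refine ne_zero_of_mem_tsupport_prodFn (ς := ς) (a := ℓ / 2) (by positivity) fun u hu => ?_
  have := (statWave_ne_zero (right_ne_zero_of_mul hu)).1
  rw [div_mul_eq_mul_div, lt_div_iff₀ hℓ] at this
  linarith

theorem statFn_support : ∀ x ∈ tsupport (statFn m ς hς).1, x 0 ≠ 0 :=
  ne_zero_of_mem_tsupport_prodFn (a := 1 / 2) (by norm_num) fun _ hu => (statAmp_ne_zero hu).1.le

/-- The plane wave solves the homogeneous equation, so only the derivative of the amplitude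
survives: a rising part and a falling part. -/
theorem twisted_solFn (hℓ : 2 ≤ ℓ) (hJ : primitive (statWave t) 2 ≠ 0) (κ : ℝ) :
    (-κ : ℂ) • pd 0 (solFn m lam ς ℓ t hς hℓ hJ) +
        (((κ * lam : ℝ) : ℂ) * Complex.I) • solFn m lam ς ℓ t hς hℓ hJ =
      (-κ * ς : ℂ) • riseFn m lam ς hς +
        (κ * (primitive (statWave t) 2)⁻¹ * (ς / ℓ : ℝ) : ℂ) •
          fallFn m lam ς ℓ t hς (by linarith) := by
  ext x
  change (-κ : ℂ) * (pd 0 (solFn m lam ς ℓ t hς hℓ hJ)).1 x + _ * (_ * _ * _) =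
    _ * (_ * _ * _) + _ * (_ * _ * _)
  rw [solFn, pd_prodFn (F := fun u => planeWave lam u * amplitude ς ℓ t u) _ _
    fun u => (hasDerivAt_planeWave lam u).mul (hasDerivAt_amplitude ς ℓ t u)]
  push_cast
  ring

/-- The relation between `t`, `lam` and `ℓ` makes the plane wave `e^{-itz}`, leaving `e^{-it log z}`
of the phase `t(z - log z)`. That is exactly the inverse of the oscillation of the multiplier, so up
to a scalar and the dilation nothing depends on `t`. -/
theorem flipFn_fallFn (odd : Bool) (hℓ : 0 < ℓ) (ht : t = -(lam * (ς * ℓ))) :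
    flipFn odd t (fallFn m lam ς ℓ t hς hℓ) (fallFn_support hς hℓ) =
      (multiplier (m + 1) odd t ς * (multiplier (m + 1) odd t ℓ)⁻¹) •
        dil ℓ hℓ.ne' (flipFn false 0 (statFn m ς hς) (statFn_support hς)) := by
  have hς2 : ς * ς = 1 := by rcases hς with rfl | rfl <;> norm_num
  have hς0 : ς ≠ 0 := by rcases hς with rfl | rfl <;> norm_num
  ext x
  change (flipFn odd t (fallFn m lam ς ℓ t hς hℓ) (fallFn_support hς hℓ)).1 x =
    _ * (flipFn false 0 (statFn m ς hς) (statFn_support hς)).1 (ℓ • x)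
  rw [flipFn_apply, flipFn_apply, fallFn, statFn, prodFn_apply, prodFn_apply]
  simp only [if_true, Pi.smul_apply, smul_eq_mul]
  have htail : (Fin.tail fun k : Fin (m + 1) => (if k = 0 then 1 else ℓ * x k) / (-(ℓ * x 0))) =
      Fin.tail fun k : Fin (m + 1) => (if k = 0 then 1 else x k) / (-x 0) := by
    funext k
    simp only [Fin.tail, Fin.succ_ne_zero, if_false]
    rw [← mul_neg, mul_div_mul_left _ _ hℓ.ne']
  rw [htail]
  set η := (((tailBump m) (Fin.tail fun k : Fin (m + 1) => (if k = 0 then 1 else x k) / (-x 0)) : ℝ) : ℂ)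
  have hz : ς * (1 / -(ℓ * x 0)) = ς / ℓ * (1 / -x 0) := by
    rw [← mul_neg, one_div, mul_inv]; ring
  rw [hz]
  set z := ς / ℓ * (1 / -x 0) with hzdef
  by_cases h0 : statAmp z = 0
  · rw [statWave, h0]; simp
  · have hz0 : 0 < z := by
      have := (statAmp_ne_zero (Complex.ofReal_ne_zero.2 h0)).1
      linarith
    have hx0 : x 0 ≠ 0 := by
      rintro h; rw [hzdef, h] at hz0; simp at hz0
    have hy : -x 0 = ς * (z⁻¹ * ℓ⁻¹) := by
      rw [hzdef]; field_simp
    have hy2 : -(ℓ * x 0) = ς * z⁻¹ := by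
      rw [← mul_neg, hy]; field_simp
    have hph : planeWave lam (1 / -x 0) * statWave t z =
        Complex.exp ((t * Real.log z⁻¹ : ℝ) * Complex.I) * statAmp z := by
      have e : lam * (1 / -x 0) = -(t * z) := by
        rw [ht, hzdef]; field_simp; linear_combination lam * hς2
      rw [planeWave, statWave, ← mul_assoc, ← Complex.exp_add, e, Real.log_inv]
      congr 2
      push_cast; ring
    rw [hph, hy2, multiplier_sign_mul hς, ← multiplier_mul_phase odd t (inv_pos.2 hz0), hy,
      multiplier_mul odd t _ _ hς0 (by positivity),
      multiplier_mul odd t _ _ (by positivity) (by positivity), multiplier_inv odd t hℓ.ne']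
    ring

/-- The far part of the right hand side is a multiple of a translate of a fixed test function. -/
theorem exists_rep_fallFn (odd : Bool) (g : Matrix.SpecialLinearGroup (Fin (m + 2)) ℝ) {s : ℝ}
    (hs : 0 < s) (hℓ : 0 < ℓ) (hsℓ : s ^ (m + 1 + 1) = ℓ) (ht : t = -(lam * (ς * ℓ))) :
    ∃ c : ℂ, ‖c‖ ^ 2 = ℓ ∧ indRep (m + 1) odd t g (vec (fallFn m lam ς ℓ t hς hℓ)) =
      c • indRep (m + 1) odd t (g * flip m * (dilation (m + 1) s hs.ne')⁻¹)
        (vec (flipFn false 0 (statFn m ς hς) (statFn_support hς))) := by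
  refine ⟨multiplier (m + 1) odd t ς * (multiplier (m + 1) odd t s)⁻¹, ?_, ?_⟩
  · rw [norm_mul, norm_multiplier_sign odd t hς, one_mul, norm_inv, inv_pow,
      norm_multiplier_sq odd t s hs.ne', inv_inv, abs_of_pos hs, hsℓ]
  · rw [indRep_vec_eq_flipFn odd t g _ (fallFn_support hς hℓ), flipFn_fallFn hς odd hℓ ht,
      indRep_dilation_inv_vec, ← map_smul, ← map_smul, smul_smul]
    -- Split `ℓ = s · s^{m+1}`: the second factor belongs to the unitary action of the dilation, and
    -- the first leaves a scalar of modulus `√ℓ`.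
    have h1 : multiplier (m + 1) odd t ς * (multiplier (m + 1) odd t ℓ)⁻¹ =
        multiplier (m + 1) odd t ς * (multiplier (m + 1) odd t s)⁻¹ *
          multiplier (m + 1) odd t (s ^ (m + 1))⁻¹ := by
      have e : ℓ = s * s ^ (m + 1) := by rw [← hsℓ]; ring
      rw [e, multiplier_mul odd t _ _ hs.ne' (by positivity), multiplier_inv odd t (by positivity),
        mul_inv]
      ring
    rw [h1]
    subst hsℓ
    rfl

/-- The limiting profile of the solution in the second chart. -/
def limitProfile (m : ℕ) (q : Fin (m + 1) → ℝ) : ℂ :=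
  multiplier (m + 1) false 0 (-q 0) * ((tailBump m (fun k => q k.succ / (-q 0)) : ℝ) : ℂ)

/-- The window `-7 ≤ q ≤ -3` for `q = ςℓ x₀` corresponds to first-chart distances between `ℓ/7` and
`ℓ/3`, inside the plateau from 2 to `ℓ/2` once `ℓ ≥ 16`. There the plane wave gives the phase `t/q`
and the multiplier gives `-t log(-q)`. -/
theorem flipFn_solFn_apply (odd : Bool) (hℓ : 16 ≤ ℓ) (hJ : primitive (statWave t) 2 ≠ 0)
    (ht : t = -(lam * (ς * ℓ))) {x : Fin (m + 1) → ℝ} (h1 : -7 ≤ ς * ℓ * x 0)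
    (h2 : ς * ℓ * x 0 ≤ -3) :
    (flipFn odd t (solFn m lam ς ℓ t hς (by linarith) hJ) (solFn_support hς _ hJ)).1 x =
      multiplier (m + 1) odd t (ς * ℓ)⁻¹ * oscFactor t (ς * ℓ * x 0) *
        limitProfile m ((ς * ℓ) • x) := by
  have hς2 : ς * ς = 1 := by rcases hς with rfl | rfl <;> norm_num
  have hς0 : ς ≠ 0 := by rcases hς with rfl | rfl <;> norm_num
  have hL : ς * ℓ ≠ 0 := mul_ne_zero hς0 (by linarith)
  rw [flipFn_apply, solFn, prodFn_apply, limitProfile]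
  simp only [if_true, Pi.smul_apply, smul_eq_mul]
  have htail : (fun k : Fin m => ς * ℓ * x k.succ / (-(ς * ℓ * x 0))) =
      Fin.tail fun k : Fin (m + 1) => (if k = 0 then 1 else x k) / (-x 0) := by
    funext k
    simp only [Fin.tail, Fin.succ_ne_zero, if_false]
    rw [← mul_neg, mul_div_mul_left _ _ hL]
  rw [htail]
  set η := (((tailBump m) (Fin.tail fun k : Fin (m + 1) => (if k = 0 then 1 else x k) / (-x 0)) : ℝ) : ℂ)
  set q := ς * ℓ * x 0 with hq
  have hx0 : x 0 ≠ 0 := by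
    intro h; rw [hq, h, mul_zero] at h2; linarith
  have hq0 : q < 0 := by linarith
  have hX : ς * (1 / -x 0) = ℓ / -q := by
    rw [hq]; field_simp; linear_combination (-1 : ℝ) * hς2
  have hA : amplitude ς ℓ t (1 / -x 0) = 1 := by
    refine amplitude_eq_one (by linarith) ?_ ?_
    · rw [hX, le_div_iff₀ (by linarith)]; linarith
    · rw [hX, div_le_iff₀ (by linarith)]; nlinarith
  have hw : planeWave lam (1 / -x 0) = Complex.exp ((t * q⁻¹ : ℝ) * Complex.I) := by
    rw [planeWave]
    congr 3
    rw [ht, hq]; field_simp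
  have hm : multiplier (m + 1) odd t (-x 0) =
      multiplier (m + 1) odd t (ς * ℓ)⁻¹ * multiplier (m + 1) odd t (-q) := by
    rw [← multiplier_mul odd t _ _ (inv_ne_zero hL) (by linarith)]
    congr 1
    rw [hq]; field_simp
  have hosc : oscFactor t q * Complex.exp ((t * Real.log (-q) : ℝ) * Complex.I) =
      Complex.exp ((t * q⁻¹ : ℝ) * Complex.I) := by
    rw [oscFactor, ← Complex.exp_add]
    congr 1
    push_cast; ring
  rw [hA, hw, hm, ← multiplier_mul_phase odd t (y := -q) (by linarith), ← hosc]
  ring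

/-- A test function on whose support the solution has its limiting profile. -/
theorem exists_windowFn (m : ℕ) : ∃ b : TestFn (m + 1),
    (∀ x ∈ tsupport b.1, -7 ≤ x 0 ∧ x 0 ≤ -3) ∧
      ∫ x, (starRingEnd ℂ) (b.1 x) * limitProfile m x ≠ 0 := by
  set c : Fin (m + 1) → ℝ := Pi.single 0 (-5) with hc
  set w : ContDiffBump c := ⟨1, 2, one_pos, one_lt_two⟩ with hw
  set b : TestFn (m + 1) := ⟨fun x => ((w x : ℝ) : ℂ), Complex.ofRealCLM.contDiff.comp w.contDiff,
    w.hasCompactSupport.comp_left (g := fun r : ℝ => (r : ℂ)) Complex.ofReal_zero⟩ with hb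
  have hsupp : ∀ x ∈ tsupport b.1, -7 ≤ x 0 ∧ x 0 ≤ -3 := by
    intro x hx
    have h1 : x ∈ tsupport w := closure_mono (fun y hy => by
      intro h; exact hy (by simp [hb, h])) hx
    rw [w.tsupport_eq, Metric.mem_closedBall] at h1
    have h2 := (dist_le_pi_dist x c 0).trans h1
    have h3 : w.rOut = 2 := rfl
    have h4 : c 0 = -5 := Pi.single_eq_same _ _
    rw [Real.dist_eq, h4, h3] at h2
    have := abs_le.1 h2
    constructor <;> linarith [this.1, this.2]
  refine ⟨b, hsupp, ?_⟩
  -- The limiting profile carries no oscillation, so the integrand is real and nonnegative, and it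
  -- is positive at the centre of the window.
  set ρ : (Fin (m + 1) → ℝ) → ℝ := fun x =>
    w x * (|-x 0| ^ (-(((m + 1 : ℕ) : ℝ) + 1) / 2) * tailBump m (fun k => x k.succ / (-x 0))) with hρ
  have hpt : ∀ x, (starRingEnd ℂ) (b.1 x) * limitProfile m x = ((ρ x : ℝ) : ℂ) := by
    intro x
    simp only [hb, hρ, limitProfile, multiplier, lineChar, Complex.conj_ofReal]
    simp
  simp only [hpt]
  rw [integral_complex_ofReal, Complex.ofReal_ne_zero]
  have hwc : Function.support ρ ⊆ tsupport b.1 := fun x hx => subset_tsupport _ (by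
    have : w x ≠ 0 := left_ne_zero_of_mul hx
    simpa [hb] using this)
  have hcont : Continuous ρ := by
    refine continuous_iff_continuousAt.2 fun x => ?_
    by_cases hx : x ∈ tsupport b.1
    · have hx0 : -x 0 ≠ 0 := by have := (hsupp x hx).2; linarith
      have h0 : ContinuousAt (fun x : Fin (m + 1) → ℝ => -x 0) x :=
        (continuous_apply 0).neg.continuousAt
      refine w.continuous.continuousAt.mul (ContinuousAt.mul ?_ ?_)
      · exact h0.abs.rpow_const (Or.inl (abs_ne_zero.2 hx0))
      · exact (tailBump m).continuous.continuousAt.comp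
          (continuousAt_pi.2 fun k => (continuous_apply k.succ).continuousAt.div h0 hx0)
    · refine (continuousAt_const (y := (0 : ℝ))).congr ?_
      filter_upwards [(isClosed_tsupport b.1).isOpen_compl.mem_nhds hx] with y hy
      by_contra h
      exact hy (hwc (Ne.symm h))
  have hρ0 : 0 ≤ ρ := fun x => mul_nonneg w.nonneg
    (mul_nonneg (Real.rpow_nonneg (abs_nonneg _) _) (tailBump m).nonneg)
  refine (hcont.integral_pos_of_hasCompactSupport_nonneg_nonzero
    (b.2.2.mono' hwc) hρ0 (x := c) ?_).ne'
  have hc0 : c 0 = -5 := Pi.single_eq_same _ _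
  have h1 : w c = 1 := w.one_of_mem_closedBall (Metric.mem_closedBall_self w.rIn_pos.le)
  have h2 : (fun k : Fin m => c k.succ / (-c 0)) = 0 := by
    funext k
    simp [hc]
  have h3 : tailBump m 0 = 1 :=
    (tailBump m).one_of_mem_closedBall (Metric.mem_closedBall_self (tailBump m).rIn_pos.le)
  simp only [hρ]
  rw [h1, h2, h3, hc0]
  positivity

end TestFn

/-! ### Combining the upper and lower bounds -/

section Assembly
variable {d m : ℕ}
open TestFn

theorem foldr_dRep_add (odd : Bool) (t : ℝ) (g : Matrix.SpecialLinearGroup (Fin (d + 1)) ℝ)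
    (w : List (BasisIdx d)) (f f' : TestFn d) :
    w.foldr (dRep (indRep d odd t)) (indRep d odd t g (vec (f + f'))) =
      w.foldr (dRep (indRep d odd t)) (indRep d odd t g (vec f)) +
        w.foldr (dRep (indRep d odd t)) (indRep d odd t g (vec f')) := by
  rw [foldr_dRep_rep_vec, foldr_dRep_rep_vec, foldr_dRep_rep_vec, map_add, map_add, map_add]

theorem foldr_dRep_smul (odd : Bool) (t : ℝ) (g : Matrix.SpecialLinearGroup (Fin (d + 1)) ℝ)
    (w : List (BasisIdx d)) (c : ℂ) (f : TestFn d) :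
    w.foldr (dRep (indRep d odd t)) (indRep d odd t g (vec (c • f))) =
      c • w.foldr (dRep (indRep d odd t)) (indRep d odd t g (vec f)) := by
  rw [foldr_dRep_rep_vec, foldr_dRep_rep_vec, map_smul, map_smul, map_smul]

/-- The rising part is a fixed test function, the falling part a multiple of a fixed test function
moved by a group element depending on `t`. For both, conjugation leaves the basis of size `O(1 +
|t|)`. -/
theorem exists_foldr_dRep_le (g : Matrix.SpecialLinearGroup (Fin (m + 2)) ℝ) {lam ς : ℝ}
    (hlam : lam ≠ 0) (hς : ς = 1 ∨ ς = -1) : ∃ (C : ℕ → ℝ) (M t₁ : ℝ), 1 ≤ M ∧ 1 ≤ t₁ ∧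
      ∀ (odd : Bool) (t ℓ κ : ℝ) (hℓ : 16 ≤ ℓ), t = -(lam * (ς * ℓ)) → t₁ ≤ |t| → κ ^ 2 = 1 →
        primitive (statWave t) 2 ≠ 0 ∧ ∀ w : List (BasisIdx (m + 1)),
          ‖w.foldr (dRep (indRep (m + 1) odd t)) (indRep (m + 1) odd t g (vec
            ((-κ * ς : ℂ) • riseFn m lam ς hς +
              (κ * (primitive (statWave t) 2)⁻¹ * (ς / ℓ : ℝ) : ℂ) •
                fallFn m lam ς ℓ t hς (by linarith))))‖ ≤
            C w.length * (M * (1 + |t|)) ^ w.length := by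
  obtain ⟨cJ, hcJ, t₀, ht₀, hJ⟩ := norm_integral_statWave_ge
  have hΛ : 0 < |lam| := abs_pos.2 hlam
  obtain ⟨M₁, hM₁, hw₁⟩ := exists_rowWeight_conjVec_le g hΛ
  obtain ⟨M₂, hM₂, hw₂⟩ := exists_rowWeight_conjVec_le (g * flip m) hΛ
  have h1 := fun k => norm_foldr_dRep_le k (riseFn m lam ς hς)
  have h2 := fun k => norm_foldr_dRep_le k (flipFn false 0 (statFn m ς hς) (statFn_support hς))
  choose C₁ hC₁ h1 using h1
  choose C₂ hC₂ h2 using h2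
  refine ⟨fun k => C₁ k + √|lam| / cJ * C₂ k, max M₁ M₂, t₀, le_max_of_le_left hM₁, ht₀,
    fun odd t ℓ κ hℓ ht htt hκ => ?_⟩
  have hℓ0 : 0 < ℓ := by linarith
  have hς1 : |ς| = 1 := by rcases hς with rfl | rfl <;> simp
  have hT : |t| = |lam| * ℓ := by
    rw [ht, abs_neg, abs_mul, abs_mul, hς1, one_mul, abs_of_pos hℓ0]
  have ht0 : 0 < |t| := by rw [hT]; positivity
  have hJt : cJ / √|t| ≤ ‖primitive (statWave t) 2‖ := hJ t htt
  have hJ0 : 0 < ‖primitive (statWave t) 2‖ := lt_of_lt_of_le (by positivity) hJt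
  refine ⟨norm_pos_iff.1 hJ0, fun w => ?_⟩
  set R := max M₁ M₂ * (1 + |t|) with hR
  have hR0 : 0 ≤ R := by
    have : 0 ≤ max M₁ M₂ := le_max_of_le_left (by linarith)
    positivity
  -- The group element with parameter `s` dilates by `s^{m+2}`, which is to be `ℓ`.
  set s := ℓ ^ (1 / ((m + 1 + 1 : ℕ) : ℝ)) with hs
  have hs0 : 0 < s := Real.rpow_pos_of_pos hℓ0 _
  have hsℓ : s ^ (m + 1 + 1) = ℓ := by
    rw [hs, ← Real.rpow_natCast, ← Real.rpow_mul hℓ0.le, one_div_mul_cancel (by positivity),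
      Real.rpow_one]
  obtain ⟨c, hc, hrep⟩ := exists_rep_fallFn hς odd g hs0 hℓ0 hsℓ ht
  have hrise := h1 w.length odd t g R (fun b => ((hw₁ t b).1).trans
    (mul_le_mul_of_nonneg_right (le_max_left _ _) (by positivity))) w rfl
  have hfall := h2 w.length odd t (g * flip m * (dilation (m + 1) s hs0.ne')⁻¹) R (fun b =>
    ((hw₂ t b).2 s hs0.ne' hs0 (by rw [hsℓ]; linarith) (by rw [hsℓ, hT, mul_div_cancel_left₀ _ hΛ.ne'])).trans
      (mul_le_mul_of_nonneg_right (le_max_right _ _) (by positivity))) w rfl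
  have hκ1 : |κ| = 1 := by
    rw [← abs_one, ← sq_eq_sq_iff_abs_eq_abs, hκ, one_pow]
  -- The balance of powers: stationary phase costs `√|t|`, the slope gives `1/ℓ` and the unitary
  -- normalisation `√ℓ`. As `|t| = |lam| ℓ`, the product is bounded.
  have hcoef : ‖(κ * (primitive (statWave t) 2)⁻¹ * (ς / ℓ : ℝ) : ℂ)‖ * ‖c‖ ≤ √|lam| / cJ := by
    have hcn : ‖c‖ = √ℓ := by rw [← hc, Real.sqrt_sq (norm_nonneg _)]
    rw [norm_mul, norm_mul, Complex.norm_real, Complex.norm_real, norm_inv, Real.norm_eq_abs,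
      Real.norm_eq_abs, hκ1, one_mul, abs_div, hς1, abs_of_pos hℓ0, hcn]
    have hsl : 0 < √ℓ := Real.sqrt_pos.2 hℓ0
    have hsq : √ℓ * √ℓ = ℓ := Real.mul_self_sqrt hℓ0.le
    have h3 : ‖primitive (statWave t) 2‖⁻¹ ≤ √|t| / cJ := by
      rw [← inv_div]
      exact inv_anti₀ (by positivity) hJt
    calc _ ≤ √|t| / cJ * (1 / ℓ) * √ℓ := by gcongr
      _ = √|lam| / cJ * (√ℓ * √ℓ / ℓ) := by
          rw [hT, Real.sqrt_mul hΛ.le]; ring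
      _ = √|lam| / cJ := by rw [hsq, div_self hℓ0.ne', mul_one]
  rw [foldr_dRep_add, foldr_dRep_smul, foldr_dRep_smul, hrep, ← map_smul, ← map_smul,
    foldr_dRep_smul]
  refine (norm_add_le _ _).trans ?_
  rw [norm_smul, norm_smul, norm_smul, ← mul_assoc]
  have ha : ‖(-κ * ς : ℂ)‖ = 1 := by
    rw [norm_mul, norm_neg, Complex.norm_real, Complex.norm_real, Real.norm_eq_abs,
      Real.norm_eq_abs, hκ1, hς1, one_mul]
  rw [ha, one_mul, add_mul, mul_assoc (√|lam| / cJ)]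
  have hlast : 0 ≤ C₂ w.length * R ^ w.length := mul_nonneg (hC₂ _) (pow_nonneg hR0 _)
  exact add_le_add hrise (mul_le_mul hcoef hfall (norm_nonneg _) (by positivity))

/-- A family of smooth solutions of the twisted equation along which the norms of the right hand
sides are controlled by those of the unipotent direction of the solutions. -/
theorem exists_solution_family (i j : Fin (m + 2)) (hij : i ≠ j) {lam : ℝ} (hlam : lam ≠ 0) {ε : ℝ}
    (hε : ε = 1 ∨ ε = -1) : ∃ (C : ℕ → ℝ) (M t₁ : ℝ), 1 ≤ M ∧ 1 ≤ t₁ ∧ ∀ s : ℝ, 0 ≤ s →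
      ∃ c : ℝ, 0 < c ∧ ∀ (odd : Bool) (t : ℝ), t₁ ≤ |t| → 0 < ε * t → ∃ f g : Model (m + 1),
        IsSmoothTwistedSolution (indRep (m + 1) odd t) i j hij lam f g ∧
        (∀ k, wordNormSq (indRep (m + 1) odd t) k g ≤ C k * (M * (1 + |t|)) ^ (2 * k)) ∧
        c * |t| ^ (2 * s + 1 / 2) ≤ besselNorm
          (fun τ => indRep (m + 1) odd t (oneParam (root j i hij.symm) τ)) s f ∧
        ∀ S : ℕ, 1 ≤ S → besselNorm
          (fun τ => indRep (m + 1) odd t (oneParam (root j i hij.symm) τ)) S f ≤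
            √(2 ^ S) * √(wordNormSq (indRep (m + 1) odd t) S f) := by
  obtain ⟨g, κ, κ', hκ, hκ', hg, hg'⟩ := exists_adapted_element i j hij
  have hκ0 : κ ≠ 0 := by rintro rfl; norm_num at hκ
  set μ := κ * lam with hμ
  have hμ0 : μ ≠ 0 := mul_ne_zero hκ0 hlam
  have hΛ : 0 < |μ| := abs_pos.2 hμ0
  -- The direction of the solution is chosen from the signs of `t` and `μ`, so that `t = -μςℓ` holds
  -- with `ℓ = |t|/|μ|` positive.
  obtain ⟨ς, hς, hςε⟩ : ∃ ς : ℝ, (ς = 1 ∨ ς = -1) ∧ ς * μ = -ε * |μ| := by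
    rcases lt_or_gt_of_ne hμ0 with h | h
    · exact ⟨ε, hε, by rw [abs_of_neg h]; ring⟩
    · refine ⟨-ε, ?_, by rw [abs_of_pos h]⟩
      rcases hε with rfl | rfl <;> simp
  have hε2 : ε * ε = 1 := by rcases hε with rfl | rfl <;> norm_num
  have hς1 : |ς| = 1 := by rcases hς with rfl | rfl <;> simp
  obtain ⟨C, M, t₁, hM, ht₁, hC⟩ := exists_foldr_dRep_le g hμ0 hς
  obtain ⟨b, hb, hA⟩ := exists_windowFn m
  have hbl : LeftSupp b := fun x hx => by linarith [(hb x hx).2]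
  refine ⟨fun k => ∑ n ∈ Finset.range (k + 1), (Fintype.card (Fin n → BasisIdx (m + 1)) : ℝ) *
    C n ^ 2, M, max t₁ (16 * |μ|), hM, le_max_of_le_left ht₁, fun s hs => ?_⟩
  obtain ⟨c₀, hc₀, hlow⟩ := exists_le_integral_freqWeight b hbl (limitProfile m) hA hs hΛ
  -- The squared scalar `ℓ^{m+2}` and the volume factor `ℓ^{-(m+1)}` of the lower bound leave `ℓ =
  -- |t|/|μ|`; its square root is the extra `|t|^{1/2}`.
  refine ⟨√(c₀ / |μ|), by positivity, fun odd t ht hεt => ?_⟩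
  have ht1 : t₁ ≤ |t| := (le_max_left _ _).trans ht
  have ht16 : 16 * |μ| ≤ |t| := (le_max_right _ _).trans ht
  have ht0 : 0 < |t| := by linarith
  set ℓ := |t| / |μ| with hℓdef
  have hℓ : 16 ≤ ℓ := by rw [hℓdef, le_div_iff₀ hΛ]; exact ht16
  have habs : |t| = ε * t := by
    rcases hε with rfl | rfl
    · rw [one_mul] at hεt ⊢; exact abs_of_pos hεt
    · rw [abs_of_neg (by linarith)]; ring
  have htl : t = -(μ * (ς * ℓ)) := by
    have h1 : |μ| * ℓ = |t| := by rw [hℓdef]; field_simp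
    calc t = ε * ε * t := by rw [hε2, one_mul]
      _ = ε * |t| := by rw [habs]; ring
      _ = -((-ε * |μ|) * ℓ) := by rw [← h1]; ring
      _ = _ := by rw [← hςε]; ring
  have hLabs : |ς * ℓ| = |t| / |μ| := by rw [abs_mul, hς1, one_mul, abs_of_pos (by linarith)]
  obtain ⟨hJ, hword⟩ := hC odd t ℓ κ hℓ htl ht1 hκ
  have h2ℓ : 2 ≤ ℓ := by linarith
  set F := solFn m μ ς ℓ t hς h2ℓ hJ with hF
  set G := (-κ * ς : ℂ) • riseFn m μ ς hς + (κ * (primitive (statWave t) 2)⁻¹ * (ς / ℓ : ℝ) : ℂ) •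
    fallFn m μ ς ℓ t hς (by linarith) with hG
  set H := flipFn odd t F (solFn_support hς _ hJ) with hH
  have hf : indRep (m + 1) odd t g (vec F) = indRep (m + 1) odd t (g * flip m) (vec H) :=
    indRep_vec_eq_flipFn odd t g F _
  have hR : 1 ≤ M * (1 + |t|) := by nlinarith
  refine ⟨indRep (m + 1) odd t g (vec F), indRep (m + 1) odd t g (vec G),
    ⟨isSmoothVec_rep_vec odd t g F, isSmoothVec_rep_vec odd t g G, ?_⟩,
    fun k => wordNormSq_le _ C k hR hword, ?_, fun S hS => ?_⟩
  · have hlamκ : κ * μ = lam := by rw [hμ]; linear_combination lam * hκ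
    have hGF : G = (-κ : ℂ) • pd 0 F + ((lam : ℂ) * Complex.I) • F := by
      rw [hG, ← twisted_solFn hς h2ℓ hJ κ, hlamκ]
    rw [dRep_rep_vec, hg, liOp_single, LinearMap.smul_apply, hGF, map_add vec, map_add,
      map_smul vec (_ * _), map_smul _ (_ * _)]
  · rw [hf]
    have hbes := besselNorm_rep_vec odd t (g * flip m) ⟨(j, i), hij.symm⟩ 0 κ' hκ' hg' s H
    refine le_trans ?_ (le_of_eq hbes.symm)
    have hl := hlow t (ς * ℓ) (by linarith) hLabs (multiplier (m + 1) odd t (ς * ℓ)⁻¹) H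
      fun x hx => by
        have hx' := hb _ hx
        exact flipFn_solFn_apply hς odd hℓ hJ htl hx'.1 hx'.2
    have hL0 : ς * ℓ ≠ 0 := abs_pos.1 (by rw [hLabs]; positivity)
    rw [norm_multiplier_sq odd t _ (inv_ne_zero hL0), abs_inv, hLabs] at hl
    refine le_trans (le_of_eq ?_) (Real.sqrt_le_sqrt hl)
    have e1 : |t| ^ (2 * s + 1 / 2) = √(|t| * |t| ^ (4 * s)) := by
      rw [Real.sqrt_eq_rpow, ← Real.rpow_one_add' ht0.le (by linarith), ← Real.rpow_mul ht0.le]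
      congr 1
      ring
    rw [e1, ← Real.sqrt_mul (by positivity)]
    congr 1
    rw [inv_pow, inv_inv, pow_succ]
    field_simp
  · rw [hf]
    exact besselNorm_le_wordNormSq odd t (g * flip m) ⟨(j, i), hij.symm⟩ 0 κ' hκ' hg' hS H

/-- The estimate for the right hand sides against the solutions, along a family with parameters of
a fixed sign. -/
theorem exists_large_solution (i j : Fin (m + 2)) (hij : i ≠ j) {lam : ℝ} (hlam : lam ≠ 0) {ε : ℝ}
    (hε : ε = 1 ∨ ε = -1) {s σ : ℝ} (hs : 0 ≤ s) (hσ : 0 ≤ σ) (hσs : σ < s + 1 / 2) (K : ℝ) :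
    ∃ δ : ℝ, 0 < δ ∧ ∀ (odd : Bool) (t : ℝ), δ < |t| → 0 < ε * t → ∃ f g : Model (m + 1),
      IsSmoothTwistedSolution (indRep (m + 1) odd t) i j hij lam f g ∧
      K * sobolevNorm (indRep (m + 1) odd t) (s + σ) g < besselNorm
        (fun τ => indRep (m + 1) odd t (oneParam (root j i hij.symm) τ)) s f ∧
      ∀ S : ℕ, 1 ≤ S → besselNorm
        (fun τ => indRep (m + 1) odd t (oneParam (root j i hij.symm) τ)) S f ≤
          √(2 ^ S) * √(wordNormSq (indRep (m + 1) odd t) S f) := by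
  obtain ⟨C, M, t₁, hM, ht₁, hfam⟩ := exists_solution_family i j hij hlam hε
  obtain ⟨c, hc, hfam⟩ := hfam s hs
  obtain ⟨D, hD, hsob⟩ := sobolevNorm_le (d := m + 1) (H := Model (m + 1)) C (add_nonneg hs hσ)
  set B := |K| * D * (2 * M) ^ (s + σ) with hB
  have hpos : 0 < s + 1 / 2 - σ := by linarith
  -- The orders compete as `2s + 1/2` against `s + σ`; their difference `s + 1/2 - σ` is positive,
  -- so it beats any constant `B/c`.
  obtain ⟨t₂, ht₂⟩ := Filter.eventually_atTop.1
    ((tendsto_rpow_atTop hpos).eventually_gt_atTop (B / c))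
  refine ⟨max t₁ t₂, lt_of_lt_of_le (by linarith) (le_max_left _ _), fun odd t ht hεt => ?_⟩
  have h1 : t₁ ≤ |t| := (le_max_left _ _).trans ht.le
  have ht0 : 0 < |t| := by linarith
  obtain ⟨f, g, hsol, hg, hbes, hS⟩ := hfam odd t h1 hεt
  refine ⟨f, g, hsol, ?_, hS⟩
  have h2 := hsob (indRep (m + 1) odd t) g (M * (1 + |t|)) (by positivity) hsol.2.1 hg
  have h3 : (M * (1 + |t|)) ^ (s + σ) ≤ (2 * M) ^ (s + σ) * |t| ^ (s + σ) := by
    rw [← Real.mul_rpow (by positivity) ht0.le]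
    exact Real.rpow_le_rpow (by positivity) (by nlinarith) (add_nonneg hs hσ)
  have h4 := ht₂ |t| ((le_max_right _ _).trans ht.le)
  rw [div_lt_iff₀ hc] at h4
  have hsn : 0 ≤ sobolevNorm (indRep (m + 1) odd t) (s + σ) g := by
    rw [sobolevNorm]; split_ifs <;> exact Real.sqrt_nonneg _
  calc K * sobolevNorm (indRep (m + 1) odd t) (s + σ) g
      ≤ |K| * (D * ((2 * M) ^ (s + σ) * |t| ^ (s + σ))) :=
        mul_le_mul (le_abs_self K) (h2.trans (mul_le_mul_of_nonneg_left h3 hD)) hsn (abs_nonneg K)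
    _ = B * |t| ^ (s + σ) := by rw [hB]; ring
    _ < |t| ^ (s + 1 / 2 - σ) * c * |t| ^ (s + σ) :=
        mul_lt_mul_of_pos_right h4 (Real.rpow_pos_of_pos ht0 _)
    _ = c * |t| ^ (2 * s + 1 / 2) := by
        rw [mul_comm _ c, mul_assoc, ← Real.rpow_add ht0]; congr 2; ring
    _ ≤ _ := hbes

end Assembly

end SLRep
end

/-! ### The theorem -/

open SLRep
theorem theorem9p1 (d : ℕ) (hd : 2 ≤ d + 1) (i j : Fin (d + 1)) (hij : j < i) :
    (∀ s σ lam : ℝ, 0 ≤ s → 0 ≤ σ → σ < s + 1 / 2 → lam ≠ 0 →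
      ∀ C : ℝ, 0 < C → ∃ δ : ℝ, 0 < δ ∧ ∀ (odd : Bool) (t : ℝ), δ < |t| →
        ∃ f g : Model d,
          IsSmoothTwistedSolution (indRep d odd t) i j hij.ne' lam f g ∧
          C * sobolevNorm (indRep d odd t) (s + σ) g <
            besselNorm (fun τ => indRep d odd t (oneParam (root j i hij.ne) τ)) s f) ∧
    (∀ lam : ℝ, lam ≠ 0 → ∀ odd : Bool,
      ¬ ∃ r : ℝ, 0 ≤ r ∧ ∀ s : ℝ, 0 ≤ s → ∃ C : ℝ, ∀ (t : ℝ) (f g : Model d),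
          IsSmoothTwistedSolution (indRep d odd t) i j hij.ne' lam f g →
          sobolevNorm (indRep d odd t) s f ≤ C * sobolevNorm (indRep d odd t) (s + r) g) := by
  obtain ⟨m, rfl⟩ : ∃ m, d = m + 1 := ⟨d - 1, by omega⟩
  constructor
  · intro s σ lam hs hσ hσs hlam C _
    obtain ⟨δ₁, hδ₁, h₁⟩ :=
      exists_large_solution i j hij.ne' hlam (Or.inl rfl : (1 : ℝ) = 1 ∨ _) hs hσ hσs C
    obtain ⟨δ₂, _, h₂⟩ :=
      exists_large_solution i j hij.ne' hlam (Or.inr rfl : (-1 : ℝ) = 1 ∨ _) hs hσ hσs C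
    -- The families for positive and negative `t` have separate thresholds.
    refine ⟨max δ₁ δ₂, lt_max_of_lt_left hδ₁, fun odd t ht => ?_⟩
    rcases lt_trichotomy t 0 with h | h | h
    · obtain ⟨f, g, h3, h4, -⟩ := h₂ odd t ((le_max_right _ _).trans_lt ht) (by linarith)
      exact ⟨f, g, h3, h4⟩
    · rw [h, abs_zero] at ht
      exact absurd (lt_max_of_lt_left hδ₁) (not_lt.2 ht.le)
    · obtain ⟨f, g, h3, h4, -⟩ := h₁ odd t ((le_max_left _ _).trans_lt ht) (by linarith)
      exact ⟨f, g, h3, h4⟩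
  · rintro lam hlam odd ⟨r, hr, H⟩
    -- With `S ≥ r` the loss `σ = r` is below `S + 1/2`, so the construction applies at `s = S`. As
    -- `S` is a positive integer, the Sobolev norm of `f` is a word norm and dominates the norm in
    -- the direction `u_{j,i}`.
    obtain ⟨S, hS⟩ := exists_nat_ge (max 1 r)
    have hS1 : 1 ≤ S := by exact_mod_cast (le_max_left _ _).trans hS
    have hSr : r ≤ S := (le_max_right _ _).trans hS
    obtain ⟨C, hC⟩ := H S (Nat.cast_nonneg S)
    obtain ⟨δ, hδ, h⟩ := exists_large_solution i j hij.ne' hlam (Or.inl rfl : (1 : ℝ) = 1 ∨ _)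
      -- This constant combines the supposed tame estimate with the comparison factor `√(2^S)`; a
      -- single large `t` then gives the contradiction.
      (Nat.cast_nonneg S) hr (by linarith) (√(2 ^ S) * C)
    obtain ⟨f, g, hsol, hlt, hle⟩ := h odd (δ + 1) (by rw [abs_of_pos] <;> linarith) (by linarith)
    have h1 := hC _ f g hsol
    have h2 : sobolevNorm (indRep (m + 1) odd (δ + 1)) S f =
        √(wordNormSq (indRep (m + 1) odd (δ + 1)) S f) := by
      simp [sobolevNorm]
    rw [h2] at h1
    have h3 := (hle S hS1).trans (mul_le_mul_of_nonneg_left h1 (Real.sqrt_nonneg _))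
    rw [← mul_assoc] at h3
    exact absurd hlt (not_lt.2 h3)
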